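/- Let $\alpha\in[-1,1]$, $\beta\in(-1,1)$, $P>0$, and let $\{Z_i\}_{i\ge1}$ be a stationary zero-mean Gaussian process with power spectral density $S_Z(e^{i\theta})=\left|\frac{1+\alpha e^{i\theta}}{1+\beta e^{i\theta}}\right|^2$. Consider the channel $Y_i=X_i+Z_i$ with feedback. A feedback code of rate $R$ and block length $n$ consists of $M_n=\lceil 2^{nR}\rceil$ messages, measurable encoding functions $X_i(w,Y^{i-1})$, $1\le i\le n$, and a measurable decoder $\mathbb R^n\to\{1,\dots,M_n\}$. The message is uniform and independent of the noise; the average power is $\frac1n\sum_{i=1}^n E X_i^2$, and $P_e^{(n)}$ is the probability of decoding error. The feedback capacity $C_{\rm FB}$ (in bits) is the supremum of the rates $R$ for which there are codes of average power at most $P$ for every $n$ with $P_e^{(n)}\to0$. Put $\sigma=1$ if $\beta\ge\alpha$ and $\sigma=-1$ otherwise. Then the equation $$P x^2=\frac{(1-x^2)(1+\sigma\alpha x)^2}{(1+\sigma\beta x)^2}$$ has exactly one positive root $x_0$ (with $1+\sigma\beta x_0\ne0$), and the following hold. (a) (Gaussian message.) Let $V\sim N(0,1)$ be independent of $\{Z_i\}$,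 let $\hat V_n=E(V\mid Y_1,\dots,Y_n)$ (so $\hat V_0=0$), and let $X_n=(\sigma x_0)^{-(n-1)}(V-\hat V_{n-1})$ for $n\ge1$ (so $X_1=V$). Then $$\liminf_{n\to\infty}\frac1n I(V;\hat V_n)\ge-\log_2x_0\ \text{(in bits)},\qquad \limsup_{n\to\infty}\frac1n\sum_{i=1}^nE X_i^2\le P .$$ (b) (Equally spaced constellation.) For a real number $\theta$ let $X_1=\theta$ and $X_{n}=(\sigma x_0)^{-(n-1)}(\theta-\hat\theta_{n-1})$ for $n\ge2$, where $\hat\theta_{n}$ is a minimum variance unbiased linear estimate of $\theta$ from $Y_1,\dots,Y_n$. Such estimates exist, and there is a constant $c_0>0$ such that the following holds for every $R\ge0$. Use this scheme with block length $n$ to send one of the $M_n$ points $-1,-1+\delta,\dots,1-\delta,1$, $\delta=2/(M_n-1)$ (only the point $-1$ if $M_n=1$). Then the limit superior, as $n\to\infty$, of its average power is at most $P$. For every $n\ge1$, nearest-point decoders (choosing a constellation point closest to $\hat\theta_n$) exist; a decoder is a maximum-likelihood decoder (for Lebesgue-almost every output $y^n$) if and only if it is a nearest-point decoder for almost every $y^n$;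 and every maximum-likelihood decoder has $$P_e^{(n)}\le\operatorname{erfc}\left(\sqrt{c_0\,x_0^{-2n}/2^{2nR}}\right),\qquad \operatorname{erfc}(x)=\frac{2}{\sqrt\pi}\int_x^\infty e^{-t^2}\,dt .$$ If moreover $R<-\log_2x_0$, the error probability decays doubly exponentially: there are $a>0$ and $\rho>1$ with $P_e^{(n)}\le\exp(-a\rho^n)$ for all $n\ge1$ and every maximum-likelihood decoder. (c) $C_{\rm FB}=-\log_2x_0$. Hence the scheme achieves the feedback capacity of the first-order ARMA Gaussian channel. -/

import Mathlib

open MeasureTheory ProbabilityTheory Filter Topology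
open scoped ENNReal

/-! Time is indexed from `0`: index `i` stands for the `(i+1)`-st channel use, so that the input at
index `i` may depend on exactly `i` previous outputs. -/

/-- The first-order ARMA power spectral density
`S_Z(e^{iθ}) = |(1 + α e^{iθ}) / (1 + β e^{iθ})|²`. -/
noncomputable def armaSpectrum (α β θ : ℝ) : ℝ :=
  ‖(1 + (α : ℂ) * Complex.exp (θ * Complex.I)) / (1 + (β : ℂ) * Complex.exp (θ * Complex.I))‖ ^ 2

/-- `Z` is a stationary zero-mean Gaussian process with (even) power spectral density `S`:
`E Z_i Z_j = (1/2π) ∫_{-π}^{π} S(θ) e^{i(i-j)θ} dθ`, the integral being real because `S` is even. -/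
structure IsGaussianNoise {Ω : Type*} [MeasurableSpace Ω] (μ : Measure Ω) (Z : ℕ → Ω → ℝ)
    (S : ℝ → ℝ) : Prop where
  measurable : ∀ i, Measurable (Z i)
  gaussian : IsGaussianProcess Z μ
  mean_zero : ∀ i, ∫ ω, Z i ω ∂μ = 0
  covariance : ∀ i j : ℕ, cov[Z i, Z j; μ] =
    (2 * Real.pi)⁻¹ *
      ∫ θ in (-Real.pi)..Real.pi, S θ * Real.cos (((i : ℝ) - (j : ℝ)) * θ)

/-- A (causal) feedback encoding of one message: the input at index `i` as a function of the
`i` previous channel outputs. -/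
abbrev FeedbackMap : Type := (i : ℕ) → (Fin i → ℝ) → ℝ

/-- The outputs `Y_i = X_i + Z_i` of the feedback channel when the inputs are
`X_i = f i (Y_0, …, Y_{i-1})` and the noise realization is `z`. -/
noncomputable def channelOutput (f : FeedbackMap) (z : ℕ → ℝ) : ℕ → ℝ
  | i => f i (fun j : Fin i => channelOutput f z j) + z i
termination_by i => i
decreasing_by exact j.isLt

/-- The first `n` outputs of the feedback channel. -/
noncomputable def outputBlock (f : FeedbackMap) (z : ℕ → ℝ) (n : ℕ) : Fin n → ℝ :=
  fun j => channelOutput f z j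

/-- The input `X_i = f i (Y_0, …, Y_{i-1})` of the feedback channel. -/
noncomputable def channelInput (f : FeedbackMap) (z : ℕ → ℝ) (i : ℕ) : ℝ :=
  f i (outputBlock f z i)

/-- A feedback code with `M` messages and block length `n`
(only `enc w i` with `i < n` is ever used). -/
structure FeedbackCode (n M : ℕ) where
  enc : Fin M → FeedbackMap
  measurable_enc : ∀ w i, Measurable (enc w i)
  dec : (Fin n → ℝ) → Fin M
  measurable_dec : Measurable dec

section Code

variable {Ω : Type*} [MeasurableSpace Ω] (μ : Measure Ω) (Z : ℕ → Ω → ℝ)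

/-- The average power `(1/n) ∑_{i<n} E X_i²` of an encoder, where the message is uniform on `Fin M`
and independent of the noise. -/
noncomputable def avgPower {M : ℕ} (n : ℕ) (enc : Fin M → FeedbackMap) : ℝ≥0∞ :=
  (∑ i ∈ Finset.range n, (∑ w : Fin M,
    ∫⁻ ω, ENNReal.ofReal ((channelInput (enc w) (fun k => Z k ω) i) ^ 2) ∂μ) / (M : ℝ≥0∞))
    / (n : ℝ≥0∞)

/-- The probability of error, where the message is uniform on `Fin M` and independent of the
noise. -/
noncomputable def FeedbackCode.errorProb {n M : ℕ} (c : FeedbackCode n M) : ℝ :=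
  (∑ w : Fin M, μ.real {ω | c.dec (outputBlock (c.enc w) (fun k => Z k ω) n) ≠ w}) / (M : ℝ)

/-- The number `⌈2^{nR}⌉` of messages at rate `R` (bits per channel use) and block length `n`. -/
noncomputable def numMessages (n : ℕ) (R : ℝ) : ℕ := ⌈(2 : ℝ) ^ ((n : ℝ) * R)⌉₊

/-- `R` (in bits) is achievable with feedback over the channel with noise `Z` under power `P`. -/
def IsAchievable (P R : ℝ) : Prop :=
  ∃ c : (n : ℕ) → FeedbackCode n (numMessages n R),
    (∀ n, avgPower μ Z n (c n).enc ≤ ENNReal.ofReal P) ∧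
    Tendsto (fun n => (c n).errorProb μ Z) atTop (𝓝 0)

/-- The feedback capacity (in bits): the supremum of all achievable rates. -/
noncomputable def feedbackCapacity (P : ℝ) : EReal :=
  ⨆ (R : ℝ) (_ : IsAchievable μ Z P R), (R : EReal)

/-- The law of the `n` outputs when message `w` is sent. -/
noncomputable def FeedbackCode.outputLaw {n M : ℕ} (c : FeedbackCode n M) (w : Fin M) :
    Measure (Fin n → ℝ) :=
  μ.map (fun ω => outputBlock (c.enc w) (fun k => Z k ω) n)

/-- The decoder of `c` is a maximum-likelihood decoder: given each message the outputs have a density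
`p(· | w)` with respect to Lebesgue measure, and the decoder picks a maximizer of `p(y | ·)`
for almost every `y`. -/
def FeedbackCode.IsMaximumLikelihood {n M : ℕ} (c : FeedbackCode n M) : Prop :=
  (∀ w, c.outputLaw μ Z w ≪ volume) ∧
  ∀ᵐ y ∂(volume : Measure (Fin n → ℝ)), ∀ w,
    (c.outputLaw μ Z w).rnDeriv volume y ≤ (c.outputLaw μ Z (c.dec y)).rnDeriv volume y

/-! ### The scheme with a Gaussian message -/

/-- Minimum mean-squared error estimate `E(V | Y_0, …, Y_{n-1})`. -/
noncomputable def mmseEstimate (V : Ω → ℝ) (n : ℕ) (Y : Fin n → Ω → ℝ) : Ω → ℝ :=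
  μ[V | MeasurableSpace.comap (fun ω k => Y k ω) (MeasurableSpace.pi : MeasurableSpace (Fin n → ℝ))]

/-- The outputs `Y_n = X_n + Z_n` of the linear scheme with ratio `r`: the input at index `n` (the
`(n+1)`-st channel use) is `X_n = r^{-n} (V - E(V | Y_0, …, Y_{n-1}))`. -/
noncomputable def gaussianSchemeOutput (V : Ω → ℝ) (r : ℝ) : ℕ → Ω → ℝ
  | n => fun ω =>
      (r ^ n)⁻¹ * (V ω - mmseEstimate μ V n (fun k : Fin n => gaussianSchemeOutput V r k) ω) + Z n ω
termination_by n => n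
decreasing_by exact k.isLt

/-- The receiver's estimate `V̂` after `n` channel uses of the linear scheme. -/
noncomputable def gaussianSchemeEstimate (V : Ω → ℝ) (r : ℝ) (n : ℕ) : Ω → ℝ :=
  mmseEstimate μ V n (fun k : Fin n => gaussianSchemeOutput μ Z V r k)

/-- The input of the linear scheme at index `n`. -/
noncomputable def gaussianSchemeInput (V : Ω → ℝ) (r : ℝ) (n : ℕ) (ω : Ω) : ℝ :=
  (r ^ n)⁻¹ * (V ω - gaussianSchemeEstimate μ Z V r n ω)

/-- Mutual information of two real random variables, in bits: the relative entropy of the joint law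
with respect to the product of the marginals. -/
noncomputable def mutualInfoBits (A B : Ω → ℝ) : ℝ≥0∞ :=
  InformationTheory.klDiv (μ.map (fun ω => (A ω, B ω))) ((μ.map A).prod (μ.map B))
    / ENNReal.ofReal (Real.log 2)

/-! ### The scheme with an equally spaced constellation -/

/-- The linear scheme for a real number `t`, with ratio `r` and linear estimators `est`: the
input at index `i` is `X_i = r^{-i} (t - est_i(Y_0, …, Y_{i-1}))`; in particular `X_0 = t`. -/
noncomputable def schemeMap (r : ℝ) (est : (i : ℕ) → (Fin i → ℝ) →ₗ[ℝ] ℝ) (t : ℝ) : FeedbackMap :=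
  fun i y => (r ^ i)⁻¹ * (t - est i y)

/-- `est i` is, for every `i ≥ 1`, a minimum variance unbiased linear estimator of the real
parameter `t` from the first `i` outputs of the linear scheme that uses the estimators `est`. -/
def IsMinVarUnbiasedLinear (r : ℝ) (est : (i : ℕ) → (Fin i → ℝ) →ₗ[ℝ] ℝ) : Prop :=
  ∀ i, 1 ≤ i →
    (∀ t : ℝ, ∫ ω, est i (outputBlock (schemeMap r est t) (fun k => Z k ω) i) ∂μ = t) ∧
    ∀ L : (Fin i → ℝ) →ₗ[ℝ] ℝ,
      (∀ t : ℝ, ∫ ω, L (outputBlock (schemeMap r est t) (fun k => Z k ω) i) ∂μ = t) →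
      ∀ t : ℝ, Var[fun ω => est i (outputBlock (schemeMap r est t) (fun k => Z k ω) i); μ] ≤
        Var[fun ω => L (outputBlock (schemeMap r est t) (fun k => Z k ω) i); μ]

end Code

/-- The equally spaced constellation `-1, -1 + δ, …, 1 - δ, 1` of `M` points, `δ = 2 / (M - 1)`
(a single point if `M = 1`). -/
noncomputable def constellation (M : ℕ) (w : Fin M) : ℝ :=
  -1 + (w : ℝ) * (2 / ((M : ℝ) - 1))

/-- `w` is a message whose constellation point is closest to `s`. -/
def IsNearestPoint {M : ℕ} (s : ℝ) (w : Fin M) : Prop :=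
  ∀ w' : Fin M, |constellation M w - s| ≤ |constellation M w' - s|

/-- The feedback code that sends constellation points with the linear scheme, with decoder `D`. -/
noncomputable def schemeCode (r : ℝ) (est : (i : ℕ) → (Fin i → ℝ) →ₗ[ℝ] ℝ) {n M : ℕ}
    (D : (Fin n → ℝ) → Fin M) (hD : Measurable D) : FeedbackCode n M where
  enc w := schemeMap r est (constellation M w)
  measurable_enc _ i :=
    ((LinearMap.continuous_of_finiteDimensional (est i)).measurable.const_sub _).const_mul _
  dec := D
  measurable_dec := hD

/-- The complementary error function `erfc(x) = (2/√π) ∫_x^∞ exp(-t²) dt`. -/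
noncomputable def erfc (x : ℝ) : ℝ :=
  2 / Real.sqrt Real.pi * ∫ t in Set.Ioi x, Real.exp (-t ^ 2)

/-- `σ = 1` if `β ≥ α` and `σ = -1` otherwise. -/
noncomputable def armaSign (α β : ℝ) : ℝ := if α ≤ β then 1 else -1

/-- `x` is a positive root of `P x² = (1 - x²)(1 + σαx)² / (1 + σβx)²`. -/
def IsArmaRoot (α β P x : ℝ) : Prop :=
  0 < x ∧ 1 + armaSign α β * β * x ≠ 0 ∧
    P * x ^ 2 = (1 - x ^ 2) * (1 + armaSign α β * α * x) ^ 2 / (1 + armaSign α β * β * x) ^ 2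

/-! ### Unit triangular changes of variables -/

/-- The unit lower triangular change of variables `y ↦ (y_i - h_i(y_0, …, y_{i-1}))_i`. -/
def shear (h : FeedbackMap) (n : ℕ) (y : Fin n → ℝ) : Fin n → ℝ :=
  fun i => y i - h i (fun j : Fin i => y (j.castLE i.isLt.le))

lemma shear_outputBlock (f : FeedbackMap) (z : ℕ → ℝ) (n : ℕ) :
    shear f n (outputBlock f z n) = fun i : Fin n => z i := by
  funext i
  simp only [shear, outputBlock]
  rw [channelOutput]
  simp

lemma measurable_shear {h : FeedbackMap} (hh : ∀ i, Measurable (h i)) (n : ℕ) :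
    Measurable (shear h n) := by
  refine measurable_pi_lambda _ fun i => (measurable_pi_apply i).sub ((hh i).comp ?_)
  exact measurable_pi_lambda _ fun j => measurable_pi_apply _

lemma shear_injective (h : FeedbackMap) (n : ℕ) : Function.Injective (shear h n) := by
  intro y y' hyy
  have key : ∀ k (hk : k < n), y ⟨k, hk⟩ = y' ⟨k, hk⟩ := by
    intro k
    induction k using Nat.strong_induction_on with
    | _ k ih =>
      intro hk
      have h1 := congrFun hyy ⟨k, hk⟩
      simp only [shear] at h1
      have h2 : (fun j : Fin k => y (j.castLE hk.le)) = fun j : Fin k => y' (j.castLE hk.le) := by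
        funext j
        exact ih j j.isLt _
      have h3 : h k (fun j : Fin k => y (j.castLE hk.le)) =
          h k (fun j : Fin k => y' (j.castLE hk.le)) := by rw [h2]
      linarith
  funext i
  exact key i i.isLt

lemma measurableEmbedding_shear {h : FeedbackMap} (hh : ∀ i, Measurable (h i)) (n : ℕ) :
    MeasurableEmbedding (shear h n) :=
  (measurable_shear hh n).measurableEmbedding (shear_injective h n)

lemma shear_measurePreserving {h : FeedbackMap} (hh : ∀ i, Measurable (h i)) (n : ℕ) :
    MeasurePreserving (shear h n) volume volume := by
  induction n with
  | zero =>
    have : shear h 0 = id := by funext y i; exact i.elim0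
    rw [this]; exact MeasurePreserving.id _
  | succ n ih =>
    have e := volume_preserving_piFinSuccAbove (fun _ : Fin (n + 1) => ℝ) (Fin.last n)
    set E := MeasurableEquiv.piFinSuccAbove (fun _ : Fin (n + 1) => ℝ) (Fin.last n) with hE
    have hsk : MeasurePreserving
        (fun p : (Fin n → ℝ) × ℝ => (shear h n p.1, p.2 - h n p.1))
        (volume.prod volume) (volume.prod volume) := by
      refine ih.skew_product (g := fun y t => t - h n y) ?_ (ae_of_all _ fun y => ?_)
      · exact measurable_snd.sub ((hh n).comp measurable_fst)
      · exact (measurePreserving_sub_right volume (h n y)).map_eq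
    have hsw : MeasurePreserving (Prod.swap : ℝ × (Fin n → ℝ) → _)
        (volume.prod volume) (volume.prod volume) := Measure.measurePreserving_swap
    have hsw' : MeasurePreserving (Prod.swap : (Fin n → ℝ) × ℝ → _)
        (volume.prod volume) (volume.prod volume) := Measure.measurePreserving_swap
    have hc := (e.symm E).comp (hsw'.comp (hsk.comp (hsw.comp e)))
    refine (congrArg (fun F => MeasurePreserving F volume volume) (funext fun y => ?_)).mp hc
    simp only [Function.comp]
    rw [MeasurableEquiv.symm_apply_eq]
    have : ∀ y : Fin (n + 1) → ℝ, E y = (y (Fin.last n), fun j : Fin n => y j.castSucc) := by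
      intro y
      ext j
      · rfl
      · simp [hE, MeasurableEquiv.piFinSuccAbove, Fin.init]
    rw [this, this]
    rfl

lemma map_eq_withDensity_of_shear {Ω : Type*} [MeasurableSpace Ω] {μ : Measure Ω} {h : FeedbackMap} (hh : ∀ i, Measurable (h i))
    {n : ℕ} {Y : Ω → Fin n → ℝ} (hY : Measurable Y) {ρ : (Fin n → ℝ) → ℝ≥0∞}
    (hρ : μ.map (fun ω => shear h n (Y ω)) = volume.withDensity ρ) :
    μ.map Y = volume.withDensity (fun y => ρ (shear h n y)) := by
  have he := measurableEmbedding_shear hh n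
  ext A hA
  rw [withDensity_apply _ hA, Measure.map_apply hY hA,
    (shear_measurePreserving hh n).setLIntegral_comp_emb he ρ A,
    ← withDensity_apply _ (he.measurableSet_image.2 hA), ← hρ,
    Measure.map_apply (f := fun ω => shear h n (Y ω)) ((measurable_shear hh n).comp hY)
      (he.measurableSet_image.2 hA)]
  congr 1
  ext ω
  simp [(shear_injective h n).mem_set_image]

lemma measurable_channelOutput {f : FeedbackMap} (hf : ∀ i, Measurable (f i)) (i : ℕ) :
    Measurable fun z : ℕ → ℝ => channelOutput f z i := by
  induction i using Nat.strong_induction_on with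
  | _ i ih =>
    have : (fun z : ℕ → ℝ => channelOutput f z i) =
        fun z => f i (fun j : Fin i => channelOutput f z j) + z i := by
      funext z; rw [channelOutput]
    rw [this]
    exact ((hf i).comp (measurable_pi_lambda _ fun j => ih j j.isLt)).add (measurable_pi_apply i)

lemma measurable_outputBlock {f : FeedbackMap} (hf : ∀ i, Measurable (f i)) (n : ℕ) :
    Measurable fun z : ℕ → ℝ => outputBlock f z n :=
  measurable_pi_lambda _ fun j => measurable_channelOutput hf j

lemma measurable_channelInput {f : FeedbackMap} (hf : ∀ i, Measurable (f i)) (i : ℕ) :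
    Measurable fun z : ℕ → ℝ => channelInput f z i :=
  (hf i).comp (measurable_outputBlock hf i)

/-- The outputs before time `i` depend only on the noise before time `i`. -/
lemma channelOutput_congr (f : FeedbackMap) {z z' : ℕ → ℝ} {i : ℕ} (h : ∀ k ≤ i, z k = z' k) :
    channelOutput f z i = channelOutput f z' i := by
  induction i using Nat.strong_induction_on with
  | _ i ih =>
    rw [channelOutput, channelOutput, h i le_rfl]
    have : (fun j : Fin i => channelOutput f z j) = fun j : Fin i => channelOutput f z' j := by
      funext j
      exact ih j j.isLt fun k hk => h k (hk.trans j.isLt.le)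
    rw [this]

lemma channelOutput_eq (f : FeedbackMap) (z : ℕ → ℝ) (i : ℕ) :
    channelOutput f z i = channelInput f z i + z i := by
  rw [channelOutput]; rfl

lemma outputBlock_congr (f : FeedbackMap) {z z' : ℕ → ℝ} {n : ℕ} (h : ∀ k < n, z k = z' k) :
    outputBlock f z n = outputBlock f z' n := by
  funext j
  exact channelOutput_congr f fun k hk => h k (hk.trans_lt j.isLt)

/-! ### First-order recursive linear filters -/

/-- The prediction, from `z_0, …, z_{i-1}`, made by the causal filter whose residuals `e_i` satisfy
`e_{i+1} = z_{i+1} + b z_i - g_i e_i`. -/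
noncomputable def predictor (b : ℝ) (g : ℕ → ℝ) : (i : ℕ) → (Fin i → ℝ) →ₗ[ℝ] ℝ
  | 0 => 0
  | i + 1 => (-b) • LinearMap.proj (Fin.last i) + g i • (LinearMap.proj (Fin.last i) -
      (predictor b g i).comp (LinearMap.funLeft ℝ ℝ Fin.castSucc))

lemma LinearMap.measurable_of_fin {n : ℕ} (L : (Fin n → ℝ) →ₗ[ℝ] ℝ) : Measurable L :=
  (LinearMap.continuous_of_finiteDimensional L).measurable

/-- The residual `e_i` of the filter. -/
noncomputable def innovation (b : ℝ) (g : ℕ → ℝ) (z : ℕ → ℝ) (i : ℕ) : ℝ :=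
  z i - predictor b g i (fun j : Fin i => z j)

@[simp] lemma innovation_zero (b : ℝ) (g z : ℕ → ℝ) : innovation b g z 0 = z 0 := by
  simp [innovation, predictor]

lemma innovation_succ (b : ℝ) (g z : ℕ → ℝ) (i : ℕ) :
    innovation b g z (i + 1) = z (i + 1) + b * z i - g i * innovation b g z i := by
  simp only [innovation, predictor, LinearMap.add_apply, LinearMap.smul_apply, LinearMap.sub_apply,
    LinearMap.proj_apply, LinearMap.comp_apply, smul_eq_mul, Fin.val_last]
  have : (LinearMap.funLeft ℝ ℝ Fin.castSucc) (fun j : Fin (i + 1) => z j) =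
    fun j : Fin i => z j := by funext j; simp [LinearMap.funLeft_apply]
  rw [this]
  ring

lemma measurable_innovation (b : ℝ) (g : ℕ → ℝ) (i : ℕ) :
    Measurable fun z : ℕ → ℝ => innovation b g z i :=
  (measurable_pi_apply i).sub ((predictor b g i).measurable_of_fin.comp
    (measurable_pi_lambda _ fun _ => measurable_pi_apply _))

lemma innovation_add (b : ℝ) (g z z' : ℕ → ℝ) (i : ℕ) :
    innovation b g (fun k => z k + z' k) i = innovation b g z i + innovation b g z' i := by
  have : (fun j : Fin i => z j + z' j) = (fun j : Fin i => z j) + fun j : Fin i => z' j := rfl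
  simp only [innovation, this, map_add]
  ring

lemma innovation_const_mul (b : ℝ) (g z : ℕ → ℝ) (c : ℝ) (i : ℕ) :
    innovation b g (fun k => c * z k) i = c * innovation b g z i := by
  have : (fun j : Fin i => c * z j) = c • fun j : Fin i => z j := rfl
  simp only [innovation, this, map_smul, smul_eq_mul]
  ring

lemma shear_predictor (b : ℝ) (g z : ℕ → ℝ) (n : ℕ) (i : Fin n) :
    shear (fun i => predictor b g i) n (fun j => z j) i = innovation b g z i := rfl

/-! ### Product densities -/

lemma lintegral_fin_prod_eq_prod {n : ℕ} {f : Fin n → ℝ → ℝ≥0∞} (hf : ∀ i, Measurable (f i)) :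
    ∫⁻ x : Fin n → ℝ, ∏ i, f i (x i) = ∏ i, ∫⁻ t, f i t := by
  induction n with
  | zero => simp [volume_pi]
  | succ n ih =>
    have e := volume_preserving_piFinSuccAbove (fun _ : Fin (n + 1) => ℝ) 0
    have hm : Measurable fun x : Fin (n + 1) → ℝ => ∏ i, f i (x i) :=
      Finset.measurable_fun_prod _ fun i _ => (hf i).comp (measurable_pi_apply i)
    rw [← (e.symm _).lintegral_comp hm]
    simp only [MeasurableEquiv.piFinSuccAbove_symm_apply, Fin.insertNthEquiv,
      Equiv.coe_fn_mk, Fin.prod_univ_succ, Fin.insertNth_zero, Fin.cons_zero, Fin.cons_succ]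
    have := lintegral_prod_mul (μ := (volume : Measure ℝ)) (ν := (volume : Measure (Fin n → ℝ)))
      (hf 0).aemeasurable (Finset.measurable_fun_prod (Finset.univ : Finset (Fin n)) fun i _ =>
        (hf i.succ).comp (measurable_pi_apply i)).aemeasurable
    simp only [Function.comp] at this
    rw [← ih fun i => hf i.succ]
    exact this

lemma pi_withDensity {n : ℕ} {f : Fin n → ℝ → ℝ≥0∞} (hf : ∀ i, Measurable (f i))
    [∀ i, SigmaFinite ((volume : Measure ℝ).withDensity (f i))] :
    Measure.pi (fun i => (volume : Measure ℝ).withDensity (f i)) =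
      volume.withDensity (fun x => ∏ i, f i (x i)) := by
  refine Measure.pi_eq fun s hs => ?_
  rw [withDensity_apply _ (MeasurableSet.univ_pi hs), ← lintegral_indicator (MeasurableSet.univ_pi hs)]
  simp only [withDensity_apply _ (hs _), ← lintegral_indicator (hs _)]
  rw [← lintegral_fin_prod_eq_prod fun i => (hf i).indicator (hs i)]
  congr 1
  funext x
  by_cases hx : x ∈ Set.univ.pi s
  · rw [Set.indicator_of_mem hx]
    exact Finset.prod_congr rfl fun i _ => (Set.indicator_of_mem (hx i trivial) _).symm
  · rw [Set.indicator_of_notMem hx]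
    simp only [Set.mem_pi, Set.mem_univ, true_implies, not_forall] at hx
    obtain ⟨i, hi⟩ := hx
    exact (Finset.prod_eq_zero (Finset.mem_univ i) (Set.indicator_of_notMem hi _)).symm

/-! ### The autocovariance of the ARMA spectrum -/

lemma one_add_sq_add_cos_pos {β : ℝ} (hβ : β ∈ Set.Ioo (-1 : ℝ) 1) (θ : ℝ) :
    0 < 1 + β ^ 2 + 2 * β * Real.cos θ := by
  have h1 := Real.neg_one_le_cos θ
  have h2 := Real.cos_le_one θ
  obtain ⟨h3, h4⟩ := hβ
  rcases le_total 0 β with h | h <;> nlinarith [mul_pos (sub_pos.2 h3) (sub_pos.2 h4)]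

lemma norm_one_add_mul_exp_sq (a θ : ℝ) :
    ‖1 + (a : ℂ) * Complex.exp (θ * Complex.I)‖ ^ 2 = 1 + a ^ 2 + 2 * a * Real.cos θ := by
  rw [Complex.sq_norm, Complex.normSq_apply, Complex.exp_mul_I, ← Complex.ofReal_cos,
    ← Complex.ofReal_sin]
  simp only [Complex.add_re, Complex.one_re, Complex.mul_re, Complex.ofReal_re, Complex.I_re,
    mul_zero, Complex.ofReal_im, Complex.I_im, mul_one, sub_self, add_zero, Complex.add_im,
    Complex.mul_im, zero_mul, Complex.one_im, zero_add, sub_zero]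
  linear_combination a ^ 2 * Real.sin_sq_add_cos_sq θ

lemma armaSpectrum_eq (α β θ : ℝ) : armaSpectrum α β θ =
    (1 + α ^ 2 + 2 * α * Real.cos θ) / (1 + β ^ 2 + 2 * β * Real.cos θ) := by
  rw [armaSpectrum, norm_div, div_pow, norm_one_add_mul_exp_sq, norm_one_add_mul_exp_sq]

lemma continuous_armaSpectrum (α : ℝ) {β : ℝ} (hβ : β ∈ Set.Ioo (-1 : ℝ) 1) :
    Continuous (armaSpectrum α β) := by
  have : armaSpectrum α β = fun θ =>
      (1 + α ^ 2 + 2 * α * Real.cos θ) / (1 + β ^ 2 + 2 * β * Real.cos θ) :=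
    funext fun θ => armaSpectrum_eq α β θ
  rw [this]
  exact Continuous.div (by fun_prop) (by fun_prop) fun θ => (one_add_sq_add_cos_pos hβ θ).ne'

/-- The autocovariance at lag `k` of the process with spectrum `armaSpectrum α β`. -/
noncomputable def armaCov (α β : ℝ) (k : ℤ) : ℝ :=
  (2 * Real.pi)⁻¹ * ∫ θ in (-Real.pi)..Real.pi, armaSpectrum α β θ * Real.cos (k * θ)

lemma armaCov_neg (α β : ℝ) (k : ℤ) : armaCov α β (-k) = armaCov α β k := by
  simp [armaCov]

lemma integral_cos_int_mul (k : ℤ) :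
    ∫ θ in (-Real.pi)..Real.pi, Real.cos (k * θ) = if k = 0 then 2 * Real.pi else 0 := by
  split_ifs with h
  · subst h; simp; ring
  · have hk : (k : ℝ) ≠ 0 := Int.cast_ne_zero.2 h
    rw [intervalIntegral.integral_comp_mul_left _ hk, integral_cos]
    simp [Real.sin_int_mul_pi]

lemma armaCov_recursion (α : ℝ) {β : ℝ} (hβ : β ∈ Set.Ioo (-1 : ℝ) 1) (k : ℤ) :
    β * armaCov α β (k + 1) + (1 + β ^ 2) * armaCov α β k + β * armaCov α β (k - 1) =
      (1 + α ^ 2) * (if k = 0 then 1 else 0) +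
        α * ((if k + 1 = 0 then 1 else 0) + (if k - 1 = 0 then 1 else 0)) := by
  have hS := continuous_armaSpectrum α hβ
  have hint : ∀ m : ℤ, IntervalIntegrable (fun θ => armaSpectrum α β θ * Real.cos (m * θ))
      volume (-Real.pi) Real.pi := fun m => (hS.mul (by fun_prop)).intervalIntegrable _ _
  have hcos : ∀ m : ℤ, IntervalIntegrable (fun θ => Real.cos (m * θ))
      volume (-Real.pi) Real.pi := fun m =>
    (show Continuous fun θ : ℝ => Real.cos (m * θ) by fun_prop).intervalIntegrable _ _
  have hprod : ∀ θ : ℝ, Real.cos ((k + 1 : ℤ) * θ) + Real.cos ((k - 1 : ℤ) * θ) =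
      2 * Real.cos θ * Real.cos (k * θ) := by
    intro θ
    push_cast
    rw [add_mul, sub_mul, one_mul, Real.cos_add, Real.cos_sub]
    ring
  have key : ∫ θ in (-Real.pi)..Real.pi,
      (β * (armaSpectrum α β θ * Real.cos ((k + 1 : ℤ) * θ)) +
        (1 + β ^ 2) * (armaSpectrum α β θ * Real.cos (k * θ)) +
        β * (armaSpectrum α β θ * Real.cos ((k - 1 : ℤ) * θ))) =
      ∫ θ in (-Real.pi)..Real.pi, ((1 + α ^ 2) * Real.cos (k * θ) +
        α * (Real.cos ((k + 1 : ℤ) * θ) + Real.cos ((k - 1 : ℤ) * θ))) := by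
    refine intervalIntegral.integral_congr fun θ _ => ?_
    have hD := (one_add_sq_add_cos_pos hβ θ).ne'
    have h1 : armaSpectrum α β θ * (1 + β ^ 2 + 2 * β * Real.cos θ) =
        1 + α ^ 2 + 2 * α * Real.cos θ := by
      rw [armaSpectrum_eq, div_mul_cancel₀ _ hD]
    linear_combination (Real.cos (k * θ)) * h1 + (β * armaSpectrum α β θ - α) * hprod θ
  rw [intervalIntegral.integral_add (((hint _).const_mul _).add ((hint _).const_mul _))
      ((hint _).const_mul _), intervalIntegral.integral_add ((hint _).const_mul _)
      ((hint _).const_mul _), intervalIntegral.integral_add ((hcos _).const_mul _)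
      (((hcos _).add (hcos _)).const_mul _)] at key
  simp only [intervalIntegral.integral_const_mul] at key
  rw [intervalIntegral.integral_add (hcos _) (hcos _), integral_cos_int_mul,
    integral_cos_int_mul, integral_cos_int_mul] at key
  have hpi : (2 * Real.pi)⁻¹ * (2 * Real.pi) = 1 := inv_mul_cancel₀ (by positivity)
  have hite : ∀ p : Prop, [Decidable p] →
      (2 * Real.pi)⁻¹ * (if p then 2 * Real.pi else 0) = if p then 1 else 0 := by
    intro p _
    split_ifs
    · exact hpi
    · exact mul_zero _
  rw [← hite, ← hite, ← hite]
  simp only [armaCov]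
  linear_combination (2 * Real.pi)⁻¹ * key

lemma abs_armaCov_le (α : ℝ) {β : ℝ} (hβ : β ∈ Set.Ioo (-1 : ℝ) 1) :
    ∃ C, ∀ k, |armaCov α β k| ≤ C := by
  refine ⟨|(2 * Real.pi)⁻¹| * ∫ θ in (-Real.pi)..Real.pi, |armaSpectrum α β θ|, fun k => ?_⟩
  rw [armaCov, abs_mul]
  refine mul_le_mul_of_nonneg_left ?_ (abs_nonneg _)
  rw [← Real.norm_eq_abs (∫ θ in (-Real.pi)..Real.pi, _)]
  refine intervalIntegral.norm_integral_le_of_norm_le (by linarith [Real.pi_pos])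
    (ae_of_all _ fun θ _ => ?_) ((continuous_armaSpectrum α hβ).abs.intervalIntegrable _ _)
  rw [Real.norm_eq_abs, abs_mul]
  exact mul_le_of_le_one_right (abs_nonneg _) (Real.abs_cos_le_one _)

lemma armaCov_one_add (α : ℝ) {β : ℝ} (hβ : β ∈ Set.Ioo (-1 : ℝ) 1) {j : ℕ} (hj : 1 ≤ j) :
    armaCov α β (j + 1) + β * armaCov α β j = 0 := by
  obtain ⟨C, hC⟩ := abs_armaCov_le α hβ
  set D : ℕ → ℝ := fun k => armaCov α β (k + 1) + β * armaCov α β k with hDdef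
  have hrec : ∀ k, 1 ≤ k → D k = -β * D (k + 1) := by
    intro k hk
    have := armaCov_recursion α hβ ((k : ℤ) + 1)
    rw [if_neg (by omega), if_neg (by omega), if_neg (by omega)] at this
    simp only [hDdef, Nat.cast_add, Nat.cast_one]
    rw [add_sub_cancel_right] at this
    linear_combination this
  have hpow : ∀ m, D j = (-β) ^ m * D (j + m) := by
    intro m
    induction m with
    | zero => simp
    | succ m ih => rw [ih, hrec (j + m) (by omega)]; rw [pow_succ]; ring_nf
  have hlim : Tendsto (fun m : ℕ => |β| ^ m * (C + |β| * C)) atTop (𝓝 0) := by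
    have := (tendsto_pow_atTop_nhds_zero_of_lt_one (abs_nonneg β)
      (abs_lt.2 hβ)).mul_const (C + |β| * C)
    simpa using this
  have : |D j| ≤ 0 := by
    refine ge_of_tendsto' hlim fun m => ?_
    rw [hpow m, abs_mul, abs_pow, abs_neg]
    gcongr
    refine (abs_add_le _ _).trans ?_
    rw [abs_mul]
    gcongr <;> apply hC
  exact abs_nonpos_iff.1 this

lemma armaCov_one (α : ℝ) {β : ℝ} (hβ : β ∈ Set.Ioo (-1 : ℝ) 1) :
    armaCov α β 1 = α - β * armaCov α β 0 := by
  have h1 := armaCov_recursion α hβ 1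
  have h2 := armaCov_one_add α hβ le_rfl
  norm_num at h1 h2
  linear_combination h1 - β * h2

lemma armaCov_zero (α : ℝ) {β : ℝ} (hβ : β ∈ Set.Ioo (-1 : ℝ) 1) :
    (1 - β ^ 2) * armaCov α β 0 = 1 + α ^ 2 - 2 * α * β := by
  have h0 := armaCov_recursion α hβ 0
  have h1 := armaCov_one α hβ
  have h2 := armaCov_neg α β 1
  norm_num at h0 h2
  rw [h2] at h0
  linear_combination h0 - 2 * β * h1

/-! ### Innovations of the noise -/

/-- The variance of the `i`-th innovation of the noise. -/
noncomputable def innovVar (α β : ℝ) : ℕ → ℝ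
  | 0 => 1 + (α - β) ^ 2 / (1 - β ^ 2)
  | i + 1 => 1 + α ^ 2 - α ^ 2 / innovVar α β i

/-- The gain of the innovations filter of the noise. -/
noncomputable def innovGain (α β : ℝ) (i : ℕ) : ℝ := α / innovVar α β i

lemma one_sub_sq_pos {β : ℝ} (hβ : β ∈ Set.Ioo (-1 : ℝ) 1) : 0 < 1 - β ^ 2 := by
  nlinarith [hβ.1, hβ.2]

section innovVar

variable {α β : ℝ} (hα : α ∈ Set.Icc (-1 : ℝ) 1) (hβ : β ∈ Set.Ioo (-1 : ℝ) 1)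
include hβ

lemma one_le_innovVar (i : ℕ) : 1 ≤ innovVar α β i := by
  induction i with
  | zero =>
    have := one_sub_sq_pos hβ
    simp only [innovVar, le_add_iff_nonneg_right]
    positivity
  | succ i ih =>
    simp only [innovVar]
    have : α ^ 2 / innovVar α β i ≤ α ^ 2 := div_le_self (sq_nonneg _) ih
    linarith

lemma innovVar_pos (i : ℕ) : 0 < innovVar α β i := one_pos.trans_le (one_le_innovVar hβ i)

lemma innovVar_zero_eq : innovVar α β 0 = armaCov α β 0 := by
  have h := one_sub_sq_pos hβ
  have h0 := armaCov_zero α hβ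
  rw [innovVar]
  field_simp
  linarith

include hα in
lemma innovVar_sub_one_le (i : ℕ) : innovVar α β (i + 1) - 1 ≤ 1 / (i + 1) := by
  have hα2 : α ^ 2 ≤ 1 := by nlinarith [hα.1, hα.2]
  have step : ∀ i, innovVar α β (i + 1) - 1 ≤ 1 - 1 / innovVar α β i := by
    intro i
    have h1 := one_le_innovVar (α := α) hβ i
    have h2 : 1 / innovVar α β i ≤ 1 := by rw [div_le_one (by linarith)]; exact h1
    have h3 : innovVar α β (i + 1) - 1 = α ^ 2 * (1 - 1 / innovVar α β i) := by
      rw [innovVar]; ring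
    rw [h3]
    nlinarith
  induction i with
  | zero =>
    refine (step 0).trans ?_
    have := innovVar_pos (α := α) hβ 0
    have : 0 < 1 / innovVar α β 0 := by positivity
    norm_num
    linarith
  | succ i ih =>
    refine (step _).trans ?_
    have h1 := innovVar_pos (α := α) hβ (i + 1)
    have h2 : innovVar α β (i + 1) ≤ (i + 2) / (i + 1) := by
      have : ((i : ℝ) + 2) / (i + 1) = 1 + 1 / (i + 1) := by field_simp; ring
      linarith
    have h3 : ((i : ℝ) + 1) / (i + 2) ≤ 1 / innovVar α β (i + 1) := by
      rw [div_le_div_iff₀ (by positivity) h1]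
      rw [le_div_iff₀ (by positivity)] at h2
      linarith
    have h4 : ((i : ℝ) + 1) / (i + 2) = 1 - 1 / (i + 2) := by field_simp; ring
    push_cast
    rw [add_assoc, one_add_one_eq_two]
    linarith

include hα in
lemma tendsto_innovVar : Tendsto (innovVar α β) atTop (𝓝 1) := by
  rw [← tendsto_add_atTop_iff_nat 1]
  have h : Tendsto (fun n : ℕ => 1 + 1 / ((n : ℝ) + 1)) atTop (𝓝 (1 + 0)) :=
    tendsto_one_div_add_atTop_nhds_zero_nat.const_add 1
  rw [add_zero] at h
  refine tendsto_of_tendsto_of_tendsto_of_le_of_le tendsto_const_nhds h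
    (fun n => one_le_innovVar hβ _) fun n => ?_
  have := innovVar_sub_one_le hα hβ n
  linarith

end innovVar

section noise

variable {Ω : Type*} {Z : ℕ → Ω → ℝ} {α β : ℝ}

/-- The `i`-th innovation of the noise. -/
noncomputable def noiseInnov (α β : ℝ) (Z : ℕ → Ω → ℝ) (i : ℕ) (ω : Ω) : ℝ :=
  innovation β (innovGain α β) (fun k => Z k ω) i

lemma noiseInnov_zero : noiseInnov α β Z 0 = Z 0 := by
  funext ω; simp [noiseInnov]

lemma noiseInnov_succ (i : ℕ) : noiseInnov α β Z (i + 1) =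
    Z (i + 1) + β • Z i - innovGain α β i • noiseInnov α β Z i := by
  funext ω; simp [noiseInnov, innovation_succ]

namespace IsGaussianNoise

variable [MeasurableSpace Ω] {μ : Measure Ω} {S : ℝ → ℝ}

lemma memLp (hZ : IsGaussianNoise μ Z S) (i : ℕ) : MemLp (Z i) 2 μ :=
  (hZ.gaussian.hasGaussianLaw_eval i).memLp_two

lemma measurable_noiseInnov (hZ : IsGaussianNoise μ Z S) (i : ℕ) :
    Measurable (noiseInnov α β Z i) :=
  (measurable_innovation β _ i).comp (measurable_pi_lambda _ hZ.measurable)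

lemma isGaussianProcess_sumElim (hZ : IsGaussianNoise μ Z S) :
    IsGaussianProcess (Sum.elim Z (noiseInnov α β Z)) μ := by
  refine hZ.gaussian.of_isGaussianProcess fun s => ?_
  rcases s with i | i
  · refine ⟨{i}, (LinearMap.proj ⟨i, by simp⟩ : (({i} : Finset ℕ) → ℝ) →ₗ[ℝ] ℝ).toContinuousLinearMap,
      fun ω => ?_⟩
    simp
  · refine ⟨Finset.range (i + 1), (LinearMap.proj ⟨i, by simp⟩ - (predictor β (innovGain α β) i).comp
      (LinearMap.funLeft ℝ ℝ fun j : Fin i => (⟨j, Finset.mem_range.2 (by omega)⟩ : Finset.range (i + 1))) :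
        (Finset.range (i + 1) → ℝ) →ₗ[ℝ] ℝ).toContinuousLinearMap, fun ω => ?_⟩
    simp [noiseInnov, innovation]
    rfl

lemma memLp_noiseInnov (hZ : IsGaussianNoise μ Z S) (i : ℕ) : MemLp (noiseInnov α β Z i) 2 μ :=
  ((isGaussianProcess_sumElim hZ).hasGaussianLaw_eval (Sum.inr i)).memLp_two

lemma cov_eq (hZ : IsGaussianNoise μ Z (armaSpectrum α β)) (i j : ℕ) :
    cov[Z i, Z j; μ] = armaCov α β ((i : ℤ) - j) := by
  rw [hZ.covariance, armaCov]; simp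

variable [IsProbabilityMeasure μ]

lemma integral_noiseInnov (hZ : IsGaussianNoise μ Z S) (i : ℕ) :
    ∫ ω, noiseInnov α β Z i ω ∂μ = 0 := by
  have hi : ∀ i, Integrable (Z i) μ := fun i => (hZ.memLp i).integrable one_le_two
  induction i with
  | zero => rw [noiseInnov_zero]; exact hZ.mean_zero 0
  | succ i ih =>
    have hn := (hZ.memLp_noiseInnov (α := α) (β := β) i).integrable one_le_two
    rw [noiseInnov_succ, integral_sub' ((hi _).add ((hi _).smul _)) (hn.smul _),
      integral_add' (hi _) ((hi _).smul _)]
    simp only [Pi.smul_apply, integral_smul, ih, hZ.mean_zero, smul_zero, add_zero, sub_zero]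

lemma cov_noiseInnov_succ (hZ : IsGaussianNoise μ Z S) {X : Ω → ℝ} (hX : MemLp X 2 μ) (i : ℕ) :
    cov[X, noiseInnov α β Z (i + 1); μ] = cov[X, Z (i + 1); μ] + β * cov[X, Z i; μ]
      - innovGain α β i * cov[X, noiseInnov α β Z i; μ] := by
  have hn := hZ.memLp_noiseInnov (α := α) (β := β) i
  have hZi := (hZ.memLp i).const_smul β
  rw [noiseInnov_succ, covariance_sub_right hX ((hZ.memLp _).add hZi) (hn.const_smul _),
    covariance_add_right hX (hZ.memLp _) hZi, covariance_smul_right, covariance_smul_right]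

variable (hβ : β ∈ Set.Ioo (-1 : ℝ) 1)
include hβ

omit [IsProbabilityMeasure μ] in
lemma cov_succ_add (hZ : IsGaussianNoise μ Z (armaSpectrum α β)) {i l : ℕ} (h : l ≤ i) :
    cov[Z l, Z (i + 1); μ] + β * cov[Z l, Z i; μ] = if l = i then α else 0 := by
  rw [hZ.cov_eq, hZ.cov_eq, ← armaCov_neg, ← armaCov_neg α β ((l : ℤ) - i)]
  obtain ⟨k, rfl⟩ := Nat.exists_eq_add_of_le h
  have e1 : -((l : ℤ) - ((l + k + 1 : ℕ) : ℤ)) = k + 1 := by push_cast; ring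
  have e2 : -((l : ℤ) - ((l + k : ℕ) : ℤ)) = k := by push_cast; ring
  rw [e1, e2]
  rcases Nat.eq_zero_or_pos k with rfl | hk
  · have := armaCov_one α hβ
    simp
    linarith
  · rw [armaCov_one_add α hβ hk, if_neg (by omega)]

/-- `Z_{i+1} + β Z_i` is uncorrelated with the innovations before time `i`. -/
lemma cov_noiseInnov_arma (hZ : IsGaussianNoise μ Z (armaSpectrum α β)) {i j : ℕ} (h : j ≤ i) :
    cov[noiseInnov α β Z j, Z (i + 1); μ] + β * cov[noiseInnov α β Z j, Z i; μ] =
      if j = i then α else 0 := by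
  induction j with
  | zero => rw [noiseInnov_zero]; exact hZ.cov_succ_add hβ h
  | succ j ih =>
    have h1 := hZ.cov_succ_add hβ h
    have h2 := hZ.cov_succ_add hβ (i := i) (l := j) (by omega)
    have h3 := ih (by omega)
    rw [if_neg (by omega)] at h2 h3
    rw [covariance_comm, covariance_comm _ (Z i), hZ.cov_noiseInnov_succ (hZ.memLp _),
      hZ.cov_noiseInnov_succ (hZ.memLp _)]
    rw [covariance_comm (Z (i + 1)), covariance_comm (Z (i + 1)), covariance_comm (Z i),
      covariance_comm (Z i), covariance_comm (Z (i + 1)), covariance_comm (Z i)]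
    linear_combination h1 + β * h2 - innovGain α β j * h3

lemma cov_noise_noiseInnov (hZ : IsGaussianNoise μ Z (armaSpectrum α β)) (j : ℕ) :
    (∀ i < j, cov[Z i, noiseInnov α β Z j; μ] = 0) ∧
      cov[Z j, noiseInnov α β Z j; μ] = innovVar α β j := by
  induction j with
  | zero =>
    refine ⟨fun i hi => absurd hi (Nat.not_lt_zero i), ?_⟩
    rw [noiseInnov_zero, hZ.cov_eq, innovVar_zero_eq hβ]
    simp
  | succ j ih =>
    have hs := (innovVar_pos (α := α) hβ j).ne'
    have hg : innovGain α β j * innovVar α β j = α := div_mul_cancel₀ _ hs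
    refine ⟨fun i hi => ?_, ?_⟩
    · rw [hZ.cov_noiseInnov_succ (hZ.memLp _), hZ.cov_succ_add hβ (by omega)]
      rcases Nat.lt_succ_iff_lt_or_eq.1 hi with h | rfl
      · rw [ih.1 i h, if_neg (by omega)]; ring
      · rw [ih.2, if_pos rfl, hg]; ring
    · have h1 := hZ.cov_noiseInnov_arma hβ (i := j) (j := j) le_rfl
      rw [covariance_comm, covariance_comm _ (Z j), ih.2, if_pos rfl] at h1
      have h2 := armaCov_zero α hβ
      have h3 := armaCov_one α hβ
      rw [hZ.cov_noiseInnov_succ (hZ.memLp _), hZ.cov_eq, hZ.cov_eq]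
      have e1 : (((j + 1 : ℕ) : ℤ) - ((j + 1 : ℕ) : ℤ)) = 0 := by ring
      have e2 : (((j + 1 : ℕ) : ℤ) - (j : ℤ)) = 1 := by push_cast; ring
      have h4 : innovVar α β (j + 1) = 1 + α ^ 2 - innovGain α β j * α := by
        rw [innovVar, innovGain]; ring
      rw [e1, e2, h4]
      linear_combination β * h3 + h2 - innovGain α β j * h1 + β * hg

lemma cov_noiseInnov (hZ : IsGaussianNoise μ Z (armaSpectrum α β)) {i j : ℕ} (h : i < j) :
    cov[noiseInnov α β Z i, noiseInnov α β Z j; μ] = 0 := by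
  have h0 := (hZ.cov_noise_noiseInnov hβ j).1
  induction i with
  | zero => rw [noiseInnov_zero]; exact h0 0 h
  | succ i ih =>
    rw [covariance_comm, hZ.cov_noiseInnov_succ (hZ.memLp_noiseInnov _), covariance_comm,
      covariance_comm _ (Z i), covariance_comm _ (noiseInnov α β Z i), h0 _ h, h0 i (by omega),
      ih (by omega)]
    ring

lemma variance_noiseInnov (hZ : IsGaussianNoise μ Z (armaSpectrum α β)) (j : ℕ) :
    Var[noiseInnov α β Z j; μ] = innovVar α β j := by
  have h0 := hZ.cov_noise_noiseInnov hβ j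
  rw [← covariance_self (hZ.measurable_noiseInnov j).aemeasurable]
  cases j with
  | zero => rw [← h0.2, noiseInnov_zero]
  | succ j =>
    rw [hZ.cov_noiseInnov_succ (hZ.memLp_noiseInnov _), covariance_comm,
      covariance_comm _ (Z j), covariance_comm _ (noiseInnov α β Z j), h0.2, h0.1 j (by omega),
      hZ.cov_noiseInnov hβ (by omega)]
    ring

lemma integral_noiseInnov_sq (hZ : IsGaussianNoise μ Z (armaSpectrum α β)) (j : ℕ) :
    ∫ ω, noiseInnov α β Z j ω ^ 2 ∂μ = innovVar α β j := by
  rw [← hZ.variance_noiseInnov hβ, variance_of_integral_eq_zero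
    (hZ.measurable_noiseInnov j).aemeasurable (hZ.integral_noiseInnov j)]

lemma iIndepFun_noiseInnov (hZ : IsGaussianNoise μ Z (armaSpectrum α β)) :
    iIndepFun (noiseInnov α β Z) μ := by
  have hG : IsGaussianProcess
      (fun (p : (_ : ℕ) × Unit) ω => (fun (t : ℕ) (_ : Unit) => noiseInnov α β Z t) p.1 p.2 ω) μ :=
    (hZ.isGaussianProcess_sumElim (α := α) (β := β)).comp_right
      (fun p : (_ : ℕ) × Unit => Sum.inr p.1)
  have := hG.iIndepFun_of_covariance_eq_zero
    (fun t _ => (hZ.measurable_noiseInnov t).aemeasurable) (fun t₁ t₂ h _ _ => by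
      rcases lt_or_gt_of_ne h with h | h
      · exact hZ.cov_noiseInnov hβ h
      · rw [covariance_comm]; exact hZ.cov_noiseInnov hβ h)
  exact this.comp (fun _ f => f ()) fun _ => measurable_pi_apply _

lemma indepFun_noise_noiseInnov (hZ : IsGaussianNoise μ Z (armaSpectrum α β)) (i : ℕ) :
    IndepFun (fun ω (j : Fin i) => Z j ω) (noiseInnov α β Z i) μ := by
  have hG : IsGaussianProcess (Sum.elim (fun j : Fin i => Z j)
      (fun _ : Unit => noiseInnov α β Z i)) μ := by
    have := (hZ.isGaussianProcess_sumElim (α := α) (β := β)).comp_right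
      (Sum.map (fun j : Fin i => (j : ℕ)) (fun _ : Unit => i))
    refine (congrArg (fun F => IsGaussianProcess F μ) (funext fun s => ?_)).mp this
    rcases s with s | s <;> rfl
  have := hG.indepFun_of_covariance_eq_zero (fun j => (hZ.measurable j).aemeasurable)
    (fun _ => (hZ.measurable_noiseInnov i).aemeasurable)
    (fun j _ => (hZ.cov_noise_noiseInnov hβ i).1 j j.isLt)
  exact this.comp measurable_id (measurable_pi_apply ())

lemma map_noiseInnov (hZ : IsGaussianNoise μ Z (armaSpectrum α β)) (i : ℕ) :
    μ.map (noiseInnov α β Z i) = gaussianReal 0 (innovVar α β i).toNNReal := by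
  have h : HasGaussianLaw (noiseInnov α β Z i) μ :=
    (hZ.isGaussianProcess_sumElim (α := α) (β := β)).hasGaussianLaw_eval (Sum.inr i)
  rw [h.map_eq_gaussianReal, hZ.integral_noiseInnov, hZ.variance_noiseInnov hβ]

/-- The joint density of the first `n` innovations. -/
lemma map_noiseInnov_block (hZ : IsGaussianNoise μ Z (armaSpectrum α β)) (n : ℕ) :
    μ.map (fun ω (i : Fin n) => noiseInnov α β Z i ω) = volume.withDensity
      (fun u => ∏ i : Fin n, gaussianPDF 0 (innovVar α β i).toNNReal (u i)) := by
  have h1 : iIndepFun (fun i : Fin n => noiseInnov α β Z i) μ :=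
    (hZ.iIndepFun_noiseInnov hβ).precomp Fin.val_injective
  rw [iIndepFun_iff_map_fun_eq_pi_map
    fun i : Fin n => (hZ.measurable_noiseInnov i).aemeasurable] at h1
  rw [h1]
  have hv : ∀ i : Fin n, (innovVar α β i).toNNReal ≠ 0 := fun i => by
    have := innovVar_pos (α := α) hβ i
    simpa using this
  have h2 : ∀ i : Fin n, μ.map (noiseInnov α β Z i) =
      volume.withDensity (gaussianPDF 0 (innovVar α β i).toNNReal) := fun i => by
    rw [hZ.map_noiseInnov hβ, gaussianReal_of_var_ne_zero _ (hv i)]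
  have : ∀ i : Fin n, SigmaFinite ((volume : Measure ℝ).withDensity
      (gaussianPDF 0 (innovVar α β i).toNNReal)) := fun i => by
    rw [← gaussianReal_of_var_ne_zero _ (hv i)]; infer_instance
  simp only [h2]
  exact pi_withDensity fun i => measurable_gaussianPDF _ _

end IsGaussianNoise

end noise

/-- Perturbed first-order linear recursions with asymptotic ratio `ρ ∈ (-1, 1)` converge. -/
lemma tendsto_of_affine_recursion {u q b : ℕ → ℝ} {ρ c : ℝ} (hρ : |ρ| < 1)
    (hu : ∀ n, u (n + 1) = q n * u n + b n) (hq : Tendsto q atTop (𝓝 ρ))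
    (hb : Tendsto b atTop (𝓝 c)) : Tendsto u atTop (𝓝 (c / (1 - ρ))) := by
  set l := c / (1 - ρ) with hl
  have hρ1 : 1 - ρ ≠ 0 := by have := (abs_lt.1 hρ).2; linarith
  have hlc : c = l * (1 - ρ) := by rw [hl, div_mul_cancel₀ _ hρ1]
  obtain ⟨k, hk1, hk2⟩ := exists_between hρ
  have hδ : Tendsto (fun n => |q n * l + b n - l|) atTop (𝓝 0) := by
    have : Tendsto (fun n => |q n * l + b n - l|) atTop (𝓝 |ρ * l + c - l|) :=
      (((hq.mul_const l).add hb).sub_const l).abs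
    have e : ρ * l + c - l = 0 := by rw [hlc]; ring
    rwa [e, abs_zero] at this
  rw [Metric.tendsto_atTop]
  intro ε hε
  have hk0 : 0 ≤ k := (abs_nonneg ρ).trans hk1.le
  have hε' : 0 < ε / 2 * (1 - k) := mul_pos (by linarith) (by linarith)
  obtain ⟨N, hN⟩ := eventually_atTop.1
    ((hq.abs.eventually_le_const hk1).and (hδ.eventually_le_const hε'))
  have hm : ∀ m, |u (N + m) - l| ≤ k ^ m * |u N - l| + ε / 2 := by
    intro m
    induction m with
    | zero => simp; linarith
    | succ m ih =>
      obtain ⟨h1, h2⟩ := hN (N + m) (by omega)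
      have e : u (N + (m + 1)) - l = q (N + m) * (u (N + m) - l)
          + (q (N + m) * l + b (N + m) - l) := by
        rw [← add_assoc, hu]; ring
      rw [e]
      calc _ ≤ |q (N + m)| * |u (N + m) - l| + |q (N + m) * l + b (N + m) - l| := by
            rw [← abs_mul]; exact abs_add_le _ _
        _ ≤ k * (k ^ m * |u N - l| + ε / 2) + ε / 2 * (1 - k) := by
            gcongr
        _ = _ := by rw [pow_succ]; ring
  have hlim : Tendsto (fun m => k ^ m * |u N - l|) atTop (𝓝 0) := by
    simpa using (tendsto_pow_atTop_nhds_zero_of_lt_one hk0 hk2).mul_const |u N - l|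
  obtain ⟨M, hM⟩ := eventually_atTop.1 (hlim.eventually_lt_const (half_pos hε))
  refine ⟨N + M, fun n hn => ?_⟩
  obtain ⟨m, rfl⟩ := Nat.exists_eq_add_of_le (show N ≤ n by omega)
  rw [Real.dist_eq]
  have := hm m
  have := hM m (by omega)
  linarith

/-! ### The whitened pilot signal -/

/-- The innovations filter of the noise applied to the signal `r^{-i}`. -/
noncomputable def whitenedPilot (α β r : ℝ) (i : ℕ) : ℝ :=
  innovation β (innovGain α β) (fun k => (r ^ k)⁻¹) i

/-- The Fisher information about `θ` in the first `n` samples of `r^{-i} θ + Z_i`. -/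
noncomputable def fisherInfo (α β r : ℝ) (n : ℕ) : ℝ :=
  ∑ i ∈ Finset.range n, whitenedPilot α β r i ^ 2 / innovVar α β i

/-- The asymptotic power of the linear scheme with ratio `r`. -/
noncomputable def schemePower (α β r : ℝ) : ℝ :=
  (1 - r ^ 2) * (1 + α * r) ^ 2 / ((1 + β * r) ^ 2 * r ^ 2)

section fisher

variable {α β r : ℝ} (hα : α ∈ Set.Icc (-1 : ℝ) 1) (hβ : β ∈ Set.Ioo (-1 : ℝ) 1)

lemma one_add_mul_pos {a r : ℝ} (ha : a ∈ Set.Icc (-1 : ℝ) 1) (hr1 : |r| < 1) :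
    0 < 1 + a * r := by
  have h1 : |a * r| < 1 := by
    rw [abs_mul]
    exact (mul_le_of_le_one_left (abs_nonneg _) (abs_le.2 ha)).trans_lt hr1
  linarith [(abs_lt.1 h1).1]

include hβ in
lemma fisherInfo_pos {n : ℕ} (hn : 1 ≤ n) : 0 < fisherInfo α β r n := by
  refine Finset.sum_pos' (fun i _ => ?_) ⟨0, Finset.mem_range.2 hn, ?_⟩
  · exact div_nonneg (sq_nonneg _) (innovVar_pos hβ i).le
  · have := innovVar_pos (α := α) hβ 0
    simp [whitenedPilot, this]

include hα hβ in
lemma tendsto_fisherInfo (hr0 : r ≠ 0) (hr1 : |r| < 1) :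
    Tendsto (fun n => r ^ (2 * n) * fisherInfo α β r n) atTop (𝓝 (schemePower α β r)⁻¹) := by
  have har := one_add_mul_pos hα hr1
  have hbr := one_add_mul_pos (Set.Ioo_subset_Icc_self hβ) hr1
  have hs := tendsto_innovVar hα hβ
  have hg : Tendsto (fun n => r ^ n * whitenedPilot α β r n) atTop
      (𝓝 ((1 + β * r) / (1 + α * r))) := by
    have hq : Tendsto (fun n => -(r * innovGain α β n)) atTop (𝓝 (-(α * r))) := by
      have := ((tendsto_const_nhds (x := α)).div hs one_ne_zero).const_mul (-r)
      simpa [innovGain, mul_comm] using this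
    have har' : |-(α * r)| < 1 := by
      rw [abs_neg, abs_mul]
      exact (mul_le_of_le_one_left (abs_nonneg _) (abs_le.2 hα)).trans_lt hr1
    have := tendsto_of_affine_recursion (u := fun n => r ^ n * whitenedPilot α β r n)
      (b := fun _ => 1 + β * r) har' (fun n => ?_) hq tendsto_const_nhds
    · rwa [sub_neg_eq_add] at this
    · have h1 : r ^ n ≠ 0 := pow_ne_zero _ hr0
      simp only [whitenedPilot, innovation_succ]
      field_simp
      ring
  have hr2 : |r ^ 2| < 1 := by rw [abs_pow]; exact pow_lt_one₀ (abs_nonneg _) hr1 two_ne_zero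
  have := tendsto_of_affine_recursion (u := fun n => r ^ (2 * n) * fisherInfo α β r n)
    (q := fun _ => r ^ 2)
    (b := fun n => r ^ 2 * ((r ^ n * whitenedPilot α β r n) ^ 2 / innovVar α β n)) hr2
    (fun n => ?_) tendsto_const_nhds (((hg.pow 2).div hs one_ne_zero).const_mul _)
  · convert this using 2
    have : 1 - r ^ 2 ≠ 0 := by have := (abs_lt.1 hr2).2; linarith
    rw [schemePower]
    field_simp
  · simp only [fisherInfo, Finset.sum_range_succ]
    ring

include hα hβ in
lemma schemePower_pos (hr0 : r ≠ 0) (hr1 : |r| < 1) : 0 < schemePower α β r := by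
  have har := one_add_mul_pos hα hr1
  have hbr := one_add_mul_pos (Set.Ioo_subset_Icc_self hβ) hr1
  have hr2 : r ^ 2 < 1 := (sq_lt_one_iff_abs_lt_one r).2 hr1
  have : 0 < 1 - r ^ 2 := by linarith
  unfold schemePower
  positivity

include hα hβ in
lemma tendsto_inv_fisherInfo (hr0 : r ≠ 0) (hr1 : |r| < 1) :
    Tendsto (fun n => (r ^ (2 * n) * fisherInfo α β r n)⁻¹) atTop (𝓝 (schemePower α β r)) := by
  have := (tendsto_fisherInfo hα hβ hr0 hr1).inv₀
    (inv_ne_zero (schemePower_pos hα hβ hr0 hr1).ne')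
  rwa [inv_inv] at this

include hα hβ in
lemma exists_inv_fisherInfo_le (hr0 : r ≠ 0) (hr1 : |r| < 1) :
    ∃ C, 0 < C ∧ ∀ n, (fisherInfo α β r n)⁻¹ ≤ C * r ^ (2 * n) := by
  obtain ⟨C, hC⟩ := (tendsto_inv_fisherInfo hα hβ hr0 hr1).bddAbove_range
  refine ⟨max C 1, by positivity, fun n => ?_⟩
  have h1 : (r ^ (2 * n) * fisherInfo α β r n)⁻¹ ≤ max C 1 :=
    (hC ⟨n, rfl⟩).trans (le_max_left _ _)
  have h2 : 0 < r ^ (2 * n) := by rw [pow_mul]; positivity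
  rw [mul_inv] at h1
  calc _ = r ^ (2 * n) * ((r ^ (2 * n))⁻¹ * (fisherInfo α β r n)⁻¹) := by
        rw [← mul_assoc, mul_inv_cancel₀ h2.ne', one_mul]
    _ ≤ r ^ (2 * n) * max C 1 := by gcongr
    _ = _ := mul_comm _ _

end fisher

/-! ### Linear estimators -/

/-- `shear` as a linear map when the predictors are linear. -/
noncomputable def linearShear (L : (i : ℕ) → (Fin i → ℝ) →ₗ[ℝ] ℝ) (n : ℕ) :
    (Fin n → ℝ) →ₗ[ℝ] (Fin n → ℝ) :=
  LinearMap.pi fun i => LinearMap.proj i -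
    (L i).comp (LinearMap.funLeft ℝ ℝ fun j : Fin i => j.castLE i.isLt.le)

lemma linearShear_apply (L : (i : ℕ) → (Fin i → ℝ) →ₗ[ℝ] ℝ) (n : ℕ) (y : Fin n → ℝ) :
    linearShear L n y = shear (fun i => L i) n y := rfl

/-- From the outputs of the linear scheme, recover `θ r^{-i} + Z_i`, and whiten the noise. -/
noncomputable def whiten (α β r : ℝ) (est : (i : ℕ) → (Fin i → ℝ) →ₗ[ℝ] ℝ) (n : ℕ) :
    (Fin n → ℝ) →ₗ[ℝ] (Fin n → ℝ) :=
  (linearShear (predictor β (innovGain α β)) n).comp (linearShear (fun i => (-(r ^ i)⁻¹) • est i) n)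

lemma whiten_injective (α β r : ℝ) (est : (i : ℕ) → (Fin i → ℝ) →ₗ[ℝ] ℝ) (n : ℕ) :
    Function.Injective (whiten α β r est n) :=
  (shear_injective (fun i => predictor β (innovGain α β) i) n).comp
    (shear_injective (fun i => (-(r ^ i)⁻¹) • est i) n)

lemma shear_schemeMap (α β r : ℝ) (est : (i : ℕ) → (Fin i → ℝ) →ₗ[ℝ] ℝ) (t : ℝ) (n : ℕ)
    (y : Fin n → ℝ) (i : Fin n) :
    shear (fun i => predictor β (innovGain α β) i) n (shear (schemeMap r est t) n y) i =
      whiten α β r est n y i - t * whitenedPilot α β r i := by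
  have h : shear (schemeMap r est t) n y =
      linearShear (fun i => (-(r ^ i)⁻¹) • est i) n y - t • fun j : Fin n => (r ^ (j : ℕ))⁻¹ := by
    funext j
    simp [shear, linearShear_apply, schemeMap]
    ring
  rw [h, ← linearShear_apply, map_sub, map_smul]
  rfl

lemma whiten_outputBlock (α β r : ℝ) (est : (i : ℕ) → (Fin i → ℝ) →ₗ[ℝ] ℝ) (t : ℝ) (z : ℕ → ℝ)
    (n : ℕ) (i : Fin n) :
    whiten α β r est n (outputBlock (schemeMap r est t) z n) i =
      t * whitenedPilot α β r i + innovation β (innovGain α β) z i := by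
  have h := shear_schemeMap α β r est t n (outputBlock (schemeMap r est t) z n) i
  rw [shear_outputBlock, shear_predictor] at h
  linarith

lemma exists_weights {n : ℕ} {B : (Fin n → ℝ) →ₗ[ℝ] (Fin n → ℝ)} (hB : Function.Injective B)
    (L : (Fin n → ℝ) →ₗ[ℝ] ℝ) : ∃ w : Fin n → ℝ, ∀ y, L y = ∑ i, w i * B y i := by
  let e := LinearEquiv.ofInjectiveEndo B hB
  refine ⟨fun i => L (e.symm (Pi.single i 1)), fun y => ?_⟩
  have h := LinearMap.pi_apply_eq_sum_univ (L.comp e.symm.toLinearMap) (B y)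
  have h2 : e.symm (B y) = y := e.symm_apply_apply y
  simp only [LinearMap.comp_apply, LinearEquiv.coe_coe, h2, smul_eq_mul] at h
  rw [h]
  refine Finset.sum_congr rfl fun i _ => ?_
  rw [mul_comm]
  congr 3
  funext j
  simp [Pi.single_apply, eq_comm]

/-- The weighted least squares estimators of the linear scheme. -/
noncomputable def glsEstimator (α β r : ℝ) : (n : ℕ) → (Fin n → ℝ) →ₗ[ℝ] ℝ
  | n => (fisherInfo α β r n)⁻¹ • ∑ i : Fin n, (whitenedPilot α β r i / innovVar α β i) •
      (LinearMap.proj i).comp ((linearShear (predictor β (innovGain α β)) n).comp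
        (LinearMap.pi fun j : Fin n => (LinearMap.proj j : (Fin n → ℝ) →ₗ[ℝ] ℝ) + (r ^ (j : ℕ))⁻¹ •
          (glsEstimator α β r j).comp (LinearMap.funLeft ℝ ℝ fun k : Fin j => k.castLE j.isLt.le)))
termination_by n => n
decreasing_by exact j.isLt

lemma glsEstimator_apply (α β r : ℝ) (n : ℕ) (y : Fin n → ℝ) :
    glsEstimator α β r n y = (fisherInfo α β r n)⁻¹ *
      ∑ i : Fin n, whitenedPilot α β r i / innovVar α β i *
        whiten α β r (glsEstimator α β r) n y i := by
  have h : (LinearMap.pi fun j : Fin n => (LinearMap.proj j : (Fin n → ℝ) →ₗ[ℝ] ℝ) + (r ^ (j : ℕ))⁻¹ •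
      (glsEstimator α β r j).comp (LinearMap.funLeft ℝ ℝ fun k : Fin j => k.castLE j.isLt.le)) =
      linearShear (fun i => (-(r ^ i)⁻¹) • glsEstimator α β r i) n := by
    refine LinearMap.ext fun y => funext fun j => ?_
    simp [linearShear]
  rw [glsEstimator, h]
  simp [LinearMap.sum_apply, whiten]

section scheme

variable {Ω : Type*} [MeasurableSpace Ω] {μ : Measure Ω} [IsProbabilityMeasure μ]
  {Z : ℕ → Ω → ℝ} {α β r : ℝ}

/-- The density of the outputs of the feedback channel. -/
lemma map_outputBlock (hβ : β ∈ Set.Ioo (-1 : ℝ) 1)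
    (hZ : IsGaussianNoise μ Z (armaSpectrum α β)) {f : FeedbackMap} (hf : ∀ i, Measurable (f i))
    (n : ℕ) :
    μ.map (fun ω => outputBlock f (fun k => Z k ω) n) = volume.withDensity (fun y =>
      ∏ i : Fin n, gaussianPDF 0 (innovVar α β i).toNNReal
        (shear (fun i => predictor β (innovGain α β) i) n (shear f n y) i)) := by
  have hp : ∀ i, Measurable (predictor β (innovGain α β) i) := fun i =>
    LinearMap.measurable_of_fin _
  have hY : Measurable fun ω => outputBlock f (fun k => Z k ω) n :=
    (measurable_outputBlock hf n).comp (measurable_pi_lambda _ hZ.measurable)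
  refine map_eq_withDensity_of_shear hf hY
    (ρ := fun y => ∏ i : Fin n, gaussianPDF 0 (innovVar α β i).toNNReal
        (shear (fun i => predictor β (innovGain α β) i) n y i)) ?_
  refine map_eq_withDensity_of_shear (h := fun i => predictor β (innovGain α β) i) hp
    ((measurable_shear hf n).comp hY)
    (ρ := fun u => ∏ i : Fin n, gaussianPDF 0 (innovVar α β i).toNNReal (u i)) ?_
  rw [← hZ.map_noiseInnov_block hβ]
  congr 1
  funext ω i
  simp only [Function.comp, shear_outputBlock]
  rfl

omit [MeasurableSpace Ω] in
lemma weights_outputBlock {n : ℕ} {est : (i : ℕ) → (Fin i → ℝ) →ₗ[ℝ] ℝ}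
    {L : (Fin n → ℝ) →ₗ[ℝ] ℝ} {w : Fin n → ℝ} (hw : ∀ y, L y = ∑ i, w i * whiten α β r est n y i)
    (t : ℝ) (ω : Ω) : L (outputBlock (schemeMap r est t) (fun k => Z k ω) n) =
      t * ∑ i, w i * whitenedPilot α β r i + ∑ i, w i * noiseInnov α β Z i ω := by
  rw [hw, Finset.mul_sum, ← Finset.sum_add_distrib]
  refine Finset.sum_congr rfl fun i _ => ?_
  rw [whiten_outputBlock, noiseInnov]
  ring

omit [IsProbabilityMeasure μ] in
lemma memLp_sum_noiseInnov (hZ : IsGaussianNoise μ Z (armaSpectrum α β)) {n : ℕ}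
    (w : Fin n → ℝ) : MemLp (fun ω => ∑ i, w i * noiseInnov α β Z i ω) 2 μ :=
  memLp_finsetSum _ fun i _ => (hZ.memLp_noiseInnov i).const_mul _

lemma variance_sum_noiseInnov (hβ : β ∈ Set.Ioo (-1 : ℝ) 1)
    (hZ : IsGaussianNoise μ Z (armaSpectrum α β)) {n : ℕ} (w : Fin n → ℝ) :
    Var[fun ω => ∑ i, w i * noiseInnov α β Z i ω; μ] = ∑ i : Fin n, w i ^ 2 * innovVar α β i := by
  have hm : ∀ i : Fin n, MemLp (fun ω => w i * noiseInnov α β Z i ω) 2 μ :=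
    fun i => (hZ.memLp_noiseInnov i).const_mul _
  rw [← covariance_self (memLp_sum_noiseInnov hZ w).aemeasurable, covariance_fun_sum_fun_sum hm hm]
  refine Finset.sum_congr rfl fun i _ => ?_
  rw [Finset.sum_eq_single i]
  · rw [covariance_const_mul_left, covariance_const_mul_right,
      covariance_self (hZ.measurable_noiseInnov i).aemeasurable, hZ.variance_noiseInnov hβ]
    ring
  · intro j _ hj
    rw [covariance_const_mul_left, covariance_const_mul_right]
    rcases lt_or_gt_of_ne (Fin.val_ne_of_ne hj) with h | h
    · rw [covariance_comm, hZ.cov_noiseInnov hβ h]; ring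
    · rw [hZ.cov_noiseInnov hβ h]; ring
  · simp

lemma integral_sum_noiseInnov
    (hZ : IsGaussianNoise μ Z (armaSpectrum α β)) {n : ℕ} (w : Fin n → ℝ) :
    ∫ ω, ∑ i, w i * noiseInnov α β Z i ω ∂μ = 0 := by
  rw [integral_finsetSum _ fun (i : Fin n) _ =>
    ((hZ.memLp_noiseInnov (α := α) (β := β) (i : ℕ)).integrable one_le_two).const_mul (w i)]
  simp [integral_const_mul, hZ.integral_noiseInnov]

lemma integral_weights (hZ : IsGaussianNoise μ Z (armaSpectrum α β)) {n : ℕ}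
    {est : (i : ℕ) → (Fin i → ℝ) →ₗ[ℝ] ℝ}
    {L : (Fin n → ℝ) →ₗ[ℝ] ℝ} {w : Fin n → ℝ} (hw : ∀ y, L y = ∑ i, w i * whiten α β r est n y i)
    (t : ℝ) : ∫ ω, L (outputBlock (schemeMap r est t) (fun k => Z k ω) n) ∂μ =
      t * ∑ i, w i * whitenedPilot α β r i := by
  simp only [weights_outputBlock hw]
  rw [integral_add (integrable_const _) ((memLp_sum_noiseInnov hZ w).integrable one_le_two),
    integral_sum_noiseInnov hZ]
  simp

lemma variance_weights (hβ : β ∈ Set.Ioo (-1 : ℝ) 1)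
    (hZ : IsGaussianNoise μ Z (armaSpectrum α β)) {n : ℕ}
    {est : (i : ℕ) → (Fin i → ℝ) →ₗ[ℝ] ℝ}
    {L : (Fin n → ℝ) →ₗ[ℝ] ℝ} {w : Fin n → ℝ} (hw : ∀ y, L y = ∑ i, w i * whiten α β r est n y i)
    (t : ℝ) : Var[fun ω => L (outputBlock (schemeMap r est t) (fun k => Z k ω) n); μ] =
      ∑ i : Fin n, w i ^ 2 * innovVar α β i := by
  simp only [weights_outputBlock hw]
  rw [variance_const_add (memLp_sum_noiseInnov hZ w).aestronglyMeasurable, variance_sum_noiseInnov hβ hZ]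

/-- The weights of the minimum variance unbiased linear estimator. -/
noncomputable def glsWeight (α β r : ℝ) (n i : ℕ) : ℝ :=
  (fisherInfo α β r n)⁻¹ * (whitenedPilot α β r i / innovVar α β i)

lemma sum_glsWeight_mul (hβ : β ∈ Set.Ioo (-1 : ℝ) 1) {n : ℕ} (hn : 1 ≤ n) :
    ∑ i : Fin n, glsWeight α β r n i * whitenedPilot α β r i = 1 := by
  have hJ := (fisherInfo_pos (α := α) (r := r) hβ hn).ne'
  have : ∀ i : Fin n, glsWeight α β r n i * whitenedPilot α β r i =
      (fisherInfo α β r n)⁻¹ * (whitenedPilot α β r i ^ 2 / innovVar α β i) := fun i => by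
    rw [glsWeight]; ring
  simp only [this, ← Finset.mul_sum]
  rw [Fin.sum_univ_eq_sum_range (fun i => whitenedPilot α β r i ^ 2 / innovVar α β i), ← fisherInfo,
    inv_mul_cancel₀ hJ]

lemma sum_mul_glsWeight_mul (hβ : β ∈ Set.Ioo (-1 : ℝ) 1) {n : ℕ} (w : Fin n → ℝ) :
    ∑ i : Fin n, w i * glsWeight α β r n i * innovVar α β i =
      (fisherInfo α β r n)⁻¹ * ∑ i : Fin n, w i * whitenedPilot α β r i := by
  rw [Finset.mul_sum]
  refine Finset.sum_congr rfl fun i _ => ?_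
  have := (innovVar_pos (α := α) hβ i).ne'
  rw [glsWeight]
  field_simp

lemma sum_glsWeight_sq (hβ : β ∈ Set.Ioo (-1 : ℝ) 1) {n : ℕ} (hn : 1 ≤ n) :
    ∑ i : Fin n, glsWeight α β r n i ^ 2 * innovVar α β i = (fisherInfo α β r n)⁻¹ := by
  have := sum_mul_glsWeight_mul (α := α) (r := r) hβ fun i : Fin n => glsWeight α β r n i
  rw [sum_glsWeight_mul hβ hn, mul_one] at this
  simpa only [sq] using this

lemma sum_weight_sub_sq (hβ : β ∈ Set.Ioo (-1 : ℝ) 1) {n : ℕ} (hn : 1 ≤ n) {w : Fin n → ℝ}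
    (hw : ∑ i, w i * whitenedPilot α β r i = 1) :
    ∑ i : Fin n, (w i - glsWeight α β r n i) ^ 2 * innovVar α β i =
      ∑ i : Fin n, w i ^ 2 * innovVar α β i - (fisherInfo α β r n)⁻¹ := by
  have h1 := sum_mul_glsWeight_mul (α := α) (r := r) hβ w
  have h2 := sum_glsWeight_sq (α := α) (r := r) hβ hn
  rw [hw, mul_one] at h1
  have : ∀ i : Fin n, (w i - glsWeight α β r n i) ^ 2 * innovVar α β i =
      w i ^ 2 * innovVar α β i - 2 * (w i * glsWeight α β r n i * innovVar α β i) +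
        glsWeight α β r n i ^ 2 * innovVar α β i := fun i => by ring
  simp only [this, Finset.sum_add_distrib, Finset.sum_sub_distrib, ← Finset.mul_sum, h1, h2]
  ring

theorem isMinVarUnbiasedLinear_iff (hβ : β ∈ Set.Ioo (-1 : ℝ) 1)
    (hZ : IsGaussianNoise μ Z (armaSpectrum α β)) (est : (i : ℕ) → (Fin i → ℝ) →ₗ[ℝ] ℝ) :
    IsMinVarUnbiasedLinear μ Z r est ↔ ∀ n, 1 ≤ n → ∀ y, est n y =
      ∑ i : Fin n, glsWeight α β r n i * whiten α β r est n y i := by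
  refine forall_congr' fun n => forall_congr' fun hn => ?_
  constructor
  · rintro ⟨h1, h2⟩ y
    obtain ⟨w, hw⟩ := exists_weights (whiten_injective α β r est n) (est n)
    let L : (Fin n → ℝ) →ₗ[ℝ] ℝ := ∑ i : Fin n, glsWeight α β r n i •
      (LinearMap.proj i).comp (whiten α β r est n)
    have hL : ∀ y, L y = ∑ i : Fin n, glsWeight α β r n i * whiten α β r est n y i := by
      intro y; simp [L, LinearMap.sum_apply]
    have hw1 : ∑ i, w i * whitenedPilot α β r i = 1 := by
      have := h1 1
      rwa [integral_weights hZ hw, one_mul] at this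
    have hv := h2 L (fun t => by rw [integral_weights hZ hL, sum_glsWeight_mul hβ hn, mul_one]) 0
    rw [variance_weights hβ hZ hw, variance_weights hβ hZ hL, sum_glsWeight_sq hβ hn] at hv
    have hd := sum_weight_sub_sq (α := α) (r := r) hβ hn hw1
    have hnn : ∀ i ∈ Finset.univ, 0 ≤ (w i - glsWeight α β r n i) ^ 2 * innovVar α β i :=
      fun i _ => mul_nonneg (sq_nonneg _) (innovVar_pos hβ i).le
    have h0 : ∑ i : Fin n, (w i - glsWeight α β r n i) ^ 2 * innovVar α β i = 0 :=
      le_antisymm (by rw [hd]; linarith) (Finset.sum_nonneg hnn)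
    have h3 := (Finset.sum_eq_zero_iff_of_nonneg hnn).1 h0
    rw [hw]
    refine Finset.sum_congr rfl fun i hi => ?_
    have h4 := (mul_eq_zero.1 (h3 i hi)).resolve_right (innovVar_pos hβ i).ne'
    rw [sub_eq_zero.1 (pow_eq_zero_iff two_ne_zero |>.1 h4)]
  · intro h
    refine ⟨fun t => by rw [integral_weights hZ h, sum_glsWeight_mul hβ hn, mul_one],
      fun L hL t => ?_⟩
    obtain ⟨w, hw⟩ := exists_weights (whiten_injective α β r est n) L
    have hw1 : ∑ i, w i * whitenedPilot α β r i = 1 := by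
      have := hL 1
      rwa [integral_weights hZ hw, one_mul] at this
    rw [variance_weights hβ hZ h, variance_weights hβ hZ hw, sum_glsWeight_sq hβ hn]
    have hd := sum_weight_sub_sq (α := α) (r := r) hβ hn hw1
    have : 0 ≤ ∑ i : Fin n, (w i - glsWeight α β r n i) ^ 2 * innovVar α β i :=
      Finset.sum_nonneg fun i _ => mul_nonneg (sq_nonneg _) (innovVar_pos hβ i).le
    linarith

theorem isMinVarUnbiasedLinear_glsEstimator (hβ : β ∈ Set.Ioo (-1 : ℝ) 1)
    (hZ : IsGaussianNoise μ Z (armaSpectrum α β)) :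
    IsMinVarUnbiasedLinear μ Z r (glsEstimator α β r) := by
  rw [isMinVarUnbiasedLinear_iff hβ hZ]
  intro n _ y
  rw [glsEstimator_apply, Finset.mul_sum]
  exact Finset.sum_congr rfl fun i _ => by rw [glsWeight]; ring

/-- The error of the minimum variance unbiased linear estimator. -/
noncomputable def glsError (α β r : ℝ) (Z : ℕ → Ω → ℝ) (n : ℕ) (ω : Ω) : ℝ :=
  ∑ i : Fin n, glsWeight α β r n i * noiseInnov α β Z i ω

omit [MeasurableSpace Ω] in
lemma est_outputBlock (hβ : β ∈ Set.Ioo (-1 : ℝ) 1)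
    {est : (i : ℕ) → (Fin i → ℝ) →ₗ[ℝ] ℝ} {n : ℕ} (hn : 1 ≤ n)
    (hest : ∀ y, est n y = ∑ i : Fin n, glsWeight α β r n i * whiten α β r est n y i)
    (t : ℝ) (ω : Ω) : est n (outputBlock (schemeMap r est t) (fun k => Z k ω) n) =
      t + glsError α β r Z n ω := by
  rw [weights_outputBlock hest, sum_glsWeight_mul hβ hn, mul_one, glsError]

lemma integral_glsError_sq (hβ : β ∈ Set.Ioo (-1 : ℝ) 1)
    (hZ : IsGaussianNoise μ Z (armaSpectrum α β)) {n : ℕ} (hn : 1 ≤ n) :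
    ∫ ω, glsError α β r Z n ω ^ 2 ∂μ = (fisherInfo α β r n)⁻¹ := by
  have h := variance_sum_noiseInnov hβ hZ fun i : Fin n => glsWeight α β r n i
  rw [variance_of_integral_eq_zero (memLp_sum_noiseInnov hZ _).aemeasurable
    (integral_sum_noiseInnov hZ _),
    sum_glsWeight_sq hβ hn] at h
  exact h

omit [IsProbabilityMeasure μ] in
lemma memLp_glsError (hZ : IsGaussianNoise μ Z (armaSpectrum α β)) (n : ℕ) :
    MemLp (glsError α β r Z n) 2 μ :=
  memLp_sum_noiseInnov hZ _

lemma map_glsError (hβ : β ∈ Set.Ioo (-1 : ℝ) 1)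
    (hZ : IsGaussianNoise μ Z (armaSpectrum α β)) {n : ℕ} (hn : 1 ≤ n) :
    μ.map (glsError α β r Z n) = gaussianReal 0 (fisherInfo α β r n)⁻¹.toNNReal := by
  have hG : HasGaussianLaw (glsError α β r Z n) μ := by
    have h1 : iIndepFun (fun i : Fin n => fun ω => glsWeight α β r n i * noiseInnov α β Z i ω) μ :=
      ((hZ.iIndepFun_noiseInnov hβ).precomp Fin.val_injective).comp
        (fun i x => glsWeight α β r n i * x) fun i => measurable_const_mul _
    refine iIndepFun.hasGaussianLaw_fun_sum (fun i => ?_) h1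
    exact ((hZ.isGaussianProcess_sumElim (α := α) (β := β)).hasGaussianLaw_eval
      (Sum.inr (i : ℕ))).fun_smul (glsWeight α β r n i)
  have h0 : ∫ ω, glsError α β r Z n ω ∂μ = 0 := integral_sum_noiseInnov hZ _
  rw [hG.map_eq_gaussianReal, h0, variance_of_integral_eq_zero hG.aemeasurable h0,
    integral_glsError_sq hβ hZ hn]

end scheme

/-! ### The complementary error function -/

lemma integrable_exp_neg_sq : Integrable fun t : ℝ => Real.exp (-t ^ 2) := by
  simpa using integrable_exp_neg_mul_sq one_pos

lemma erfc_antitone : Antitone erfc := by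
  intro x y hxy
  unfold erfc
  refine mul_le_mul_of_nonneg_left ?_ (by positivity)
  exact setIntegral_mono_set integrable_exp_neg_sq.integrableOn
    (ae_of_all _ fun t => (Real.exp_pos _).le) (LE.le.eventuallyLE (Set.Ioi_subset_Ioi hxy))

lemma erfc_nonneg (x : ℝ) : 0 ≤ erfc x :=
  mul_nonneg (by positivity) (integral_nonneg fun t => (Real.exp_pos _).le)

lemma erfc_le_exp {s : ℝ} (hs : 0 ≤ s) : erfc s ≤ Real.exp (-s ^ 2) := by
  have h0 : ∫ t in Set.Ioi (0 : ℝ), Real.exp (-t ^ 2) = Real.sqrt Real.pi / 2 := by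
    simpa using integral_gaussian_Ioi 1
  have h1 : ∫ t in Set.Ioi s, Real.exp (-t ^ 2) =
      ∫ t in Set.Ioi (0 : ℝ), Real.exp (-(t + s) ^ 2) := by
    have := (measurePreserving_add_right volume s).setIntegral_preimage_emb
      (measurableEmbedding_addRight s) (fun t => Real.exp (-t ^ 2)) (Set.Ioi s)
    rw [← this]
    congr 2
    ext x
    simp
  have h2 : ∫ t in Set.Ioi (0 : ℝ), Real.exp (-(t + s) ^ 2) ≤
      ∫ t in Set.Ioi (0 : ℝ), Real.exp (-s ^ 2) * Real.exp (-t ^ 2) := by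
    refine setIntegral_mono_on ?_ ?_ measurableSet_Ioi fun t ht => ?_
    · exact (integrable_exp_neg_sq.comp_add_right s).integrableOn
    · exact (integrable_exp_neg_sq.const_mul _).integrableOn
    · rw [← Real.exp_add]
      refine Real.exp_le_exp.2 ?_
      have : (0 : ℝ) < t := ht
      nlinarith [mul_nonneg this.le hs]
  have hpi : 0 < Real.sqrt Real.pi := Real.sqrt_pos.2 Real.pi_pos
  rw [integral_const_mul, h0] at h2
  rw [erfc, h1]
  calc _ ≤ 2 / Real.sqrt Real.pi * (Real.exp (-s ^ 2) * (Real.sqrt Real.pi / 2)) := by gcongr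
    _ = _ := by field_simp

lemma gaussianReal_real_Ici {v : ℝ} (hv : 0 < v) (c : ℝ) :
    (gaussianReal 0 v.toNNReal).real (Set.Ici c) =
      1 / Real.sqrt Real.pi * ∫ t in Set.Ioi (c / Real.sqrt (2 * v)), Real.exp (-t ^ 2) := by
  have hv0 : v.toNNReal ≠ 0 := by simpa using hv
  have hs : 0 < Real.sqrt (2 * v) := Real.sqrt_pos.2 (by positivity)
  have hs2 : Real.sqrt (2 * v) ^ 2 = 2 * v := Real.sq_sqrt (by positivity)
  have h := integral_comp_mul_left_Ioi (fun x => Real.exp (-x ^ 2 / (2 * v)))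
    (c / Real.sqrt (2 * v)) hs
  rw [mul_div_cancel₀ _ hs.ne'] at h
  have e : ∀ t : ℝ, -(Real.sqrt (2 * v) * t) ^ 2 / (2 * v) = -t ^ 2 := by
    intro t
    rw [mul_pow, hs2]
    field_simp
  simp only [e] at h
  rw [measureReal_def, gaussianReal_apply_eq_integral _ hv0, ENNReal.toReal_ofReal
    (integral_nonneg fun x => gaussianPDFReal_nonneg _ _ _), integral_Ici_eq_integral_Ioi, h]
  simp only [gaussianPDFReal, sub_zero, Real.coe_toNNReal v hv.le]
  rw [integral_const_mul, smul_eq_mul]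
  have : Real.sqrt (2 * Real.pi * v) = Real.sqrt Real.pi * Real.sqrt (2 * v) := by
    rw [← Real.sqrt_mul Real.pi_pos.le]; congr 1; ring
  rw [this]
  field_simp

lemma gaussianReal_real_le_abs {v : ℝ} (hv : 0 < v) {c : ℝ} :
    (gaussianReal 0 v.toNNReal).real {x | c ≤ |x|} ≤ erfc (c / Real.sqrt (2 * v)) := by
  have h1 : {x : ℝ | c ≤ |x|} = Set.Ici c ∪ (fun x => -x) ⁻¹' Set.Ici c := by
    ext x; simp [le_abs, le_neg]
  have h2 : (gaussianReal 0 v.toNNReal).real ((fun x => -x) ⁻¹' Set.Ici c) =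
      (gaussianReal 0 v.toNNReal).real (Set.Ici c) := by
    rw [← map_measureReal_apply measurable_neg measurableSet_Ici, gaussianReal_map_neg, neg_zero]
  rw [h1]
  refine (measureReal_union_le _ _).trans ?_
  rw [h2, gaussianReal_real_Ici hv, erfc]
  apply le_of_eq
  ring

/-! ### The constellation -/

lemma constellation_mem {M : ℕ} (w : Fin M) : constellation M w ∈ Set.Icc (-1 : ℝ) 1 := by
  have hw : (w : ℝ) + 1 ≤ M := by exact_mod_cast w.isLt
  have hw0 : (0 : ℝ) ≤ (w : ℕ) := Nat.cast_nonneg _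
  have h1 : 0 ≤ (w : ℝ) * (2 / ((M : ℝ) - 1)) :=
    mul_nonneg hw0 (div_nonneg two_pos.le (by linarith))
  have h2 : (w : ℝ) * (2 / ((M : ℝ) - 1)) ≤ 2 := by
    rcases eq_or_lt_of_le (show (0 : ℝ) ≤ M - 1 by linarith) with h | h
    · rw [← h]; simp
    · rw [mul_div_assoc', div_le_iff₀ h]; nlinarith
  constructor <;> simp only [constellation] <;> linarith

lemma le_abs_constellation_sub {M : ℕ} {w w' : Fin M} (h : w ≠ w') :
    2 / ((M : ℝ) - 1) ≤ |constellation M w - constellation M w'| := by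
  have hM : (0 : ℝ) ≤ M - 1 := by
    have : (1 : ℝ) ≤ M := by exact_mod_cast Nat.one_le_of_lt w.isLt
    linarith
  have h1 : constellation M w - constellation M w' =
      (((w : ℕ) : ℤ) - ((w' : ℕ) : ℤ) : ℤ) * (2 / ((M : ℝ) - 1)) := by
    simp only [constellation]; push_cast; ring
  have h2 : (1 : ℝ) ≤ |(((((w : ℕ) : ℤ) - ((w' : ℕ) : ℤ) : ℤ)) : ℝ)| := by
    have h3 : ((w : ℕ) : ℤ) - ((w' : ℕ) : ℤ) ≠ 0 := by
      have := Fin.val_ne_of_ne h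
      omega
    exact_mod_cast Int.one_le_abs h3
  have h4 : 0 ≤ 2 / ((M : ℝ) - 1) := div_nonneg two_pos.le hM
  rw [h1, abs_mul, abs_of_nonneg h4]
  exact le_mul_of_one_le_left h4 h2

lemma measurableSet_isNearestPoint {M : ℕ} (w : Fin M) :
    MeasurableSet {s : ℝ | IsNearestPoint s w} := by
  simp only [IsNearestPoint, Set.ofPred_forall]
  exact MeasurableSet.iInter fun w' => measurableSet_le (by fun_prop) (by fun_prop)

lemma exists_nearestPoint {M : ℕ} (hM : 0 < M) (s : ℝ) : ∃ w : Fin M, IsNearestPoint s w := by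
  have : Nonempty (Fin M) := ⟨⟨0, hM⟩⟩
  exact Finite.exists_min fun w : Fin M => |constellation M w - s|

lemma exists_measurable_nearestPoint {M : ℕ} (hM : 0 < M) :
    ∃ D : ℝ → Fin M, Measurable D ∧ ∀ s, IsNearestPoint s (D s) := by
  classical
  let p : ℝ → ℕ → Prop := fun s k => ∃ h : k < M, IsNearestPoint s ⟨k, h⟩
  have hp : ∀ s, ∃ k, p s k := fun s => by
    obtain ⟨w, hw⟩ := exists_nearestPoint hM s
    exact ⟨w, w.isLt, hw⟩
  have hm : Measurable fun s => Nat.find (hp s) := by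
    refine measurable_find hp fun k => ?_
    by_cases h : k < M
    · simpa [p, h] using measurableSet_isNearestPoint (⟨k, h⟩ : Fin M)
    · simp [p, h]
  let F : ℕ → Fin M := fun k => if h : k < M then ⟨k, h⟩ else ⟨0, hM⟩
  refine ⟨fun s => F (Nat.find (hp s)), (measurable_from_top (f := F)).comp hm, fun s => ?_⟩
  obtain ⟨h, hs⟩ := Nat.find_spec (hp s)
  simpa [F, h] using hs

lemma numMessages_pos (n : ℕ) (R : ℝ) : 0 < numMessages n R :=
  Nat.ceil_pos.2 (by positivity)

section scheme

variable {Ω : Type*} [MeasurableSpace Ω] {μ : Measure Ω} [IsProbabilityMeasure μ]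
  {Z : ℕ → Ω → ℝ} {α β r : ℝ} {est : (i : ℕ) → (Fin i → ℝ) →ₗ[ℝ] ℝ}

/-! ### Power of the linear scheme -/

/-- The power used at time `i` by the linear scheme, for a parameter in `[-1, 1]`. -/
noncomputable def powerBound (α β r : ℝ) (i : ℕ) : ℝ :=
  if i = 0 then 1 else (r ^ (2 * i) * fisherInfo α β r i)⁻¹

lemma powerBound_nonneg (hβ : β ∈ Set.Ioo (-1 : ℝ) 1) (i : ℕ) : 0 ≤ powerBound α β r i := by
  rw [powerBound]
  split_ifs with h
  · exact zero_le_one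
  · have := fisherInfo_pos (α := α) (r := r) hβ (Nat.one_le_iff_ne_zero.2 h)
    rw [pow_mul]
    positivity

lemma tendsto_powerBound (hα : α ∈ Set.Icc (-1 : ℝ) 1) (hβ : β ∈ Set.Ioo (-1 : ℝ) 1)
    (hr0 : r ≠ 0) (hr1 : |r| < 1) :
    Tendsto (powerBound α β r) atTop (𝓝 (schemePower α β r)) := by
  refine (tendsto_inv_fisherInfo hα hβ hr0 hr1).congr' ?_
  filter_upwards [eventually_ge_atTop 1] with n hn
  rw [powerBound, if_neg (by omega)]

lemma tendsto_sum_powerBound (hα : α ∈ Set.Icc (-1 : ℝ) 1) (hβ : β ∈ Set.Ioo (-1 : ℝ) 1)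
    (hr0 : r ≠ 0) (hr1 : |r| < 1) :
    Tendsto (fun n : ℕ => ENNReal.ofReal ((n : ℝ)⁻¹ * ∑ i ∈ Finset.range n, powerBound α β r i))
      atTop (𝓝 (ENNReal.ofReal (schemePower α β r))) :=
  ENNReal.tendsto_ofReal (tendsto_powerBound hα hβ hr0 hr1).cesaro

lemma sum_ofReal_powerBound_div (hβ : β ∈ Set.Ioo (-1 : ℝ) 1) (n : ℕ) :
    (∑ i ∈ Finset.range n, ENNReal.ofReal (powerBound α β r i)) / (n : ℝ≥0∞) =
      ENNReal.ofReal ((n : ℝ)⁻¹ * ∑ i ∈ Finset.range n, powerBound α β r i) := by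
  rw [← ENNReal.ofReal_sum_of_nonneg fun i _ => powerBound_nonneg hβ i]
  rcases Nat.eq_zero_or_pos n with rfl | hn
  · simp
  · have : (0 : ℝ) < n := by exact_mod_cast hn
    rw [mul_comm, ← div_eq_mul_inv, ENNReal.ofReal_div_of_pos this, ENNReal.ofReal_natCast]

/-- The estimators satisfy the normal equations of weighted least squares. -/
def IsGLS (α β r : ℝ) (est : (i : ℕ) → (Fin i → ℝ) →ₗ[ℝ] ℝ) : Prop :=
  ∀ n, 1 ≤ n → ∀ y, est n y = ∑ i : Fin n, glsWeight α β r n i * whiten α β r est n y i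

lemma lintegral_channelInput_sq_le (hβ : β ∈ Set.Ioo (-1 : ℝ) 1)
    (hZ : IsGaussianNoise μ Z (armaSpectrum α β)) (hest : IsGLS α β r est) {t : ℝ}
    (ht : t ∈ Set.Icc (-1 : ℝ) 1) (i : ℕ) :
    ∫⁻ ω, ENNReal.ofReal (channelInput (schemeMap r est t) (fun k => Z k ω) i ^ 2) ∂μ ≤
      ENNReal.ofReal (powerBound α β r i) := by
  rcases Nat.eq_zero_or_pos i with rfl | hi
  · have h : ∀ ω, channelInput (schemeMap r est t) (fun k => Z k ω) 0 = t := fun ω => by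
      have : outputBlock (schemeMap r est t) (fun k => Z k ω) 0 = 0 := Subsingleton.elim _ _
      rw [channelInput, schemeMap, this, map_zero]
      simp
    simp only [h, lintegral_const, measure_univ, mul_one, powerBound, if_true]
    refine ENNReal.ofReal_le_ofReal ?_
    nlinarith [ht.1, ht.2]
  · have h : ∀ ω, channelInput (schemeMap r est t) (fun k => Z k ω) i ^ 2 =
        (r ^ (2 * i))⁻¹ * glsError α β r Z i ω ^ 2 := fun ω => by
      rw [channelInput, schemeMap, est_outputBlock hβ hi (hest i hi), pow_mul', ← inv_pow]
      ring
    have hI := (memLp_glsError (r := r) hZ i).integrable_sq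
    simp only [h]
    rw [← ofReal_integral_eq_lintegral_ofReal (hI.const_mul _) (ae_of_all _ fun ω => by
      rw [pow_mul]; positivity), integral_const_mul, integral_glsError_sq hβ hZ hi, powerBound,
      if_neg (by omega), mul_inv]

lemma avgPower_le (hβ : β ∈ Set.Ioo (-1 : ℝ) 1)
    (hZ : IsGaussianNoise μ Z (armaSpectrum α β)) (hest : IsGLS α β r est) (n M : ℕ) :
    avgPower μ Z n (fun w : Fin M => schemeMap r est (constellation M w)) ≤
      ENNReal.ofReal ((n : ℝ)⁻¹ * ∑ i ∈ Finset.range n, powerBound α β r i) := by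
  rw [← sum_ofReal_powerBound_div hβ, avgPower]
  gcongr with i _
  refine ENNReal.div_le_of_le_mul ?_
  calc _ ≤ ∑ w : Fin M, ENNReal.ofReal (powerBound α β r i) := by
        gcongr with w
        exact lintegral_channelInput_sq_le hβ hZ hest (constellation_mem w) i
    _ = _ := by simp [mul_comm]

/-! ### Maximum-likelihood decoding -/

lemma prod_gaussianPDF_le_iff (hβ : β ∈ Set.Ioo (-1 : ℝ) 1) (hest : IsGLS α β r est) {n : ℕ}
    (hn : 1 ≤ n) (y : Fin n → ℝ) (t t' : ℝ) :
    (∏ i : Fin n, gaussianPDF 0 (innovVar α β i).toNNReal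
        (whiten α β r est n y i - t * whitenedPilot α β r i)) ≤
      (∏ i : Fin n, gaussianPDF 0 (innovVar α β i).toNNReal
        (whiten α β r est n y i - t' * whitenedPilot α β r i)) ↔
    |t' - est n y| ≤ |t - est n y| := by
  have hs : ∀ i, 0 < innovVar α β i := innovVar_pos hβ
  have hJ := fisherInfo_pos (α := α) (r := r) hβ hn
  set B := whiten α β r est n y with hB
  have hprod : ∀ t : ℝ, ∏ i : Fin n, gaussianPDF 0 (innovVar α β i).toNNReal
      (B i - t * whitenedPilot α β r i) = ENNReal.ofReal
      ((∏ i : Fin n, (Real.sqrt (2 * Real.pi * innovVar α β i))⁻¹) * Real.exp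
        (∑ i : Fin n, -(B i - t * whitenedPilot α β r i) ^ 2 / (2 * innovVar α β i))) := by
    intro t
    simp only [gaussianPDF]
    rw [← ENNReal.ofReal_prod_of_nonneg fun i _ => gaussianPDFReal_nonneg _ _ _, Real.exp_sum,
      ← Finset.prod_mul_distrib]
    congr 1
    refine Finset.prod_congr rfl fun i _ => ?_
    rw [gaussianPDFReal, Real.coe_toNNReal _ (hs i).le, sub_zero]
  have hexp : ∀ t : ℝ, ∑ i : Fin n, -(B i - t * whitenedPilot α β r i) ^ 2 / (2 * innovVar α β i) =
      (∑ i : Fin n, -(B i) ^ 2 / (2 * innovVar α β i) + fisherInfo α β r n * est n y ^ 2 / 2) -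
        fisherInfo α β r n / 2 * (t - est n y) ^ 2 := by
    intro t
    have h1 : fisherInfo α β r n * est n y =
        ∑ i : Fin n, whitenedPilot α β r i * B i / innovVar α β i := by
      rw [hest n hn y, ← hB, Finset.mul_sum]
      refine Finset.sum_congr rfl fun i _ => ?_
      rw [glsWeight]
      have := hJ.ne'
      have := (hs i).ne'
      field_simp
    have h2 : fisherInfo α β r n = ∑ i : Fin n, whitenedPilot α β r i ^ 2 / innovVar α β i :=
      (Fin.sum_univ_eq_sum_range (fun i => whitenedPilot α β r i ^ 2 / innovVar α β i) n).symm
    have h3 : ∀ i : Fin n, -(B i - t * whitenedPilot α β r i) ^ 2 / (2 * innovVar α β i) =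
        -(B i) ^ 2 / (2 * innovVar α β i) + t * (whitenedPilot α β r i * B i / innovVar α β i) -
          t ^ 2 / 2 * (whitenedPilot α β r i ^ 2 / innovVar α β i) := fun i => by
      have := (hs i).ne'
      field_simp
      ring
    simp only [h3, Finset.sum_sub_distrib, Finset.sum_add_distrib, ← Finset.mul_sum, ← h1, ← h2]
    ring
  rw [hprod, hprod, ENNReal.ofReal_le_ofReal_iff (mul_nonneg
    (Finset.prod_nonneg fun i _ => by positivity) (Real.exp_pos _).le),
    mul_le_mul_iff_right₀ (Finset.prod_pos fun (i : Fin n) _ => by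
      have := hs i
      have := Real.pi_pos
      positivity), Real.exp_le_exp, hexp, hexp, sub_le_sub_iff_left,
    mul_le_mul_iff_right₀ (by positivity), sq_le_sq]

variable {n M : ℕ} {D : (Fin n → ℝ) → Fin M} {hD : Measurable D}

lemma measurable_schemeMap (r : ℝ) (est : (i : ℕ) → (Fin i → ℝ) →ₗ[ℝ] ℝ) (t : ℝ) (i : ℕ) :
    Measurable (schemeMap r est t i) :=
  ((est i).measurable_of_fin.const_sub _).const_mul _

lemma outputLaw_schemeCode (hβ : β ∈ Set.Ioo (-1 : ℝ) 1)
    (hZ : IsGaussianNoise μ Z (armaSpectrum α β)) (w : Fin M) :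
    (schemeCode r est D hD).outputLaw μ Z w = volume.withDensity (fun y =>
      ∏ i : Fin n, gaussianPDF 0 (innovVar α β i).toNNReal
        (whiten α β r est n y i - constellation M w * whitenedPilot α β r i)) := by
  have h := map_outputBlock hβ hZ (measurable_schemeMap r est (constellation M w)) n
  simp only [shear_schemeMap] at h
  exact h

lemma isMaximumLikelihood_schemeCode_iff (hβ : β ∈ Set.Ioo (-1 : ℝ) 1)
    (hZ : IsGaussianNoise μ Z (armaSpectrum α β)) (hest : IsGLS α β r est) (hn : 1 ≤ n) :
    (schemeCode r est D hD).IsMaximumLikelihood μ Z ↔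
      ∀ᵐ y ∂(volume : Measure (Fin n → ℝ)), IsNearestPoint (est n y) (D y) := by
  have hlaw := outputLaw_schemeCode (r := r) (est := est) (D := D) (hD := hD) hβ hZ
  have hac : ∀ w, (schemeCode r est D hD).outputLaw μ Z w ≪ volume := fun w => by
    rw [hlaw]; exact withDensity_absolutelyContinuous _ _
  have hmeas : ∀ w : Fin M, Measurable fun y : Fin n → ℝ =>
      ∏ i : Fin n, gaussianPDF 0 (innovVar α β i).toNNReal
        (whiten α β r est n y i - constellation M w * whitenedPilot α β r i) := fun w => by
    have hw : Measurable (whiten α β r est n) :=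
      (LinearMap.continuous_of_finiteDimensional _).measurable
    exact Finset.measurable_fun_prod _ fun i _ => (measurable_gaussianPDF _ _).comp
      (((measurable_pi_apply i).comp hw).sub_const _)
  have hrn : ∀ᵐ y ∂(volume : Measure (Fin n → ℝ)), ∀ w,
      ((schemeCode r est D hD).outputLaw μ Z w).rnDeriv volume y =
        ∏ i : Fin n, gaussianPDF 0 (innovVar α β i).toNNReal
          (whiten α β r est n y i - constellation M w * whitenedPilot α β r i) := by
    rw [ae_all_iff]
    intro w
    rw [hlaw]
    exact Measure.rnDeriv_withDensity _ (hmeas w)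
  rw [FeedbackCode.IsMaximumLikelihood, and_iff_right hac]
  refine eventually_congr ?_
  filter_upwards [hrn] with y hy
  simp only [hy, prod_gaussianPDF_le_iff hβ hest hn]
  rfl

/-! ### Error probability -/

lemma errorProb_schemeCode_le (hβ : β ∈ Set.Ioo (-1 : ℝ) 1)
    (hZ : IsGaussianNoise μ Z (armaSpectrum α β)) (hest : IsGLS α β r est) (hn : 1 ≤ n)
    (hD' : ∀ᵐ y ∂(volume : Measure (Fin n → ℝ)), IsNearestPoint (est n y) (D y)) {s : ℝ}
    (hs : 2 ≤ M → s ≤ 1 / ((M : ℝ) - 1) / Real.sqrt (2 * (fisherInfo α β r n)⁻¹)) :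
    (schemeCode r est D hD).errorProb μ Z ≤ erfc s := by
  have hJ := fisherInfo_pos (α := α) (r := r) hβ hn
  have hYm : ∀ w : Fin M, Measurable fun ω =>
      outputBlock (schemeMap r est (constellation M w)) (fun k => Z k ω) n := fun w =>
    (measurable_outputBlock (measurable_schemeMap _ _ _) n).comp
      (measurable_pi_lambda _ hZ.measurable)
  have key : ∀ w : Fin M, μ.real {ω | D (outputBlock (schemeMap r est (constellation M w))
      (fun k => Z k ω) n) ≠ w} ≤ erfc s := by
    intro w
    rcases lt_or_ge M 2 with hM | hM
    · have : Subsingleton (Fin M) := Fin.subsingleton_iff_le_one.2 (by omega)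
      have h0 : {ω | D (outputBlock (schemeMap r est (constellation M w))
          (fun k => Z k ω) n) ≠ w} = ∅ := by
        ext ω; simp [Subsingleton.elim (D _) w]
      rw [h0]
      simpa using erfc_nonneg s
    · have hM1 : (0 : ℝ) < M - 1 := by
        have : (2 : ℝ) ≤ M := by exact_mod_cast hM
        linarith
      have hae : ∀ᵐ ω ∂μ, IsNearestPoint
          (est n (outputBlock (schemeMap r est (constellation M w)) (fun k => Z k ω) n))
          (D (outputBlock (schemeMap r est (constellation M w)) (fun k => Z k ω) n)) := by
        have hac : (schemeCode r est D hD).outputLaw μ Z w ≪ volume := by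
          rw [outputLaw_schemeCode hβ hZ]; exact withDensity_absolutelyContinuous _ _
        exact ae_of_ae_map (hYm w).aemeasurable (hac.ae_le hD')
      have hsub : ∀ᵐ ω ∂μ, ω ∈ {ω | D (outputBlock (schemeMap r est (constellation M w))
          (fun k => Z k ω) n) ≠ w} → ω ∈ glsError α β r Z n ⁻¹' {x | 1 / ((M : ℝ) - 1) ≤ |x|} := by
        filter_upwards [hae] with ω hω hne
        have h1 := hω w
        rw [est_outputBlock hβ hn (hest n hn)] at h1
        have h2 := le_abs_constellation_sub hne
        have h3 : |constellation M w - (constellation M w + glsError α β r Z n ω)| =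
            |glsError α β r Z n ω| := by
          rw [sub_add_cancel_left, abs_neg]
        rw [h3] at h1
        have h4 := abs_sub_le (constellation M (D (outputBlock (schemeMap r est (constellation M w))
          (fun k => Z k ω) n))) (constellation M w + glsError α β r Z n ω) (constellation M w)
        rw [add_sub_cancel_left] at h4
        have h5 : 2 / ((M : ℝ) - 1) = 2 * (1 / ((M : ℝ) - 1)) := by ring
        simp only [Set.mem_preimage, Set.mem_ofPred_eq]
        linarith
      calc _ ≤ μ.real (glsError α β r Z n ⁻¹' {x | 1 / ((M : ℝ) - 1) ≤ |x|}) :=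
            ENNReal.toReal_mono (measure_ne_top _ _) (measure_mono_ae hsub)
        _ = (gaussianReal 0 (fisherInfo α β r n)⁻¹.toNNReal).real
              {x | 1 / ((M : ℝ) - 1) ≤ |x|} := by
            rw [← map_glsError hβ hZ hn, map_measureReal_apply_of_aemeasurable
              (memLp_glsError hZ n).aemeasurable (measurableSet_le (by fun_prop) (by fun_prop))]
        _ ≤ erfc (1 / ((M : ℝ) - 1) / Real.sqrt (2 * (fisherInfo α β r n)⁻¹)) :=
            gaussianReal_real_le_abs (inv_pos.2 hJ)
        _ ≤ _ := erfc_antitone (hs hM)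
  rw [FeedbackCode.errorProb]
  rcases Nat.eq_zero_or_pos M with rfl | hM
  · simpa using erfc_nonneg s
  · have hM' : (0 : ℝ) < M := by exact_mod_cast hM
    rw [div_le_iff₀ hM']
    calc _ ≤ ∑ w : Fin M, erfc s := Finset.sum_le_sum fun w _ => key w
      _ = _ := by simp [mul_comm]

lemma errorProb_schemeCode_le_erfc (hβ : β ∈ Set.Ioo (-1 : ℝ) 1)
    (hZ : IsGaussianNoise μ Z (armaSpectrum α β)) (hest : IsGLS α β r est) (hr0 : r ≠ 0)
    {C R : ℝ} (hC : 0 < C) (hCn : ∀ n, (fisherInfo α β r n)⁻¹ ≤ C * r ^ (2 * n))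
    (hn : 1 ≤ n) {D : (Fin n → ℝ) → Fin (numMessages n R)} {hD : Measurable D}
    (hD' : ∀ᵐ y ∂(volume : Measure (Fin n → ℝ)), IsNearestPoint (est n y) (D y)) :
    (schemeCode r est D hD).errorProb μ Z ≤
      erfc (Real.sqrt ((2 * C)⁻¹ * r⁻¹ ^ (2 * n) / (2 : ℝ) ^ (2 * (n : ℝ) * R))) := by
  refine errorProb_schemeCode_le hβ hZ hest hn hD' fun hM => ?_
  have hJ := fisherInfo_pos (α := α) (r := r) hβ hn
  have hM1 : (0 : ℝ) < (numMessages n R : ℝ) - 1 := by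
    have : (2 : ℝ) ≤ numMessages n R := by exact_mod_cast hM
    linarith
  have hlt : (numMessages n R : ℝ) - 1 ≤ (2 : ℝ) ^ ((n : ℝ) * R) := by
    have := Nat.ceil_lt_add_one (show (0 : ℝ) ≤ (2 : ℝ) ^ ((n : ℝ) * R) by positivity)
    unfold numMessages
    linarith
  have hr : 0 < r ^ (2 * n) := by rw [pow_mul]; positivity
  have h2 : (2 : ℝ) ^ (2 * (n : ℝ) * R) = ((2 : ℝ) ^ ((n : ℝ) * R)) ^ 2 := by
    rw [← Real.rpow_mul_natCast two_pos.le]; congr 1; push_cast; ring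
  rw [Real.sqrt_le_left (by positivity), div_pow, Real.sq_sqrt (by positivity), h2, inv_pow]
  have e1 : (2 * C)⁻¹ * (r ^ (2 * n))⁻¹ / ((2 : ℝ) ^ ((n : ℝ) * R)) ^ 2 =
      (1 / (2 : ℝ) ^ ((n : ℝ) * R)) ^ 2 / (2 * (C * r ^ (2 * n))) := by
    field_simp
  rw [e1]
  gcongr
  exact hCn n

lemma erfc_le_doubleExp {c x R : ℝ} (hc : 0 < c) (hx : 0 < x) (n : ℕ) :
    erfc (Real.sqrt (c * x⁻¹ ^ (2 * n) / (2 : ℝ) ^ (2 * (n : ℝ) * R))) ≤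
      Real.exp (-(c * ((x⁻¹ / (2 : ℝ) ^ R) ^ 2) ^ n)) := by
  refine (erfc_le_exp (Real.sqrt_nonneg _)).trans (le_of_eq ?_)
  rw [Real.sq_sqrt (by positivity)]
  have : (2 : ℝ) ^ (2 * (n : ℝ) * R) = (((2 : ℝ) ^ R) ^ 2) ^ n := by
    rw [← pow_mul, ← Real.rpow_mul_natCast two_pos.le]; congr 1; push_cast; ring
  rw [this, pow_mul, div_pow, div_pow, mul_div_assoc]

lemma one_lt_doubleExp_base {x R : ℝ} (hx : 0 < x) (hR : R < -Real.logb 2 x) :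
    1 < (x⁻¹ / (2 : ℝ) ^ R) ^ 2 := by
  refine one_lt_pow₀ ?_ two_ne_zero
  rw [one_lt_div (by positivity)]
  rw [← Real.logb_inv] at hR
  exact (Real.lt_logb_iff_rpow_lt one_lt_two (inv_pos.2 hx)).1 hR

end scheme

/-! ### Variational lower bounds for relative entropy -/

section entropy

variable {X : Type*} [MeasurableSpace X]

/-- Jensen's inequality for the exponential function, in a form that does not presuppose that
`exp ∘ g` is integrable. -/
lemma integral_le_log_of_lintegral_exp_le {P : Measure X} [IsProbabilityMeasure P] {g : X → ℝ}
    (hg : Integrable g P) {K : ℝ} (hK : 0 < K)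
    (h : ∫⁻ x, ENNReal.ofReal (Real.exp (g x)) ∂P ≤ ENNReal.ofReal K) :
    ∫ x, g x ∂P ≤ Real.log K := by
  have hm : AEStronglyMeasurable (fun x => Real.exp (g x)) P :=
    Real.continuous_exp.comp_aestronglyMeasurable hg.aestronglyMeasurable
  have h0 : 0 ≤ᵐ[P] fun x => Real.exp (g x) := ae_of_all _ fun x => (Real.exp_pos _).le
  have hi : Integrable (fun x => Real.exp (g x)) P :=
    (lintegral_ofReal_ne_top_iff_integrable hm h0).1 (h.trans_lt ENNReal.ofReal_lt_top).ne
  have hle : ∫ x, Real.exp (g x) ∂P ≤ K := by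
    rw [integral_eq_lintegral_of_nonneg_ae h0 hm]
    exact ENNReal.toReal_le_of_le_ofReal hK.le h
  have hpt : ∀ x, g x ≤ Real.exp (g x) / K - 1 + Real.log K := by
    intro x
    have h1 := Real.add_one_le_exp (g x - Real.log K)
    rw [Real.exp_sub, Real.exp_log hK] at h1
    linarith
  calc ∫ x, g x ∂P ≤ ∫ x, (Real.exp (g x) / K + (Real.log K - 1)) ∂P :=
        integral_mono hg ((hi.div_const K).add (integrable_const _)) fun x => by
          have := hpt x
          simp only
          linarith
    _ = (∫ x, Real.exp (g x) ∂P) / K + (Real.log K - 1) := by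
        rw [integral_add (hi.div_const K) (integrable_const _), integral_div]; simp
    _ ≤ 1 + (Real.log K - 1) := by gcongr; exact (div_le_one hK).2 hle
    _ = _ := by ring

/-- The easy half of the Donsker–Varadhan formula. -/
lemma ofReal_le_klDiv {P Q : Measure X} [IsProbabilityMeasure P] [IsProbabilityMeasure Q]
    {f : X → ℝ} (hfm : Measurable f) (hf : Integrable f P) {K : ℝ} (hK : 0 < K)
    (h : ∫⁻ x, ENNReal.ofReal (Real.exp (f x)) ∂Q ≤ ENNReal.ofReal K) :
    ENNReal.ofReal (∫ x, f x ∂P - Real.log K) ≤ InformationTheory.klDiv P Q := by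
  by_cases htop : InformationTheory.klDiv P Q = ∞
  · rw [htop]; exact le_top
  obtain ⟨hac, hint⟩ := InformationTheory.klDiv_ne_top_iff.1 htop
  rw [InformationTheory.klDiv_of_ac_of_integrable hac hint]
  refine ENNReal.ofReal_le_ofReal ?_
  have key : ∫ x, (f x - llr P Q x) ∂P ≤ Real.log K := by
    refine integral_le_log_of_lintegral_exp_le (hf.sub hint) hK (le_trans ?_ h)
    rw [← lintegral_rnDeriv_mul hac (by
      have := measurable_llr P Q
      fun_prop)]
    refine lintegral_mono_ae ?_
    filter_upwards [Measure.rnDeriv_lt_top P Q] with x hx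
    rw [Pi.sub_apply, Real.exp_sub, ENNReal.ofReal_div_of_pos (Real.exp_pos _), llr]
    rcases eq_or_ne (P.rnDeriv Q x) 0 with h0 | h0
    · rw [h0]; simp
    · have hpos : 0 < (P.rnDeriv Q x).toReal := ENNReal.toReal_pos h0 hx.ne
      rw [Real.exp_log hpos, ENNReal.ofReal_toReal hx.ne, ENNReal.mul_div_cancel h0 hx.ne]
  rw [integral_sub hf hint] at key
  simp only [probReal_univ]
  linarith

end entropy

section gaussian

variable {Ω : Type*} {mΩ : MeasurableSpace Ω} {μ : Measure Ω} [IsProbabilityMeasure μ]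

lemma lintegral_exp_distortion {D : ℝ} (hD : 0 < D) (u : ℝ) :
    ∫⁻ v, ENNReal.ofReal (Real.exp (-(v - u) ^ 2 / (2 * D) + v ^ 2 / 2)) ∂(gaussianReal 0 1) =
      ENNReal.ofReal (Real.sqrt D) := by
  have hD0 : D.toNNReal ≠ 0 := by simpa using hD
  rw [gaussianReal_of_var_ne_zero _ one_ne_zero, lintegral_withDensity_eq_lintegral_mul _
    (measurable_gaussianPDF _ _) (by fun_prop)]
  have : ∀ v, (gaussianPDF 0 1 * fun v => ENNReal.ofReal
      (Real.exp (-(v - u) ^ 2 / (2 * D) + v ^ 2 / 2))) v =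
      ENNReal.ofReal (Real.sqrt D) * gaussianPDF u D.toNNReal v := by
    intro v
    rw [Pi.mul_apply, gaussianPDF, gaussianPDF, ← ENNReal.ofReal_mul
      (gaussianPDFReal_nonneg _ _ _), ← ENNReal.ofReal_mul (Real.sqrt_nonneg _)]
    congr 1
    rw [gaussianPDFReal, gaussianPDFReal, Real.coe_toNNReal _ hD.le, mul_assoc, ← Real.exp_add]
    have h1 : Real.sqrt (2 * Real.pi * D) = Real.sqrt (2 * Real.pi) * Real.sqrt D :=
      Real.sqrt_mul (by positivity) _
    have h2 : 0 < Real.sqrt D := Real.sqrt_pos.2 hD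
    have h3 : 0 < Real.sqrt (2 * Real.pi) := by positivity
    have h4 : -(v - 0) ^ 2 / (2 * ((1 : NNReal) : ℝ)) + (-(v - u) ^ 2 / (2 * D) + v ^ 2 / 2) =
      -(v - u) ^ 2 / (2 * D) := by
      simp only [NNReal.coe_one]
      ring
    rw [h4, h1, NNReal.coe_one, mul_one]
    field_simp
  simp only [this]
  rw [lintegral_const_mul _ (measurable_gaussianPDF _ _), lintegral_gaussianPDF_eq_one _ hD0,
    mul_one]

omit [IsProbabilityMeasure μ] in
lemma memLp_of_hasLaw_gaussian {V : Ω → ℝ} (hVm : Measurable V) (hV : HasLaw V (gaussianReal 0 1) μ) :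
    MemLp V 2 μ := by
  have := (memLp_id_gaussianReal (μ := 0) (v := 1) 2)
  rw [← hV.map_eq] at this
  exact (memLp_map_measure_iff aestronglyMeasurable_id hVm.aemeasurable).1 (by simpa using this)

omit [IsProbabilityMeasure μ] in
lemma integral_sq_of_hasLaw_gaussian {V : Ω → ℝ} (hVm : Measurable V) (hV : HasLaw V (gaussianReal 0 1) μ) :
    ∫ ω, V ω ^ 2 ∂μ = 1 := by
  have e1 : ∫ ω, V ω ^ 2 ∂μ = ∫ x, x ^ 2 ∂(gaussianReal 0 1) := by
    rw [← hV.map_eq, integral_map hVm.aemeasurable (by fun_prop)]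
  have e2 := variance_id_gaussianReal (μ := 0) (v := 1)
  rw [variance_of_integral_eq_zero aemeasurable_id (by simp)] at e2
  rw [e1]
  simpa using e2

/-- The rate-distortion lower bound for a Gaussian source. -/
lemma ofReal_le_mutualInfoBits {V U : Ω → ℝ} (hVm : Measurable V)
    (hV : HasLaw V (gaussianReal 0 1) μ) (hUm : Measurable U) {D : ℝ} (hD : 0 < D)
    (hint : Integrable (fun ω => (V ω - U ω) ^ 2) μ) (hle : ∫ ω, (V ω - U ω) ^ 2 ∂μ ≤ D) :
    ENNReal.ofReal (-Real.log (Real.sqrt D) / Real.log 2) ≤ mutualInfoBits μ V U := by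
  have hVU : Measurable fun ω => (V ω, U ω) := hVm.prodMk hUm
  have h1 : IsProbabilityMeasure (μ.map fun ω => (V ω, U ω)) :=
    Measure.isProbabilityMeasure_map hVU.aemeasurable
  have h2 : IsProbabilityMeasure (μ.map V) := Measure.isProbabilityMeasure_map hVm.aemeasurable
  have h3 : IsProbabilityMeasure (μ.map U) := Measure.isProbabilityMeasure_map hUm.aemeasurable
  let f : ℝ × ℝ → ℝ := fun p => -(p.1 - p.2) ^ 2 / (2 * D) + p.1 ^ 2 / 2
  have hfm : Measurable f := by fun_prop
  have hV2 := memLp_of_hasLaw_gaussian hVm hV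
  have hVsq := integral_sq_of_hasLaw_gaussian hVm hV
  have hfi : Integrable (fun ω => f (V ω, U ω)) μ :=
    ((hint.neg).div_const (2 * D)).add (hV2.integrable_sq.div_const 2)
  have hf : Integrable f (μ.map fun ω => (V ω, U ω)) :=
    (integrable_map_measure hfm.aestronglyMeasurable hVU.aemeasurable).2 hfi
  have hf0 : 0 ≤ ∫ p, f p ∂(μ.map fun ω => (V ω, U ω)) := by
    rw [integral_map hVU.aemeasurable hfm.aestronglyMeasurable]
    have e : ∫ ω, f (V ω, U ω) ∂μ =
        (∫ ω, -(V ω - U ω) ^ 2 / (2 * D) ∂μ) + ∫ ω, V ω ^ 2 / 2 ∂μ :=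
      integral_add ((hint.neg).div_const (2 * D)) (hV2.integrable_sq.div_const 2)
    rw [e, integral_div, integral_div, integral_neg, hVsq]
    have : (∫ ω, (V ω - U ω) ^ 2 ∂μ) / (2 * D) ≤ 1 / 2 := by
      rw [div_le_div_iff₀ (by positivity) two_pos]; linarith
    rw [neg_div]
    linarith
  have hQ : ∫⁻ p, ENNReal.ofReal (Real.exp (f p)) ∂((μ.map V).prod (μ.map U)) ≤
      ENNReal.ofReal (Real.sqrt D) := by
    rw [lintegral_prod_symm' _ (by fun_prop), hV.map_eq]
    simp only [f, lintegral_exp_distortion hD]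
    simp
  have key := ofReal_le_klDiv hfm hf (Real.sqrt_pos.2 hD) hQ
  rw [mutualInfoBits, ENNReal.ofReal_div_of_pos (Real.log_pos one_lt_two)]
  gcongr
  refine le_trans (ENNReal.ofReal_le_ofReal ?_) key
  linarith

/-! ### The scheme with a Gaussian message -/

variable {Z : ℕ → Ω → ℝ} {α β r : ℝ} {V : Ω → ℝ}

omit [IsProbabilityMeasure μ] in
lemma measurable_condExp (m : MeasurableSpace Ω) (f : Ω → ℝ) : Measurable[mΩ] (μ[f | m]) := by
  by_cases hm : m ≤ mΩ
  · exact (stronglyMeasurable_condExp.mono hm).measurable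
  · rw [condExp_of_not_le hm]; exact measurable_const

/-- The information available to the receiver before time `n`. -/
noncomputable abbrev gaussianSchemeSigma (μ : Measure Ω) (Z : ℕ → Ω → ℝ) (V : Ω → ℝ) (r : ℝ) (n : ℕ) :
    MeasurableSpace Ω :=
  MeasurableSpace.comap (fun ω (k : Fin n) => gaussianSchemeOutput μ Z V r k ω)
    (MeasurableSpace.pi : MeasurableSpace (Fin n → ℝ))

omit [IsProbabilityMeasure μ] in
lemma gaussianSchemeOutput_eq (n : ℕ) (ω : Ω) : gaussianSchemeOutput μ Z V r n ω =
    (r ^ n)⁻¹ * (V ω - gaussianSchemeEstimate μ Z V r n ω) + Z n ω := by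
  rw [gaussianSchemeOutput]; rfl

omit [IsProbabilityMeasure μ] in
lemma measurable_gaussianSchemeEstimate (n : ℕ) : Measurable (gaussianSchemeEstimate μ Z V r n) :=
  measurable_condExp _ _

omit [IsProbabilityMeasure μ] in
lemma gaussianSchemeSigma_le (hV : Measurable V) (hZ : ∀ i, Measurable (Z i)) (n : ℕ) :
    gaussianSchemeSigma μ Z V r n ≤ mΩ := by
  refine Measurable.comap_le (measurable_pi_lambda _ fun k => ?_)
  have : gaussianSchemeOutput μ Z V r k = fun ω =>
      (r ^ (k : ℕ))⁻¹ * (V ω - gaussianSchemeEstimate μ Z V r k ω) + Z k ω :=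
    funext fun ω => gaussianSchemeOutput_eq _ ω
  rw [this]
  exact ((hV.sub (measurable_gaussianSchemeEstimate _)).const_mul _).add (hZ _)

omit [IsProbabilityMeasure μ] in
/-- The receiver can recover `r^{-k} V + Z_k` from the outputs. -/
lemma measurable_openLoop {n k : ℕ} (hk : k < n) :
    Measurable[gaussianSchemeSigma μ Z V r n] fun ω => (r ^ k)⁻¹ * V ω + Z k ω := by
  have hY : ∀ j < n, Measurable[gaussianSchemeSigma μ Z V r n] (gaussianSchemeOutput μ Z V r j) :=
    fun j hj => (measurable_pi_apply (⟨j, hj⟩ : Fin n)).comp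
      (comap_measurable fun ω (k : Fin n) => gaussianSchemeOutput μ Z V r k ω)
  have hle : gaussianSchemeSigma μ Z V r k ≤ gaussianSchemeSigma μ Z V r n :=
    Measurable.comap_le (@measurable_pi_lambda _ _ _ (gaussianSchemeSigma μ Z V r n) _ _
      fun j => hY j (j.isLt.trans hk))
  have hE : Measurable[gaussianSchemeSigma μ Z V r n] (gaussianSchemeEstimate μ Z V r k) :=
    ((stronglyMeasurable_condExp (m := gaussianSchemeSigma μ Z V r k)).mono hle).measurable
  have : (fun ω => (r ^ k)⁻¹ * V ω + Z k ω) = fun ω =>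
      gaussianSchemeOutput μ Z V r k ω + (r ^ k)⁻¹ * gaussianSchemeEstimate μ Z V r k ω := by
    funext ω
    rw [gaussianSchemeOutput_eq]
    ring
  rw [this]
  exact (hY k hk).add (hE.const_mul _)

/-- The conditional expectation is at least as good an estimate as any other. -/
lemma integral_sub_condExp_sq_le {m : MeasurableSpace Ω} (hm : m ≤ mΩ)
    {A : Ω → ℝ} (hV : MemLp V 2 μ) (hA : MemLp A 2 μ) (hAm : Measurable[m] A) :
    ∫ ω, (V ω - (μ[V | m]) ω) ^ 2 ∂μ ≤ ∫ ω, (V ω - A ω) ^ 2 ∂μ := by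
  have hX : MemLp (V - A) 2 μ := hV.sub hA
  have hAe : μ[A | m] = A := condExp_of_stronglyMeasurable hm hAm.stronglyMeasurable
    (hA.integrable one_le_two)
  have h1 : μ[V - A | m] =ᵐ[μ] μ[V | m] - A := by
    have := condExp_sub (hV.integrable one_le_two) (hA.integrable one_le_two) m
    rwa [hAe] at this
  have h2 : ∫ ω, (Var[V - A; μ | m]) ω ∂μ = ∫ ω, (V ω - (μ[V | m]) ω) ^ 2 ∂μ := by
    rw [condVar, integral_condExp hm]
    refine integral_congr_ae ?_
    filter_upwards [h1] with ω hω
    simp only [Pi.pow_apply, Pi.sub_apply, hω]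
    ring
  have h3 : ∫ ω, (μ[(V - A) ^ 2 | m]) ω ∂μ = ∫ ω, (V ω - A ω) ^ 2 ∂μ := by
    rw [integral_condExp hm]
    rfl
  rw [← h2, ← h3]
  exact integral_mono_ae integrable_condVar integrable_condExp (condVar_ae_le_condExp_sq hm hX)

omit [IsProbabilityMeasure μ] in
lemma integrable_gaussianScheme_sq (hVm : Measurable V) (hV : HasLaw V (gaussianReal 0 1) μ)
    (n : ℕ) : Integrable (fun ω => (V ω - gaussianSchemeEstimate μ Z V r n ω) ^ 2) μ :=
  ((memLp_of_hasLaw_gaussian hVm hV).sub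
    ((memLp_of_hasLaw_gaussian hVm hV).condExp one_le_two)).integrable_sq

lemma integral_gaussianScheme_sq_le (hβ : β ∈ Set.Ioo (-1 : ℝ) 1)
    (hZ : IsGaussianNoise μ Z (armaSpectrum α β)) (hVm : Measurable V)
    (hV : HasLaw V (gaussianReal 0 1) μ) {n : ℕ} (hn : 1 ≤ n) :
    ∫ ω, (V ω - gaussianSchemeEstimate μ Z V r n ω) ^ 2 ∂μ ≤ (fisherInfo α β r n)⁻¹ := by
  have hV2 := memLp_of_hasLaw_gaussian hVm hV
  have hE2 := memLp_glsError (r := r) hZ n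
  have hA : (fun ω => V ω + glsError α β r Z n ω) = fun ω => ∑ i : Fin n, glsWeight α β r n i *
      shear (fun i => predictor β (innovGain α β) i) n
        (fun k : Fin n => (r ^ (k : ℕ))⁻¹ * V ω + Z k ω) i := by
    funext ω
    have h1 : ∀ i : Fin n, shear (fun i => predictor β (innovGain α β) i) n
        (fun k : Fin n => (r ^ (k : ℕ))⁻¹ * V ω + Z k ω) i =
        V ω * whitenedPilot α β r i + noiseInnov α β Z i ω := fun i => by
      rw [shear_predictor β (innovGain α β) (fun k => (r ^ k)⁻¹ * V ω + Z k ω), innovation_add]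
      simp only [mul_comm _ (V ω)]
      rw [innovation_const_mul]
      rfl
    simp only [h1, mul_add, Finset.sum_add_distrib, glsError]
    congr 1
    have h2 : ∀ i : Fin n, glsWeight α β r n i * (V ω * whitenedPilot α β r i) =
        V ω * (glsWeight α β r n i * whitenedPilot α β r i) := fun i => by ring
    simp only [h2, ← Finset.mul_sum]
    rw [sum_glsWeight_mul hβ hn, mul_one]
  have hAm : Measurable[gaussianSchemeSigma μ Z V r n] fun ω => V ω + glsError α β r Z n ω := by
    rw [hA]
    have h1 : Measurable fun y : Fin n → ℝ => ∑ i : Fin n, glsWeight α β r n i *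
        shear (fun i => predictor β (innovGain α β) i) n y i :=
      Finset.measurable_fun_sum _ fun i _ => ((measurable_pi_apply i).comp
        (measurable_shear (fun i => LinearMap.measurable_of_fin _) n)).const_mul _
    exact h1.comp (@measurable_pi_lambda _ _ _ (gaussianSchemeSigma μ Z V r n) _ _
      fun k => measurable_openLoop k.isLt)
  refine (integral_sub_condExp_sq_le (gaussianSchemeSigma_le hVm hZ.measurable n) hV2
    (hV2.add hE2) hAm).trans (le_of_eq ?_)
  rw [← integral_glsError_sq hβ hZ hn]
  refine integral_congr_ae (ae_of_all _ fun ω => ?_)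
  simp only [Pi.add_apply]
  ring

lemma lintegral_gaussianSchemeInput_sq_le (hβ : β ∈ Set.Ioo (-1 : ℝ) 1)
    (hZ : IsGaussianNoise μ Z (armaSpectrum α β)) (hVm : Measurable V)
    (hV : HasLaw V (gaussianReal 0 1) μ) (i : ℕ) :
    ∫⁻ ω, ENNReal.ofReal (gaussianSchemeInput μ Z V r i ω ^ 2) ∂μ ≤
      ENNReal.ofReal (powerBound α β r i) := by
  have hI := integrable_gaussianScheme_sq (Z := Z) (r := r) hVm hV i
  have h : ∀ ω, gaussianSchemeInput μ Z V r i ω ^ 2 =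
      (r ^ (2 * i))⁻¹ * (V ω - gaussianSchemeEstimate μ Z V r i ω) ^ 2 := fun ω => by
    rw [gaussianSchemeInput, pow_mul', mul_pow, inv_pow]
  simp only [h]
  have hr : 0 ≤ (r ^ (2 * i))⁻¹ := by rw [pow_mul]; positivity
  rw [← ofReal_integral_eq_lintegral_ofReal (hI.const_mul _) (ae_of_all _ fun ω => by positivity),
    integral_const_mul]
  refine ENNReal.ofReal_le_ofReal ?_
  rcases Nat.eq_zero_or_pos i with rfl | hi
  · have h0 := integral_sub_condExp_sq_le (μ := μ) (V := V) (A := fun _ => 0)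
      (gaussianSchemeSigma_le (μ := μ) (r := r) hVm hZ.measurable 0) (memLp_of_hasLaw_gaussian hVm hV)
      (memLp_const 0) measurable_const
    simp only [sub_zero, integral_sq_of_hasLaw_gaussian hVm hV] at h0
    have h1 : ∫ ω, (V ω - gaussianSchemeEstimate μ Z V r 0 ω) ^ 2 ∂μ ≤ 1 := h0
    simpa [powerBound] using h1
  · rw [powerBound, if_neg (by omega), mul_inv]
    gcongr
    exact integral_gaussianScheme_sq_le hβ hZ hVm hV hi

theorem limsup_gaussianScheme_power_le (hα : α ∈ Set.Icc (-1 : ℝ) 1) (hβ : β ∈ Set.Ioo (-1 : ℝ) 1)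
    (hr0 : r ≠ 0) (hr1 : |r| < 1)
    (hZ : IsGaussianNoise μ Z (armaSpectrum α β)) (hVm : Measurable V)
    (hV : HasLaw V (gaussianReal 0 1) μ) :
    limsup (fun n : ℕ => (∑ i ∈ Finset.range n,
      ∫⁻ ω, ENNReal.ofReal (gaussianSchemeInput μ Z V r i ω ^ 2) ∂μ) / (n : ℝ≥0∞)) atTop ≤
        ENNReal.ofReal (schemePower α β r) := by
  rw [← (tendsto_sum_powerBound hα hβ hr0 hr1).limsup_eq]
  refine limsup_le_limsup (Eventually.of_forall fun n => ?_)
  simp only [← sum_ofReal_powerBound_div hβ]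
  gcongr with i _
  exact lintegral_gaussianSchemeInput_sq_le hβ hZ hVm hV i

theorem le_liminf_mutualInfoBits (hα : α ∈ Set.Icc (-1 : ℝ) 1) (hβ : β ∈ Set.Ioo (-1 : ℝ) 1)
    (hr0 : r ≠ 0) (hr1 : |r| < 1)
    (hZ : IsGaussianNoise μ Z (armaSpectrum α β)) (hVm : Measurable V)
    (hV : HasLaw V (gaussianReal 0 1) μ) :
    ENNReal.ofReal (-Real.logb 2 |r|) ≤ liminf (fun n : ℕ =>
      mutualInfoBits μ V (gaussianSchemeEstimate μ Z V r n) / (n : ℝ≥0∞)) atTop := by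
  obtain ⟨C, hC, hCn⟩ := exists_inv_fisherInfo_le hα hβ hr0 hr1
  have hr : 0 < |r| := abs_pos.2 hr0
  have hlog2 : 0 < Real.log 2 := Real.log_pos one_lt_two
  have hlim : Tendsto (fun n : ℕ => ENNReal.ofReal
      (-Real.logb 2 |r| + -(Real.log C / 2 / Real.log 2) * (n : ℝ)⁻¹)) atTop
      (𝓝 (ENNReal.ofReal (-Real.logb 2 |r|))) := by
    refine ENNReal.tendsto_ofReal ?_
    simpa using (tendsto_inv_atTop_nhds_zero_nat.const_mul
      (-(Real.log C / 2 / Real.log 2))).const_add (-Real.logb 2 |r|)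
  rw [← hlim.liminf_eq]
  refine liminf_le_liminf ?_
  filter_upwards [eventually_ge_atTop 1] with n hn
  have hn' : (0 : ℝ) < n := by exact_mod_cast hn
  have hD : 0 < C * r ^ (2 * n) := by rw [pow_mul]; positivity
  have h := ofReal_le_mutualInfoBits hVm hV (measurable_gaussianSchemeEstimate (Z := Z) (r := r) n)
    hD (integrable_gaussianScheme_sq hVm hV n)
    ((integral_gaussianScheme_sq_le hβ hZ hVm hV hn).trans (hCn n))
  have e : -Real.logb 2 |r| + -(Real.log C / 2 / Real.log 2) * (n : ℝ)⁻¹ =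
      -Real.log (Real.sqrt (C * r ^ (2 * n))) / Real.log 2 / n := by
    have hlr : Real.log (r ^ (2 * n)) = 2 * n * Real.log |r| := by
      rw [← Real.log_abs, abs_pow, Real.log_pow]; push_cast; ring
    rw [Real.log_sqrt hD.le, Real.log_mul hC.ne' (by positivity), hlr, Real.logb]
    field_simp
    ring
  rw [e, ENNReal.ofReal_div_of_pos hn', ENNReal.ofReal_natCast]
  gcongr

end gaussian

section converse

variable {Ω : Type*} {mΩ : MeasurableSpace Ω} {μ : Measure Ω} {Z : ℕ → Ω → ℝ} {α β d : ℝ}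
  {f : FeedbackMap}

/-! ### The energy of the filtered outputs -/

/-- The difference between the prediction of the noise from its past, and the prediction of the
output by the stationary filter with constant gain `d`. -/
noncomputable def mismatch (α β d : ℝ) (f : FeedbackMap) (z : ℕ → ℝ) (i : ℕ) : ℝ :=
  predictor β (innovGain α β) i (fun j : Fin i => z j) -
    predictor β (fun _ => d) i (outputBlock f z i)

/-- The outputs of the channel, filtered with constant gain `d`. -/
noncomputable def filteredOutput (β d : ℝ) (f : FeedbackMap) (z : ℕ → ℝ) (i : ℕ) : ℝ :=
  innovation β (fun _ => d) (channelOutput f z) i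

lemma filteredOutput_eq (α β d : ℝ) (f : FeedbackMap) (z : ℕ → ℝ) (i : ℕ) :
    filteredOutput β d f z i =
      channelInput f z i + mismatch α β d f z i + innovation β (innovGain α β) z i := by
  have : outputBlock f z i = fun j : Fin i => channelOutput f z j := rfl
  rw [filteredOutput, mismatch, innovation, innovation, channelOutput_eq, this]
  ring

lemma mismatch_zero (α β d : ℝ) (f : FeedbackMap) (z : ℕ → ℝ) : mismatch α β d f z 0 = 0 := by
  simp [mismatch, predictor]

lemma mismatch_succ (α β d : ℝ) (f : FeedbackMap) (z : ℕ → ℝ) (i : ℕ) :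
    mismatch α β d f z (i + 1) = -d * mismatch α β d f z i + (β - d) * channelInput f z i +
      (innovGain α β i - d) * innovation β (innovGain α β) z i := by
  have h0 := filteredOutput_eq α β d f z i
  have h1 := filteredOutput_eq α β d f z (i + 1)
  have h2 : filteredOutput β d f z (i + 1) = channelOutput f z (i + 1) + β * channelOutput f z i -
      d * filteredOutput β d f z i := innovation_succ _ _ _ _
  rw [channelOutput_eq, channelOutput_eq] at h2
  have h3 := innovation_succ β (innovGain α β) z i
  linear_combination h2 - h1 - d * h0 - h3

/-- Extend a finite sequence by zeros. -/
noncomputable def zeroExtend {i : ℕ} (u : Fin i → ℝ) (k : ℕ) : ℝ := if h : k < i then u ⟨k, h⟩ else 0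

lemma measurable_zeroExtend (i : ℕ) : Measurable (zeroExtend : (Fin i → ℝ) → ℕ → ℝ) := by
  refine measurable_pi_lambda _ fun k => ?_
  by_cases h : k < i
  · simpa [zeroExtend, h] using measurable_pi_apply (⟨k, h⟩ : Fin i)
  · simp [zeroExtend, h]

lemma outputBlock_zeroExtend (f : FeedbackMap) (z : ℕ → ℝ) (i : ℕ) :
    outputBlock f (zeroExtend fun j : Fin i => z j) i = outputBlock f z i :=
  outputBlock_congr f fun k hk => by simp [zeroExtend, hk]

lemma channelInput_zeroExtend (f : FeedbackMap) (z : ℕ → ℝ) (i : ℕ) :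
    channelInput f (zeroExtend fun j : Fin i => z j) i = channelInput f z i := by
  rw [channelInput, outputBlock_zeroExtend, channelInput]

lemma mismatch_zeroExtend (α β d : ℝ) (f : FeedbackMap) (z : ℕ → ℝ) (i : ℕ) :
    mismatch α β d f (zeroExtend fun j : Fin i => z j) i = mismatch α β d f z i := by
  rw [mismatch, outputBlock_zeroExtend, mismatch]
  congr 2
  funext j
  simp [zeroExtend]

lemma measurable_mismatch (hf : ∀ i, Measurable (f i)) (i : ℕ) :
    Measurable fun z : ℕ → ℝ => mismatch α β d f z i :=
  ((predictor _ _ i).measurable_of_fin.comp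
    (measurable_pi_lambda _ fun _ => measurable_pi_apply _)).sub
    ((predictor _ _ i).measurable_of_fin.comp (measurable_outputBlock hf i))

variable [IsProbabilityMeasure μ]

/-- A function of the noise before time `i` is uncorrelated with the innovation at time `i`. -/
lemma integral_mul_noiseInnov (hβ : β ∈ Set.Ioo (-1 : ℝ) 1)
    (hZ : IsGaussianNoise μ Z (armaSpectrum α β)) {i : ℕ} {F : (Fin i → ℝ) → ℝ}
    (hF : Measurable F) (hI : Integrable (fun ω => F fun j => Z j ω) μ) :
    Integrable (fun ω => (F fun j => Z j ω) * noiseInnov α β Z i ω) μ ∧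
      ∫ ω, (F fun j => Z j ω) * noiseInnov α β Z i ω ∂μ = 0 := by
  have h : IndepFun (fun ω => F fun j => Z j ω) (noiseInnov α β Z i) μ :=
    (hZ.indepFun_noise_noiseInnov hβ i).comp hF measurable_id
  have hN := (hZ.memLp_noiseInnov (α := α) (β := β) i).integrable one_le_two
  refine ⟨h.integrable_mul hI hN, ?_⟩
  rw [h.integral_fun_mul_eq_mul_integral hI.aestronglyMeasurable hN.aestronglyMeasurable,
    hZ.integral_noiseInnov, mul_zero]

lemma memLp_mismatch (hZ : IsGaussianNoise μ Z (armaSpectrum α β)) {n : ℕ}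
    (hX : ∀ i < n, MemLp (fun ω => channelInput f (fun k => Z k ω) i) 2 μ) {i : ℕ} (hi : i ≤ n) :
    MemLp (fun ω => mismatch α β d f (fun k => Z k ω) i) 2 μ := by
  induction i with
  | zero => simp only [mismatch_zero]; exact memLp_const 0
  | succ i ih =>
    simp only [mismatch_succ]
    exact (((ih (by omega)).const_mul _).add ((hX i (by omega)).const_mul _)).add
      ((hZ.memLp_noiseInnov i).const_mul _)

lemma memLp_filteredOutput (hZ : IsGaussianNoise μ Z (armaSpectrum α β)) {n : ℕ}
    (hX : ∀ i < n, MemLp (fun ω => channelInput f (fun k => Z k ω) i) 2 μ) {i : ℕ} (hi : i < n) :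
    MemLp (fun ω => filteredOutput β d f (fun k => Z k ω) i) 2 μ := by
  simp only [filteredOutput_eq α]
  exact ((hX i hi).add (memLp_mismatch hZ hX hi.le)).add (hZ.memLp_noiseInnov i)

lemma mismatch_eq_zero (hβ : β ∈ Set.Ioo (-1 : ℝ) 1) (hαβ : α = β) (hd : d = β) (z : ℕ → ℝ)
    (i : ℕ) : mismatch α β d f z i = 0 := by
  subst hαβ
  have hs : ∀ i, innovVar α α i = 1 := by
    intro i
    induction i with
    | zero => simp [innovVar]
    | succ i ih => rw [innovVar, ih]; ring
  induction i with
  | zero => exact mismatch_zero _ _ _ _ _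
  | succ i ih => rw [mismatch_succ, ih, innovGain, hs, hd]; ring

/-- The dissipation inequality behind the converse: the energy of the filtered outputs is controlled
by the energy of the inputs. -/
lemma sum_integral_filteredOutput_sq_le (hβ : β ∈ Set.Ioo (-1 : ℝ) 1)
    (hZ : IsGaussianNoise μ Z (armaSpectrum α β)) (hf : ∀ i, Measurable (f i)) {v l : ℝ}
    (hv : 0 ≤ v) (hd : α = β → d = β)
    (hq : ∀ x m : ℝ, (α = β → m = 0) →
      (x + m) ^ 2 + v * (-d * m + (β - d) * x) ^ 2 - v * m ^ 2 ≤ l * x ^ 2)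
    {n : ℕ} (hX : ∀ i < n, MemLp (fun ω => channelInput f (fun k => Z k ω) i) 2 μ) :
    ∑ i ∈ Finset.range n, ∫ ω, filteredOutput β d f (fun k => Z k ω) i ^ 2 ∂μ ≤
      l * ∑ i ∈ Finset.range n, ∫ ω, channelInput f (fun k => Z k ω) i ^ 2 ∂μ +
      ∑ i ∈ Finset.range n, (1 + v * (innovGain α β i - d) ^ 2) * innovVar α β i := by
  have step : ∀ i < n, ∫ ω, filteredOutput β d f (fun k => Z k ω) i ^ 2 ∂μ +
      v * ∫ ω, mismatch α β d f (fun k => Z k ω) (i + 1) ^ 2 ∂μ ≤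
      v * ∫ ω, mismatch α β d f (fun k => Z k ω) i ^ 2 ∂μ +
        l * ∫ ω, channelInput f (fun k => Z k ω) i ^ 2 ∂μ +
        (1 + v * (innovGain α β i - d) ^ 2) * innovVar α β i := by
    intro i hi
    set X : Ω → ℝ := fun ω => channelInput f (fun k => Z k ω) i with hXdef
    set m : Ω → ℝ := fun ω => mismatch α β d f (fun k => Z k ω) i with hmdef
    set N : Ω → ℝ := noiseInnov α β Z i with hNdef
    have hXi : MemLp X 2 μ := hX i hi
    have hm : MemLp m 2 μ := memLp_mismatch hZ hX hi.le
    have hm1 := memLp_mismatch (d := d) hZ hX (show i + 1 ≤ n from hi)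
    have hN : MemLp N 2 μ := hZ.memLp_noiseInnov i
    have he := memLp_filteredOutput (d := d) hZ hX hi
    let F : (Fin i → ℝ) → ℝ := fun u =>
      2 * (channelInput f (zeroExtend u) i + mismatch α β d f (zeroExtend u) i +
        v * (innovGain α β i - d) * (-d * mismatch α β d f (zeroExtend u) i +
          (β - d) * channelInput f (zeroExtend u) i))
    have hF : Measurable F := by
      have h1 := (measurable_channelInput hf i).comp (measurable_zeroExtend i)
      have h2 := (measurable_mismatch (α := α) (β := β) (d := d) hf i).comp (measurable_zeroExtend i)
      exact ((h1.add h2).add (((h2.const_mul _).add (h1.const_mul _)).const_mul _)).const_mul _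
    have hFe : ∀ ω, (F fun j => Z j ω) = 2 * (X ω + m ω + v * (innovGain α β i - d) *
        (-d * m ω + (β - d) * X ω)) := fun ω => by
      simp only [F, channelInput_zeroExtend f (fun k => Z k ω),
        mismatch_zeroExtend α β d f (fun k => Z k ω), hXdef, hmdef]
    have hFi : Integrable (fun ω => F fun j => Z j ω) μ := by
      simp only [hFe]
      have hX1 := hXi.integrable one_le_two
      have hm1 := hm.integrable one_le_two
      exact ((hX1.add hm1).add (((hm1.const_mul _).add (hX1.const_mul _)).const_mul _)).const_mul _
    obtain ⟨hFN, hFN0⟩ := integral_mul_noiseInnov hβ hZ hF hFi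
    have hpt : ∀ ω, filteredOutput β d f (fun k => Z k ω) i ^ 2 +
        v * mismatch α β d f (fun k => Z k ω) (i + 1) ^ 2 ≤ v * m ω ^ 2 + l * X ω ^ 2 +
          (1 + v * (innovGain α β i - d) ^ 2) * N ω ^ 2 + (F fun j => Z j ω) * N ω := by
      intro ω
      have hz := hq (X ω) (m ω) fun h => mismatch_eq_zero hβ h (hd h) _ _
      rw [filteredOutput_eq α, mismatch_succ, hFe]
      have e : innovation β (innovGain α β) (fun k => Z k ω) i = N ω := rfl
      have e1 : channelInput f (fun k => Z k ω) i = X ω := rfl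
      have e2 : mismatch α β d f (fun k => Z k ω) i = m ω := rfl
      rw [e, e1, e2]
      nlinarith [hz]
    have hmono := integral_mono (he.integrable_sq.add (hm1.integrable_sq.const_mul v))
      ((((hm.integrable_sq.const_mul v).add (hXi.integrable_sq.const_mul l)).add
        (hN.integrable_sq.const_mul (1 + v * (innovGain α β i - d) ^ 2))).add hFN) hpt
    rw [integral_add' he.integrable_sq (hm1.integrable_sq.const_mul v),
      integral_add' (((hm.integrable_sq.const_mul v).add (hXi.integrable_sq.const_mul l)).add
        (hN.integrable_sq.const_mul (1 + v * (innovGain α β i - d) ^ 2))) hFN,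
      integral_add' ((hm.integrable_sq.const_mul v).add (hXi.integrable_sq.const_mul l))
        (hN.integrable_sq.const_mul (1 + v * (innovGain α β i - d) ^ 2)),
      integral_add' (hm.integrable_sq.const_mul v) (hXi.integrable_sq.const_mul l),
      integral_const_mul, integral_const_mul, integral_const_mul, integral_const_mul, hFN0,
      hZ.integral_noiseInnov_sq hβ, add_zero] at hmono
    exact hmono
  have total : ∀ k ≤ n, ∑ i ∈ Finset.range k, ∫ ω, filteredOutput β d f (fun k => Z k ω) i ^ 2 ∂μ +
      v * ∫ ω, mismatch α β d f (fun k => Z k ω) k ^ 2 ∂μ ≤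
      l * ∑ i ∈ Finset.range k, ∫ ω, channelInput f (fun k => Z k ω) i ^ 2 ∂μ +
      ∑ i ∈ Finset.range k, (1 + v * (innovGain α β i - d) ^ 2) * innovVar α β i := by
    intro k
    induction k with
    | zero => simp [mismatch_zero]
    | succ k ih =>
      intro hk
      have h1 := ih (by omega)
      have h2 := step k (by omega)
      simp only [Finset.sum_range_succ, mul_add]
      linarith
  have h1 := total n le_rfl
  have h2 : 0 ≤ v * ∫ ω, mismatch α β d f (fun k => Z k ω) n ^ 2 ∂μ :=
    mul_nonneg hv (integral_nonneg fun ω => sq_nonneg _)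
  linarith

/-! ### Change of measure -/

/-- The density of the reference output law, under which the filtered outputs are independent
Gaussian with variance `τ`. -/
noncomputable def refDensity (β d τ : ℝ) (n : ℕ) (y : Fin n → ℝ) : ℝ≥0∞ :=
  ∏ i : Fin n, gaussianPDF 0 τ.toNNReal (shear (fun i => predictor β (fun _ => d) i) n y i)

lemma measurable_refDensity (β d τ : ℝ) (n : ℕ) : Measurable (refDensity β d τ n) :=
  Finset.measurable_fun_prod _ fun i _ => (measurable_gaussianPDF _ _).comp
    ((measurable_pi_apply i).comp (measurable_shear (fun _ => LinearMap.measurable_of_fin _) n))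

lemma lintegral_refDensity (β d : ℝ) {τ : ℝ} (hτ : 0 < τ) (n : ℕ) :
    ∫⁻ y, refDensity β d τ n y = 1 := by
  have hm : Measurable fun u : Fin n → ℝ => ∏ i : Fin n, gaussianPDF 0 τ.toNNReal (u i) :=
    Finset.measurable_fun_prod _ fun i _ => (measurable_gaussianPDF _ _).comp (measurable_pi_apply i)
  have h := (shear_measurePreserving (h := fun i => predictor β (fun _ => d) i)
    (fun _ => LinearMap.measurable_of_fin _) n).lintegral_comp hm
  unfold refDensity
  rw [h, lintegral_fin_prod_eq_prod fun i => measurable_gaussianPDF _ _]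
  have : τ.toNNReal ≠ 0 := by simpa using hτ
  simp [lintegral_gaussianPDF_eq_one _ this]

/-- The log-likelihood ratio of a Gaussian of variance `s` at `u` and one of variance `τ` at `e`. -/
noncomputable def gaussianLLR (s τ u e : ℝ) : ℝ :=
  Real.log (τ / s) / 2 - u ^ 2 / (2 * s) + e ^ 2 / (2 * τ)

lemma gaussianPDF_mul_exp_neg_llr {s τ : ℝ} (hs : 0 < s) (hτ : 0 < τ) (u e : ℝ) :
    gaussianPDF 0 s.toNNReal u * ENNReal.ofReal (Real.exp (-gaussianLLR s τ u e)) =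
      gaussianPDF 0 τ.toNNReal e := by
  rw [gaussianPDF, gaussianPDF, ← ENNReal.ofReal_mul (gaussianPDFReal_nonneg _ _ _)]
  congr 1
  rw [gaussianPDFReal, gaussianPDFReal, Real.coe_toNNReal _ hs.le, Real.coe_toNNReal _ hτ.le,
    mul_assoc, ← Real.exp_add, sub_zero, sub_zero]
  have h1 : -u ^ 2 / (2 * s) + -gaussianLLR s τ u e = -(Real.log (τ / s) / 2) + -e ^ 2 / (2 * τ) := by
    rw [gaussianLLR]; ring
  have h2 : Real.exp (-(Real.log (τ / s) / 2)) = Real.sqrt s / Real.sqrt τ := by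
    rw [← Real.log_sqrt (by positivity), Real.exp_neg, Real.exp_log (by positivity),
      Real.sqrt_div hτ.le, inv_div]
  have h3 : 0 < Real.sqrt s := Real.sqrt_pos.2 hs
  have h4 : 0 < Real.sqrt τ := Real.sqrt_pos.2 hτ
  have h5 : 0 < Real.sqrt (2 * Real.pi) := by positivity
  have h6 : 0 ≤ 2 * Real.pi := by positivity
  rw [h1, Real.exp_add, h2, Real.sqrt_mul h6 s, Real.sqrt_mul h6 τ]
  field_simp

/-- The log-likelihood ratio of the output law given the encoder and the reference law, as a
function of the noise. -/
noncomputable def outputLLR (α β d τ : ℝ) (f : FeedbackMap) (n : ℕ) (z : ℕ → ℝ) : ℝ :=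
  ∑ i : Fin n, gaussianLLR (innovVar α β i) τ (innovation β (innovGain α β) z i)
    (filteredOutput β d f z i)

lemma lintegral_mul_exp_neg_outputLLR (hβ : β ∈ Set.Ioo (-1 : ℝ) 1)
    (hZ : IsGaussianNoise μ Z (armaSpectrum α β)) (hf : ∀ i, Measurable (f i)) {τ : ℝ} (hτ : 0 < τ)
    {n : ℕ} {φ : (Fin n → ℝ) → ℝ≥0∞} (hφ : Measurable φ) :
    ∫⁻ ω, φ (outputBlock f (fun k => Z k ω) n) *
        ENNReal.ofReal (Real.exp (-outputLLR α β d τ f n (fun k => Z k ω))) ∂μ =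
      ∫⁻ y, φ y * refDensity β d τ n y := by
  have hp : ∀ (g : ℕ → ℝ) i, Measurable (predictor β g i) := fun g i =>
    LinearMap.measurable_of_fin _
  have hY : Measurable fun ω => outputBlock f (fun k => Z k ω) n :=
    (measurable_outputBlock hf n).comp (measurable_pi_lambda _ hZ.measurable)
  have hA : Measurable fun y : Fin n → ℝ =>
      shear (fun i => predictor β (innovGain α β) i) n (shear f n y) :=
    (measurable_shear (hp _) n).comp (measurable_shear hf n)
  have hB : Measurable fun y : Fin n → ℝ => shear (fun i => predictor β (fun _ => d) i) n y :=
    measurable_shear (hp _) n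
  let Λ : (Fin n → ℝ) → ℝ := fun y => ∑ i : Fin n, gaussianLLR (innovVar α β i) τ
    (shear (fun i => predictor β (innovGain α β) i) n (shear f n y) i)
    (shear (fun i => predictor β (fun _ => d) i) n y i)
  have hΛ : Measurable Λ := by
    refine Finset.measurable_fun_sum _ fun i _ => ?_
    have h1 := (measurable_pi_apply i).comp hA
    have h2 := (measurable_pi_apply i).comp hB
    exact ((((h1.pow_const 2).div_const _).const_sub _)).add ((h2.pow_const 2).div_const _)
  have hΛY : ∀ ω, outputLLR α β d τ f n (fun k => Z k ω) =
      Λ (outputBlock f (fun k => Z k ω) n) := by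
    intro ω
    simp only [Λ, shear_outputBlock]
    rfl
  have hm : Measurable fun y => φ y * ENNReal.ofReal (Real.exp (-Λ y)) :=
    hφ.mul (Real.measurable_exp.comp hΛ.neg).ennreal_ofReal
  simp only [hΛY]
  rw [← lintegral_map (f := fun y => φ y * ENNReal.ofReal (Real.exp (-Λ y))) hm hY,
    map_outputBlock hβ hZ hf n, lintegral_withDensity_eq_lintegral_mul _ _ hm]
  · refine lintegral_congr fun y => ?_
    simp only [Pi.mul_apply]
    rw [mul_left_comm]
    congr 1
    rw [refDensity, ← Finset.sum_neg_distrib, Real.exp_sum,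
      ENNReal.ofReal_prod_of_nonneg fun i _ => (Real.exp_pos _).le, ← Finset.prod_mul_distrib]
    exact Finset.prod_congr rfl fun i _ =>
      gaussianPDF_mul_exp_neg_llr (innovVar_pos hβ i) hτ _ _
  · exact Finset.measurable_fun_prod _ fun i _ => (measurable_gaussianPDF _ _).comp
      ((measurable_pi_apply i).comp hA)

lemma integrable_outputLLR (hβ : β ∈ Set.Ioo (-1 : ℝ) 1)
    (hZ : IsGaussianNoise μ Z (armaSpectrum α β)) {τ : ℝ} {n : ℕ}
    (hX : ∀ i < n, MemLp (fun ω => channelInput f (fun k => Z k ω) i) 2 μ) :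
    Integrable (fun ω => outputLLR α β d τ f n (fun k => Z k ω)) μ ∧
    ∫ ω, outputLLR α β d τ f n (fun k => Z k ω) ∂μ = ∑ i ∈ Finset.range n,
      (Real.log (τ / innovVar α β i) / 2 - 1 / 2 +
        (∫ ω, filteredOutput β d f (fun k => Z k ω) i ^ 2 ∂μ) / (2 * τ)) := by
  have h1 : ∀ i : Fin n, Integrable (fun ω => noiseInnov α β Z i ω ^ 2 / (2 * innovVar α β i)) μ :=
    fun i => (hZ.memLp_noiseInnov i).integrable_sq.div_const _
  have h2 : ∀ i : Fin n, Integrable (fun ω =>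
      filteredOutput β d f (fun k => Z k ω) i ^ 2 / (2 * τ)) μ :=
    fun i => (memLp_filteredOutput hZ hX i.isLt).integrable_sq.div_const _
  have h3 : ∀ i : Fin n, Integrable (fun ω => gaussianLLR (innovVar α β i) τ
      (innovation β (innovGain α β) (fun k => Z k ω) i) (filteredOutput β d f (fun k => Z k ω) i)) μ :=
    fun i => ((integrable_const _).sub (h1 i)).add (h2 i)
  refine ⟨integrable_finsetSum _ fun i _ => h3 i, ?_⟩
  unfold outputLLR
  rw [integral_finsetSum _ fun i _ => h3 i, ← Fin.sum_univ_eq_sum_range (fun i =>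
    (Real.log (τ / innovVar α β i) / 2 - 1 / 2 +
        (∫ ω, filteredOutput β d f (fun k => Z k ω) i ^ 2 ∂μ) / (2 * τ)))]
  refine Finset.sum_congr rfl fun i _ => ?_
  have e : ∫ ω, gaussianLLR (innovVar α β i) τ (innovation β (innovGain α β) (fun k => Z k ω) i)
      (filteredOutput β d f (fun k => Z k ω) i) ∂μ =
      ∫ ω, (Real.log (τ / innovVar α β i) / 2 - noiseInnov α β Z i ω ^ 2 / (2 * innovVar α β i) +
        filteredOutput β d f (fun k => Z k ω) i ^ 2 / (2 * τ)) ∂μ := rfl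
  have hs := (innovVar_pos (α := α) hβ i).ne'
  have hc : Integrable (fun ω => Real.log (τ / innovVar α β i) / 2 -
      noiseInnov α β Z i ω ^ 2 / (2 * innovVar α β i)) μ := (integrable_const _).sub (h1 i)
  rw [e, integral_add hc (h2 i), integral_sub (integrable_const _) (h1 i)]
  simp only [integral_div, hZ.integral_noiseInnov_sq hβ]
  simp only [integral_const, probReal_univ, smul_eq_mul, one_mul]
  field_simp

/-- A Fano-type inequality: the probability of correct decoding is bounded through the log-likelihood
ratios against any fixed reference law of the outputs. -/
lemma sum_log_mul_correct_le (hβ : β ∈ Set.Ioo (-1 : ℝ) 1)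
    (hZ : IsGaussianNoise μ Z (armaSpectrum α β)) {τ : ℝ} (hτ : 0 < τ) {n M : ℕ} (hM : 1 ≤ M)
    (c : FeedbackCode n M)
    (hX : ∀ w, ∀ i < n, MemLp (fun ω => channelInput (c.enc w) (fun k => Z k ω) i) 2 μ) :
    ∑ w, (Real.log M * (1 - μ.real {ω | c.dec (outputBlock (c.enc w) (fun k => Z k ω) n) ≠ w}) -
      ∫ ω, outputLLR α β d τ (c.enc w) n (fun k => Z k ω) ∂μ) ≤ M * Real.log 2 := by
  classical
  have hM0 : (0 : ℝ) < M := by exact_mod_cast hM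
  set q := (volume : Measure (Fin n → ℝ)).withDensity (refDensity β d τ n) with hqdef
  have hq1 : IsProbabilityMeasure q := ⟨by
    rw [hqdef, withDensity_apply _ MeasurableSet.univ, Measure.restrict_univ,
      lintegral_refDensity β d hτ]⟩
  let A : Fin M → Set (Fin n → ℝ) := fun w => c.dec ⁻¹' {w}
  have hA : ∀ w, MeasurableSet (A w) := fun w => c.measurable_dec (measurableSet_singleton w)
  have hAsum : ∑ w, q.real (A w) = 1 := by
    rw [← measureReal_iUnion_fintype (fun i j hij => Disjoint.preimage _ (by simpa using hij)) hA]
    have : ⋃ w, A w = Set.univ := by ext y; simp [A]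
    rw [this, probReal_univ]
  let K : Fin M → ℝ := fun w => 1 + (M - 1) * q.real (A w)
  have hM1 : (0 : ℝ) ≤ M - 1 := by
    have : (1 : ℝ) ≤ M := by exact_mod_cast hM
    linarith
  have hK : ∀ w, 0 < K w := fun w => by
    have : 0 ≤ (M - 1) * q.real (A w) := mul_nonneg hM1 measureReal_nonneg
    simp only [K]; linarith
  have key : ∀ w, Real.log M *
      (1 - μ.real {ω | c.dec (outputBlock (c.enc w) (fun k => Z k ω) n) ≠ w}) -
      ∫ ω, outputLLR α β d τ (c.enc w) n (fun k => Z k ω) ∂μ ≤ Real.log (K w) := by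
    intro w
    have hY : Measurable fun ω => outputBlock (c.enc w) (fun k => Z k ω) n :=
      (measurable_outputBlock (c.measurable_enc w) n).comp (measurable_pi_lambda _ hZ.measurable)
    obtain ⟨hLi, -⟩ := integrable_outputLLR (d := d) (τ := τ) hβ hZ (hX w)
    set B : Set Ω := {ω | c.dec (outputBlock (c.enc w) (fun k => Z k ω) n) = w} with hB
    have hBm : MeasurableSet B := hY (hA w)
    have hcompl : {ω | c.dec (outputBlock (c.enc w) (fun k => Z k ω) n) ≠ w} = Bᶜ := rfl
    have hind : Integrable (B.indicator fun _ => Real.log M) μ :=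
      (integrable_const _).indicator hBm
    have e1 : ∫ ω, (B.indicator (fun _ => Real.log M) ω -
        outputLLR α β d τ (c.enc w) n (fun k => Z k ω)) ∂μ = Real.log M * (1 - μ.real Bᶜ) -
        ∫ ω, outputLLR α β d τ (c.enc w) n (fun k => Z k ω) ∂μ := by
      rw [integral_sub hind hLi, integral_indicator_const _ hBm, probReal_compl_eq_one_sub hBm,
        smul_eq_mul]
      ring
    rw [hcompl, ← e1]
    refine integral_le_log_of_lintegral_exp_le (hind.sub hLi) (hK w) ?_
    have hφ : Measurable ((A w).indicator (fun _ => (M : ℝ≥0∞) - 1) + 1) :=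
      (measurable_const.indicator (hA w)).add measurable_const
    have e2 := lintegral_mul_exp_neg_outputLLR (d := d) hβ hZ (c.measurable_enc w) hτ hφ
    have hM1' : (M : ℝ≥0∞) - 1 + 1 = M := tsub_add_cancel_of_le (by exact_mod_cast hM)
    have e3 : ∀ ω, ENNReal.ofReal (Real.exp ((B.indicator (fun _ => Real.log M) - fun ω =>
        outputLLR α β d τ (c.enc w) n (fun k => Z k ω)) ω)) =
        ((A w).indicator (fun _ => (M : ℝ≥0∞) - 1) + 1)
          (outputBlock (c.enc w) (fun k => Z k ω) n) *
        ENNReal.ofReal (Real.exp (-outputLLR α β d τ (c.enc w) n (fun k => Z k ω))) := by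
      intro ω
      rw [Pi.sub_apply, sub_eq_add_neg, Real.exp_add, ENNReal.ofReal_mul (Real.exp_pos _).le]
      congr 1
      by_cases h : c.dec (outputBlock (c.enc w) (fun k => Z k ω) n) = w
      · rw [Set.indicator_of_mem (show ω ∈ B from h), Real.exp_log hM0, Pi.add_apply,
          Set.indicator_of_mem (show _ ∈ A w from h), Pi.one_apply, hM1', ENNReal.ofReal_natCast]
      · rw [Set.indicator_of_notMem (show ω ∉ B from h), Pi.add_apply,
          Set.indicator_of_notMem (show _ ∉ A w from h)]
        simp
    have e4 : ∫⁻ y, ((A w).indicator (fun _ => (M : ℝ≥0∞) - 1) + 1) y * refDensity β d τ n y =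
        ENNReal.ofReal (K w) := by
      have h1 : ∀ y, ((A w).indicator (fun _ => (M : ℝ≥0∞) - 1) + 1) y * refDensity β d τ n y =
          (refDensity β d τ n * ((A w).indicator (fun _ => (M : ℝ≥0∞) - 1) + 1)) y := fun y => by
        rw [Pi.mul_apply, mul_comm]
      simp only [h1]
      rw [← lintegral_withDensity_eq_lintegral_mul _ (measurable_refDensity β d τ n) hφ]
      simp only [Pi.add_apply, Pi.one_apply]
      rw [lintegral_add_right _ measurable_const, lintegral_indicator_const (hA w), ← hqdef]
      simp only [lintegral_const, measure_univ, mul_one]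
      rw [← ENNReal.ofReal_toReal (measure_ne_top q (A w)), add_comm]
      have h2 : (M : ℝ≥0∞) - 1 = ENNReal.ofReal ((M : ℝ) - 1) := by
        rw [ENNReal.ofReal_sub _ zero_le_one, ENNReal.ofReal_natCast, ENNReal.ofReal_one]
      rw [h2, ← ENNReal.ofReal_mul hM1, ← ENNReal.ofReal_one, ← ENNReal.ofReal_add zero_le_one
        (mul_nonneg hM1 ENNReal.toReal_nonneg)]
      rfl
    rw [← e4, ← e2]
    exact le_of_eq (lintegral_congr e3)
  have hlog : ∀ w, Real.log (K w) ≤ K w / 2 - 1 + Real.log 2 := fun w => by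
    have := Real.log_le_sub_one_of_pos (half_pos (hK w))
    rw [Real.log_div (hK w).ne' two_ne_zero] at this
    linarith
  calc _ ≤ ∑ w, (K w / 2 - 1 + Real.log 2) := Finset.sum_le_sum fun w _ => (key w).trans (hlog w)
    _ = (∑ w, K w) / 2 - M + M * Real.log 2 := by
        rw [Finset.sum_add_distrib, Finset.sum_sub_distrib, Finset.sum_div]; simp
    _ ≤ _ := by
        simp only [K, Finset.sum_add_distrib, ← Finset.mul_sum, hAsum]
        simp
        linarith

end converse

/-! ### The root -/

section root

variable {α β P : ℝ}

lemma armaSign_sq (α β : ℝ) : armaSign α β ^ 2 = 1 := by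
  unfold armaSign; split_ifs <;> norm_num

lemma abs_armaSign (α β : ℝ) : |armaSign α β| = 1 := by
  unfold armaSign; split_ifs <;> norm_num

lemma armaSign_mul_sub_nonneg (α β : ℝ) : 0 ≤ armaSign α β * (β - α) := by
  unfold armaSign; split_ifs <;> linarith

lemma armaSign_mul_mem {a : ℝ} (ha : a ∈ Set.Icc (-1 : ℝ) 1) : armaSign α β * a ∈ Set.Icc (-1 : ℝ) 1 := by
  rw [Set.mem_Icc, ← abs_le, abs_mul, abs_armaSign, one_mul]
  exact abs_le.2 ha

lemma abs_armaSign_mul {x : ℝ} (hx : 0 < x) : |armaSign α β * x| = x := by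
  rw [abs_mul, abs_armaSign, one_mul, abs_of_pos hx]

lemma schemePower_armaSign_mul (x : ℝ) : schemePower α β (armaSign α β * x) =
    (1 - x ^ 2) * (1 + armaSign α β * α * x) ^ 2 / ((1 + armaSign α β * β * x) ^ 2 * x ^ 2) := by
  rw [schemePower, mul_pow, armaSign_sq, one_mul]
  congr 3 <;> ring

lemma schemePower_lt (hα : α ∈ Set.Icc (-1 : ℝ) 1) (hβ : β ∈ Set.Ioo (-1 : ℝ) 1) {x y : ℝ}
    (hx : 0 < x) (hxy : x < y) (hy : y < 1) :
    schemePower α β (armaSign α β * y) < schemePower α β (armaSign α β * x) := by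
  have hpos : ∀ {a z : ℝ}, a ∈ Set.Icc (-1 : ℝ) 1 → 0 < z → z < 1 →
      0 < 1 + armaSign α β * a * z := fun ha h0 h1 =>
    one_add_mul_pos (armaSign_mul_mem ha) (by rwa [abs_of_pos h0])
  have hβ' := Set.Ioo_subset_Icc_self hβ
  have h1 := hpos hα hx (hxy.trans hy)
  have h2 := hpos hβ' hx (hxy.trans hy)
  have h3 := hpos hα (hx.trans hxy) hy
  have h4 := hpos hβ' (hx.trans hxy) hy
  have hq : (1 + armaSign α β * α * y) / (1 + armaSign α β * β * y) ≤
      (1 + armaSign α β * α * x) / (1 + armaSign α β * β * x) := by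
    rw [div_le_div_iff₀ h4 h2]
    nlinarith [mul_nonneg (armaSign_mul_sub_nonneg α β) (sub_pos.2 hxy).le]
  have hs : (1 - y ^ 2) / y ^ 2 < (1 - x ^ 2) / x ^ 2 := by
    have hy0 : 0 < y := hx.trans hxy
    rw [div_lt_div_iff₀ (by positivity) (by positivity)]
    nlinarith
  have e : ∀ z, schemePower α β (armaSign α β * z) =
      (1 - z ^ 2) / z ^ 2 * ((1 + armaSign α β * α * z) / (1 + armaSign α β * β * z)) ^ 2 := by
    intro z
    rw [schemePower_armaSign_mul, div_pow, div_mul_div_comm]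
    congr 1
    ring
  have hx2 : 0 ≤ (1 - x ^ 2) / x ^ 2 := div_nonneg (by nlinarith) (sq_nonneg _)
  rw [e, e]
  exact mul_lt_mul hs (pow_le_pow_left₀ (div_pos h3 h4).le hq 2) (by positivity) hx2

lemma isArmaRoot_iff (hβ : β ∈ Set.Ioo (-1 : ℝ) 1) (hP : 0 < P)
    (x : ℝ) : IsArmaRoot α β P x ↔ 0 < x ∧ x < 1 ∧ schemePower α β (armaSign α β * x) = P := by
  rw [schemePower_armaSign_mul, IsArmaRoot]
  refine and_congr_right fun hx => ?_
  constructor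
  · rintro ⟨h1, h2⟩
    have hx1 : x < 1 := by
      by_contra h
      have h3 : 0 < P * x ^ 2 := by positivity
      rw [h2] at h3
      have h4 : (1 - x ^ 2) * (1 + armaSign α β * α * x) ^ 2 / (1 + armaSign α β * β * x) ^ 2 ≤ 0 :=
        div_nonpos_of_nonpos_of_nonneg
          (mul_nonpos_of_nonpos_of_nonneg (by nlinarith) (sq_nonneg _)) (sq_nonneg _)
      linarith
    refine ⟨hx1, ?_⟩
    rw [← div_div, ← h2, mul_div_assoc, div_self (by positivity), mul_one]
  · rintro ⟨hx1, h2⟩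
    have h1 : 0 < 1 + armaSign α β * β * x :=
      one_add_mul_pos (armaSign_mul_mem (Set.Ioo_subset_Icc_self hβ)) (by rwa [abs_of_pos hx])
    refine ⟨h1.ne', ?_⟩
    rw [← h2]
    field_simp

lemma exists_root (hβ : β ∈ Set.Ioo (-1 : ℝ) 1) (hP : 0 < P) :
    ∃ x, 0 < x ∧ x < 1 ∧ schemePower α β (armaSign α β * x) = P := by
  set a := armaSign α β * α
  set b := armaSign α β * β with hb
  have hpos : ∀ z ∈ Set.Icc (0 : ℝ) 1, 0 < 1 + b * z := by
    intro z hz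
    have h1 : |b| < 1 := by rw [hb, abs_mul, abs_armaSign, one_mul]; exact abs_lt.2 hβ
    have h2 : |b * z| < 1 := by
      rw [abs_mul]
      exact (mul_le_of_le_one_right (abs_nonneg _) (by rw [abs_of_nonneg hz.1]; exact hz.2)).trans_lt h1
    linarith [(abs_lt.1 h2).1]
  have hc : ContinuousOn (fun z : ℝ => P * z ^ 2 * (1 + b * z) ^ 2 - (1 - z ^ 2) * (1 + a * z) ^ 2)
      (Set.Icc 0 1) := by fun_prop
  have h1 := hpos 1 ⟨zero_le_one, le_rfl⟩
  obtain ⟨x, ⟨hx0, hx1⟩, hx⟩ := intermediate_value_Ioo zero_le_one hc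
    (show (0 : ℝ) ∈ Set.Ioo _ _ from ⟨by norm_num, by
      have : 0 < P * 1 ^ 2 * (1 + b * 1) ^ 2 := by positivity
      simpa using this⟩)
  refine ⟨x, hx0, hx1, ?_⟩
  have h2 := hpos x ⟨hx0.le, hx1.le⟩
  rw [schemePower_armaSign_mul, div_eq_iff (by positivity)]
  linear_combination -hx

end root

/-! ### The converse -/

lemma exists_dissipation_constants {α β r : ℝ} (hα : α ∈ Set.Icc (-1 : ℝ) 1)
    (hβ : β ∈ Set.Ioo (-1 : ℝ) 1) (hr0 : r ≠ 0) (hr1 : |r| < 1) (hr : 0 ≤ (β - α) * r) :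
    ∃ d v l : ℝ, 0 ≤ v ∧ 0 ≤ l ∧ (α = β → d = β) ∧
      (∀ x m : ℝ, (α = β → m = 0) →
        (x + m) ^ 2 + v * (-d * m + (β - d) * x) ^ 2 - v * m ^ 2 ≤ l * x ^ 2) ∧
      1 + v * (α - d) ^ 2 + l * schemePower α β r = 1 / r ^ 2 := by
  have har := one_add_mul_pos hα hr1
  have hbr := one_add_mul_pos (Set.Ioo_subset_Icc_self hβ) hr1
  obtain ⟨c, hc⟩ : ∃ c, c = (β - α) * r / (1 + α * r) := ⟨_, rfl⟩
  have hc0 : 0 ≤ c := by rw [hc]; positivity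
  have hc1 : 0 < 1 + c := by linarith
  have hcα : (1 + c) * (1 + α * r) = 1 + β * r := by rw [hc]; field_simp; ring
  obtain ⟨d, hd⟩ : ∃ d, d = (β - c * r) / (1 + c) := ⟨_, rfl⟩
  have hdc : (1 + c) * d = β - c * r := by rw [hd]; field_simp
  have hd1 : |d| ≤ 1 := by
    rw [hd, abs_div, abs_of_pos hc1, div_le_one hc1]
    have h1 := abs_sub β (c * r)
    rw [abs_mul, abs_of_nonneg hc0] at h1
    have h2 : |β| < 1 := abs_lt.2 hβ
    nlinarith
  have hdr : 0 < 1 + d * r := one_add_mul_pos (abs_le.1 hd1) hr1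
  have hbd : 0 ≤ 1 - β * d := by
    have h2 : |β * d| ≤ 1 := by
      rw [abs_mul]
      exact mul_le_one₀ (abs_lt.2 hβ).le (abs_nonneg _) hd1
    linarith [(abs_le.1 h2).2]
  have hαβ : c = 0 ↔ α = β := by
    rw [hc, div_eq_zero_iff, mul_eq_zero, sub_eq_zero]
    constructor
    · rintro ((h | h) | h)
      · exact h.symm
      · exact absurd h hr0
      · exact absurd h har.ne'
    · intro h; exact Or.inl (Or.inl h.symm)
  have hαd : (1 + c) * r * (α - d) = -(c * (1 - r ^ 2)) := by
    linear_combination hcα - r * hdc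
  have hα' : α - d = -(c * (1 - r ^ 2)) / ((1 + c) * r) := by
    rw [eq_div_iff (mul_ne_zero hc1.ne' hr0), ← hαd]; ring
  have hPow : schemePower α β r = (1 - r ^ 2) / (r ^ 2 * (1 + c) ^ 2) := by
    have := har.ne'
    rw [schemePower, ← hcα, div_eq_div_iff (by positivity) (by positivity)]
    ring
  refine ⟨d, (1 + c) / (c * (1 + d * r)), (1 + c) * (1 + β * r) / (1 + d * r), by positivity,
    by positivity, fun h => ?_, fun x m hm => ?_, ?_⟩
  · rw [hd, hαβ.2 h]; simp
  · have hβe : β = (1 + c) * d + c * r := by linarith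
    rcases hc0.eq_or_lt with h | h
    · have h0 : c = 0 := h.symm
      rw [hm (hαβ.1 h0)]
      have hβd : β = d := by rw [hβe, h0]; ring
      rw [h0, hβd]
      simp
      rw [div_self hdr.ne', one_mul]
    · have key : (1 + c) * (1 + β * r) / (1 + d * r) * x ^ 2 -
          ((x + m) ^ 2 + (1 + c) / (c * (1 + d * r)) * (-d * m + (β - d) * x) ^ 2 -
            (1 + c) / (c * (1 + d * r)) * m ^ 2) =
          c * (1 - β * d) / (1 + d * r) * (x - m / c) ^ 2 := by
        rw [hβe]
        field_simp
        ring
      have h3 : 0 ≤ c * (1 - β * d) / (1 + d * r) * (x - m / c) ^ 2 := by positivity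
      linarith
  · rw [hα', hPow]
    have hβe : β * r = (1 + c) * (1 + d * r) - 1 - c * (1 - r ^ 2) := by linear_combination -r * hdc
    rw [hβe]
    rcases hc0.eq_or_lt with h | h
    · rw [← h]
      field_simp
      ring
    · field_simp
      ring

section capacity

variable {Ω : Type*} {mΩ : MeasurableSpace Ω} {μ : Measure Ω} [IsProbabilityMeasure μ]
  {Z : ℕ → Ω → ℝ} {α β r P R : ℝ}

/-- The finite-block converse. -/
lemma log_mul_correct_le (hβ : β ∈ Set.Ioo (-1 : ℝ) 1)
    (hZ : IsGaussianNoise μ Z (armaSpectrum α β)) {d v l τ : ℝ} (hτ : 0 < τ) (hv : 0 ≤ v)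
    (hl : 0 ≤ l) (hd : α = β → d = β)
    (hq : ∀ x m : ℝ, (α = β → m = 0) →
      (x + m) ^ 2 + v * (-d * m + (β - d) * x) ^ 2 - v * m ^ 2 ≤ l * x ^ 2)
    (hP : 0 ≤ P) {n M : ℕ} (hn : 1 ≤ n) (hM : 1 ≤ M) (c : FeedbackCode n M)
    (hc : avgPower μ Z n c.enc ≤ ENNReal.ofReal P) :
    Real.log M * (1 - c.errorProb μ Z) ≤ Real.log 2 + n * (Real.log τ / 2 - 1 / 2) +
      (l * (n * P) + ∑ i ∈ Finset.range n,
        (1 + v * (innovGain α β i - d) ^ 2) * innovVar α β i) / (2 * τ) := by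
  have hn0 : (0 : ℝ) < n := by exact_mod_cast hn
  have hM0 : (0 : ℝ) < M := by exact_mod_cast hM
  have hXm : ∀ w i, Measurable fun ω => channelInput (c.enc w) (fun k => Z k ω) i := fun w i =>
    (measurable_channelInput (c.measurable_enc w) i).comp (measurable_pi_lambda _ hZ.measurable)
  have hsum : ∑ i ∈ Finset.range n, ∑ w : Fin M, ∫⁻ ω, ENNReal.ofReal
      ((channelInput (c.enc w) (fun k => Z k ω) i) ^ 2) ∂μ ≤ ENNReal.ofReal (P * n * M) := by
    have h1 := hc
    rw [avgPower, ENNReal.div_le_iff (by simp; omega) (by simp)] at h1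
    simp only [div_eq_mul_inv] at h1
    rw [← Finset.sum_mul, ← div_eq_mul_inv, ENNReal.div_le_iff (by simp; omega) (by simp)] at h1
    rwa [ENNReal.ofReal_mul (by positivity), ENNReal.ofReal_mul hP, ENNReal.ofReal_natCast,
      ENNReal.ofReal_natCast]
  have hX : ∀ w, ∀ i < n, MemLp (fun ω => channelInput (c.enc w) (fun k => Z k ω) i) 2 μ := by
    intro w i hi
    rw [memLp_two_iff_integrable_sq (hXm w i).aestronglyMeasurable]
    refine (lintegral_ofReal_ne_top_iff_integrable ((hXm w i).pow_const 2).aestronglyMeasurable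
      (ae_of_all _ fun ω => sq_nonneg _)).1 (ne_of_lt ?_)
    refine lt_of_le_of_lt ?_ (hsum.trans_lt ENNReal.ofReal_lt_top)
    exact (Finset.single_le_sum (f := fun w => ∫⁻ ω, ENNReal.ofReal
      ((channelInput (c.enc w) (fun k => Z k ω) i) ^ 2) ∂μ) (fun _ _ => zero_le)
      (Finset.mem_univ w)).trans (Finset.single_le_sum (f := fun i => ∑ w : Fin M,
      ∫⁻ ω, ENNReal.ofReal ((channelInput (c.enc w) (fun k => Z k ω) i) ^ 2) ∂μ)
      (fun _ _ => zero_le) (Finset.mem_range.2 hi))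
  have hpow : ∑ w : Fin M, ∑ i ∈ Finset.range n,
      ∫ ω, channelInput (c.enc w) (fun k => Z k ω) i ^ 2 ∂μ ≤ P * n * M := by
    rw [Finset.sum_comm]
    have hnn : ∀ i w, 0 ≤ ∫ ω, channelInput (c.enc w) (fun k => Z k ω) i ^ 2 ∂μ :=
      fun i w => integral_nonneg fun ω => sq_nonneg _
    rw [← ENNReal.ofReal_le_ofReal_iff (by positivity), ENNReal.ofReal_sum_of_nonneg
      fun i _ => Finset.sum_nonneg fun w _ => hnn i w]
    refine le_trans (le_of_eq (Finset.sum_congr rfl fun i hi => ?_)) hsum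
    rw [ENNReal.ofReal_sum_of_nonneg fun w _ => hnn i w]
    refine Finset.sum_congr rfl fun w _ => ?_
    exact ofReal_integral_eq_lintegral_ofReal (hX w i (Finset.mem_range.1 hi)).integrable_sq
      (ae_of_all _ fun ω => sq_nonneg _)
  have hfano := sum_log_mul_correct_le (d := d) hβ hZ hτ hM c hX
  have hllr : ∀ w, ∫ ω, outputLLR α β d τ (c.enc w) n (fun k => Z k ω) ∂μ ≤
      n * (Real.log τ / 2 - 1 / 2) +
      (l * ∑ i ∈ Finset.range n, ∫ ω, channelInput (c.enc w) (fun k => Z k ω) i ^ 2 ∂μ +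
        ∑ i ∈ Finset.range n, (1 + v * (innovGain α β i - d) ^ 2) * innovVar α β i) / (2 * τ) := by
    intro w
    rw [(integrable_outputLLR hβ hZ (hX w)).2, Finset.sum_add_distrib, ← Finset.sum_div]
    refine add_le_add ?_ (div_le_div_of_nonneg_right
      (sum_integral_filteredOutput_sq_le hβ hZ (c.measurable_enc w) hv hd hq (hX w)) (by positivity))
    calc _ ≤ ∑ i ∈ Finset.range n, (Real.log τ / 2 - 1 / 2) := by
          refine Finset.sum_le_sum fun i _ => ?_
          have h1 := one_le_innovVar (α := α) hβ i
          have h2 : Real.log (τ / innovVar α β i) ≤ Real.log τ :=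
            Real.log_le_log (div_pos hτ (innovVar_pos hβ i)) (div_le_self hτ.le h1)
          linarith
      _ = _ := by rw [Finset.sum_const, Finset.card_range, nsmul_eq_mul]
  have herr : ∑ w, (1 - μ.real {ω | c.dec (outputBlock (c.enc w) (fun k => Z k ω) n) ≠ w}) =
      M * (1 - c.errorProb μ Z) := by
    rw [Finset.sum_sub_distrib, FeedbackCode.errorProb]
    simp
    field_simp
  rw [Finset.sum_sub_distrib, ← Finset.mul_sum, herr] at hfano
  have h3 := Finset.sum_le_sum fun w (_ : w ∈ Finset.univ) => hllr w
  rw [Finset.sum_add_distrib, ← Finset.sum_div, Finset.sum_add_distrib] at h3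
  simp only [← Finset.mul_sum, Finset.sum_const, Finset.card_univ, Fintype.card_fin, nsmul_eq_mul] at h3
  set κ := ∑ i ∈ Finset.range n, (1 + v * (innovGain α β i - d) ^ 2) * innovVar α β i
  have h4 : (l * ∑ w : Fin M, ∑ i ∈ Finset.range n,
      ∫ ω, channelInput (c.enc w) (fun k => Z k ω) i ^ 2 ∂μ + M * κ) / (2 * τ) ≤
      (l * (P * n * M) + M * κ) / (2 * τ) := by gcongr
  have h5 : (l * (P * n * M) + M * κ) / (2 * τ) = M * ((l * (n * P) + κ) / (2 * τ)) := by ring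
  refine le_of_mul_le_mul_left ?_ hM0
  nlinarith

theorem le_of_isAchievable (hα : α ∈ Set.Icc (-1 : ℝ) 1) (hβ : β ∈ Set.Ioo (-1 : ℝ) 1)
    (hr0 : r ≠ 0) (hr1 : |r| < 1) (hr : 0 ≤ (β - α) * r)
    (hZ : IsGaussianNoise μ Z (armaSpectrum α β)) (h : IsAchievable μ Z (schemePower α β r) R) :
    R ≤ -Real.logb 2 |r| := by
  obtain ⟨d, v, l, hv, hl, hd, hq, hbal⟩ := exists_dissipation_constants hα hβ hr0 hr1 hr
  obtain ⟨c, hc, herr⟩ := h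
  have hP := (schemePower_pos hα hβ hr0 hr1).le
  set P := schemePower α β r
  set τ := 1 / r ^ 2 with hτdef
  have hτ : 0 < τ := by positivity
  have hlog2 : 0 < Real.log 2 := Real.log_pos one_lt_two
  have hs := tendsto_innovVar hα hβ
  have hg : Tendsto (innovGain α β) atTop (𝓝 α) := by
    have := (tendsto_const_nhds (x := α)).div hs one_ne_zero
    rwa [div_one] at this
  have hκ : Tendsto (fun i => (1 + v * (innovGain α β i - d) ^ 2) * innovVar α β i) atTop
      (𝓝 (1 + v * (α - d) ^ 2)) := by
    have := ((((hg.sub_const d).pow 2).const_mul v).const_add 1).mul hs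
    rwa [mul_one] at this
  have hright : Tendsto (fun n : ℕ => (n : ℝ)⁻¹ * Real.log 2 + (Real.log τ / 2 - 1 / 2) +
      (l * P + (n : ℝ)⁻¹ * ∑ i ∈ Finset.range n,
        (1 + v * (innovGain α β i - d) ^ 2) * innovVar α β i) / (2 * τ)) atTop
      (𝓝 (Real.log τ / 2)) := by
    have h1 := (tendsto_inv_atTop_nhds_zero_nat (𝕜 := ℝ)).mul_const (Real.log 2)
    have h2 := ((h1.add_const (Real.log τ / 2 - 1 / 2)).add
      ((hκ.cesaro.const_add (l * P)).div_const (2 * τ)))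
    have e : 0 * Real.log 2 + (Real.log τ / 2 - 1 / 2) + (l * P + (1 + v * (α - d) ^ 2)) / (2 * τ) =
        Real.log τ / 2 := by
      have : l * P + (1 + v * (α - d) ^ 2) = τ := by linarith
      rw [this]
      field_simp
      ring
    rwa [e] at h2
  have hleft : Tendsto (fun n : ℕ => R * Real.log 2 * (1 - (c n).errorProb μ Z)) atTop
      (𝓝 (R * Real.log 2)) := by
    simpa using (herr.const_sub 1).const_mul (R * Real.log 2)
  have hev : ∀ᶠ n : ℕ in atTop, R * Real.log 2 * (1 - (c n).errorProb μ Z) ≤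
      (n : ℝ)⁻¹ * Real.log 2 + (Real.log τ / 2 - 1 / 2) +
      (l * P + (n : ℝ)⁻¹ * ∑ i ∈ Finset.range n,
        (1 + v * (innovGain α β i - d) ^ 2) * innovVar α β i) / (2 * τ) := by
    filter_upwards [eventually_ge_atTop 1, herr.eventually_le_const one_pos] with n hn he
    have hn0 : (0 : ℝ) < n := by exact_mod_cast hn
    have h1 := log_mul_correct_le hβ hZ hτ hv hl hd hq hP hn (numMessages_pos n R) (c n) (hc n)
    have h2 : n * R * Real.log 2 ≤ Real.log (numMessages n R) := by
      rw [← Real.log_rpow two_pos]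
      exact Real.log_le_log (by positivity) (Nat.le_ceil _)
    have h3 := mul_le_mul_of_nonneg_right h2 (show 0 ≤ 1 - (c n).errorProb μ Z by linarith)
    have h4 := mul_le_mul_of_nonneg_left (h3.trans h1) (inv_pos.2 hn0).le
    have e1 : (n : ℝ)⁻¹ * (n * R * Real.log 2 * (1 - (c n).errorProb μ Z)) =
        R * Real.log 2 * (1 - (c n).errorProb μ Z) := by field_simp
    rw [e1] at h4
    refine h4.trans (le_of_eq ?_)
    field_simp
  have hfin := le_of_tendsto_of_tendsto hleft hright hev
  have hlτ : Real.log τ = -(2 * Real.log |r|) := by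
    rw [hτdef, one_div, Real.log_inv, ← sq_abs, Real.log_pow]; simp
  rw [hlτ] at hfin
  rw [Real.logb, ← neg_div, le_div_iff₀ hlog2]
  linarith

/-- The code that ignores the message. -/
noncomputable def trivialCode (n : ℕ) {M : ℕ} (hM : 0 < M) : FeedbackCode n M where
  enc _ _ _ := 0
  measurable_enc _ _ := measurable_const
  dec _ := ⟨0, hM⟩
  measurable_dec := measurable_const

omit [IsProbabilityMeasure μ] in
lemma avgPower_trivialCode (n : ℕ) {M : ℕ} (hM : 0 < M) :
    avgPower μ Z n (trivialCode n hM).enc = 0 := by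
  simp [avgPower, trivialCode, channelInput]

theorem isAchievable_of_lt (hα : α ∈ Set.Icc (-1 : ℝ) 1) (hβ : β ∈ Set.Ioo (-1 : ℝ) 1)
    (hr0 : r ≠ 0) (hr1 : |r| < 1) (hP : 0 < P) (hrP : schemePower α β r < P)
    (hZ : IsGaussianNoise μ Z (armaSpectrum α β)) (hR : R < -Real.logb 2 |r|) :
    IsAchievable μ Z P R := by
  classical
  have hest : IsGLS α β r (glsEstimator α β r) :=
    (isMinVarUnbiasedLinear_iff hβ hZ _).1 (isMinVarUnbiasedLinear_glsEstimator hβ hZ)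
  obtain ⟨C, hC, hCn⟩ := exists_inv_fisherInfo_le hα hβ hr0 hr1
  choose D hDm hD using fun n => exists_measurable_nearestPoint (numMessages_pos n R)
  let good : (n : ℕ) → FeedbackCode n (numMessages n R) := fun n =>
    schemeCode r (glsEstimator α β r) (fun y => D n (glsEstimator α β r n y))
      ((hDm n).comp (LinearMap.measurable_of_fin _))
  let c : (n : ℕ) → FeedbackCode n (numMessages n R) := fun n =>
    if avgPower μ Z n (good n).enc ≤ ENNReal.ofReal P then good n
    else trivialCode n (numMessages_pos n R)
  refine ⟨c, fun n => ?_, ?_⟩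
  · by_cases h : avgPower μ Z n (good n).enc ≤ ENNReal.ofReal P
    · simp only [c, if_pos h, h]
    · simp only [c, if_neg h, avgPower_trivialCode, zero_le]
  · have hlt : ENNReal.ofReal (schemePower α β r) < ENNReal.ofReal P :=
      (ENNReal.ofReal_lt_ofReal_iff hP).2 hrP
    have hev : ∀ᶠ n in atTop, c n = good n := by
      filter_upwards [(tendsto_sum_powerBound hα hβ hr0 hr1).eventually_le_const hlt] with n hn
      exact if_pos ((avgPower_le hβ hZ hest n _).trans hn)
    have hr : 0 < |r| := abs_pos.2 hr0
    have hlim : Tendsto (fun n : ℕ => Real.exp (-((2 * C)⁻¹ * ((|r|⁻¹ / (2 : ℝ) ^ R) ^ 2) ^ n)))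
        atTop (𝓝 0) := by
      refine Real.tendsto_exp_neg_atTop_nhds_zero.comp ?_
      exact (tendsto_pow_atTop_atTop_of_one_lt (one_lt_doubleExp_base hr hR)).const_mul_atTop
        (by positivity)
    refine tendsto_of_tendsto_of_tendsto_of_le_of_le' tendsto_const_nhds hlim ?_ ?_
    · exact Eventually.of_forall fun n => by
        unfold FeedbackCode.errorProb
        exact div_nonneg (Finset.sum_nonneg fun w _ => measureReal_nonneg) (Nat.cast_nonneg _)
    · filter_upwards [hev, eventually_ge_atTop 1] with n hn hn1
      rw [hn]
      refine (errorProb_schemeCode_le_erfc hβ hZ hest hr0 hC hCn hn1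
        (ae_of_all _ fun y => hD n _)).trans ?_
      have e : r⁻¹ ^ (2 * n) = |r|⁻¹ ^ (2 * n) := by
        rw [inv_pow, inv_pow, pow_mul, pow_mul, sq_abs]
      rw [e]
      exact erfc_le_doubleExp (by positivity) hr n

theorem feedbackCapacity_eq (hα : α ∈ Set.Icc (-1 : ℝ) 1) (hβ : β ∈ Set.Ioo (-1 : ℝ) 1)
    (hP : 0 < P) (hZ : IsGaussianNoise μ Z (armaSpectrum α β)) {x : ℝ} (hx0 : 0 < x) (hx1 : x < 1)
    (hxP : schemePower α β (armaSign α β * x) = P) :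
    feedbackCapacity μ Z P = ((-Real.logb 2 x : ℝ) : EReal) := by
  have hσ : armaSign α β ≠ 0 := abs_pos.1 (by rw [abs_armaSign]; exact one_pos)
  refine le_antisymm (iSup₂_le fun R hR => EReal.coe_le_coe_iff.2 ?_) ?_
  · rw [← hxP] at hR
    have h := le_of_isAchievable hα hβ (mul_ne_zero hσ hx0.ne')
      (by rwa [abs_armaSign_mul hx0]) (by
        have := mul_nonneg (armaSign_mul_sub_nonneg α β) hx0.le
        linarith) hZ hR
    rwa [abs_armaSign_mul hx0] at h
  · refine le_of_forall_lt fun y hy => ?_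
    obtain ⟨R, hyR, hR⟩ := EReal.lt_iff_exists_real_btwn.1 hy
    rw [EReal.coe_lt_coe_iff, ← Real.logb_inv, Real.lt_logb_iff_rpow_lt one_lt_two
      (inv_pos.2 hx0)] at hR
    have hxR : x < ((2 : ℝ) ^ R)⁻¹ := by
      rwa [lt_inv_comm₀ hx0 (by positivity)]
    obtain ⟨x', h1, h2⟩ := exists_between (lt_min hx1 hxR)
    have hx'0 := hx0.trans h1
    have hx'1 := h2.trans_le (min_le_left _ _)
    have hx'R := h2.trans_le (min_le_right _ _)
    refine hyR.trans_le (le_iSup₂_of_le R ?_ le_rfl)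
    refine isAchievable_of_lt (r := armaSign α β * x') hα hβ (mul_ne_zero hσ hx'0.ne')
      (by rwa [abs_armaSign_mul hx'0]) hP ?_ hZ ?_
    · rw [← hxP]; exact schemePower_lt hα hβ hx0 h1 hx'1
    · rw [abs_armaSign_mul hx'0, ← Real.logb_inv, Real.lt_logb_iff_rpow_lt one_lt_two
        (inv_pos.2 hx'0), lt_inv_comm₀ (by positivity) hx'0]
      exact hx'R

end capacity

theorem mainTheorem4 {Ω : Type*} [MeasurableSpace Ω] (μ : Measure Ω) [IsProbabilityMeasure μ]
    (α β P : ℝ) (hα : α ∈ Set.Icc (-1 : ℝ) 1) (hβ : β ∈ Set.Ioo (-1 : ℝ) 1) (hP : 0 < P)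
    (Z : ℕ → Ω → ℝ) (hZ : IsGaussianNoise μ Z (armaSpectrum α β)) :
    ∃ x : ℝ, (IsArmaRoot α β P x ∧ ∀ x', IsArmaRoot α β P x' → x' = x) ∧
      -- the linear scheme with a Gaussian message has rate at least `-log x` and power at most `P`
      (∀ V : Ω → ℝ, Measurable V → HasLaw V (gaussianReal 0 1) μ →
        IndepFun V (fun ω (i : ℕ) => Z i ω) μ →
        ENNReal.ofReal (-Real.logb 2 x) ≤
          liminf (fun n : ℕ =>
            mutualInfoBits μ V (gaussianSchemeEstimate μ Z V (armaSign α β * x) n) / (n : ℝ≥0∞))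
            atTop ∧
        limsup (fun n : ℕ => (∑ i ∈ Finset.range n,
            ∫⁻ ω, ENNReal.ofReal (gaussianSchemeInput μ Z V (armaSign α β * x) i ω ^ 2) ∂μ)
            / (n : ℝ≥0∞)) atTop ≤ ENNReal.ofReal P) ∧
      -- the linear scheme with an equally spaced constellation
      (∃ est, IsMinVarUnbiasedLinear μ Z (armaSign α β * x) est) ∧
      (∃ c₀ : ℝ, 0 < c₀ ∧ ∀ est, IsMinVarUnbiasedLinear μ Z (armaSign α β * x) est →
        ∀ R : ℝ, 0 ≤ R →
          -- average power
          limsup (fun n : ℕ => avgPower μ Z n (fun w : Fin (numMessages n R) =>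
            schemeMap (armaSign α β * x) est (constellation (numMessages n R) w))) atTop
              ≤ ENNReal.ofReal P ∧
          -- nearest-point decoding is maximum-likelihood decoding, and its error probability
          (∀ n : ℕ, 1 ≤ n →
            (∃ D : (Fin n → ℝ) → Fin (numMessages n R), Measurable D ∧
              ∀ y, IsNearestPoint (est n y) (D y)) ∧
            ∀ (D : (Fin n → ℝ) → Fin (numMessages n R)) (hD : Measurable D),
              ((schemeCode (armaSign α β * x) est D hD).IsMaximumLikelihood μ Z ↔
                ∀ᵐ y ∂(volume : Measure (Fin n → ℝ)), IsNearestPoint (est n y) (D y)) ∧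
              ((schemeCode (armaSign α β * x) est D hD).IsMaximumLikelihood μ Z →
                (schemeCode (armaSign α β * x) est D hD).errorProb μ Z ≤
                  erfc (Real.sqrt (c₀ * x⁻¹ ^ (2 * n) / (2 : ℝ) ^ (2 * (n : ℝ) * R))))) ∧
          -- doubly exponential decay at all rates below `-log x`
          (R < -Real.logb 2 x → ∃ a ρ : ℝ, 0 < a ∧ 1 < ρ ∧ ∀ n : ℕ, 1 ≤ n →
            ∀ (D : (Fin n → ℝ) → Fin (numMessages n R)) (hD : Measurable D),
              (schemeCode (armaSign α β * x) est D hD).IsMaximumLikelihood μ Z →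
                (schemeCode (armaSign α β * x) est D hD).errorProb μ Z ≤
                  Real.exp (-(a * ρ ^ n)))) ∧
      -- the rate `-log x` is the feedback capacity
      feedbackCapacity μ Z P = ((-Real.logb 2 x : ℝ) : EReal) := by
  obtain ⟨x, hx0, hx1, hxP⟩ := exists_root hβ hP
  have hσ : armaSign α β ≠ 0 := abs_pos.1 (by rw [abs_armaSign]; exact one_pos)
  have hr0 : armaSign α β * x ≠ 0 := mul_ne_zero hσ hx0.ne'
  have hrx : |armaSign α β * x| = x := abs_armaSign_mul hx0
  have hr1 : |armaSign α β * x| < 1 := by rwa [hrx]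
  have hpow : ∀ n, (armaSign α β * x)⁻¹ ^ (2 * n) = x⁻¹ ^ (2 * n) := fun n => by
    rw [inv_pow, inv_pow, pow_mul, pow_mul, mul_pow, armaSign_sq, one_mul]
  obtain ⟨C, hC, hCn⟩ := exists_inv_fisherInfo_le hα hβ hr0 hr1
  refine ⟨x, ⟨(isArmaRoot_iff hβ hP x).2 ⟨hx0, hx1, hxP⟩, fun x' hx' => ?_⟩,
    fun V hVm hV _ => ⟨?_, ?_⟩, ⟨_, isMinVarUnbiasedLinear_glsEstimator hβ hZ⟩,
    ⟨(2 * C)⁻¹, by positivity, fun est hest R hR => ?_⟩,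
    feedbackCapacity_eq hα hβ hP hZ hx0 hx1 hxP⟩
  · obtain ⟨h0, h1, h2⟩ := (isArmaRoot_iff hβ hP x').1 hx'
    rcases lt_trichotomy x' x with h | h | h
    · have := schemePower_lt hα hβ h0 h hx1
      rw [hxP, h2] at this
      exact absurd this (lt_irrefl _)
    · exact h
    · have := schemePower_lt hα hβ hx0 h h1
      rw [hxP, h2] at this
      exact absurd this (lt_irrefl _)
  · have := le_liminf_mutualInfoBits hα hβ hr0 hr1 hZ hVm hV
    rwa [hrx] at this
  · have := limsup_gaussianScheme_power_le hα hβ hr0 hr1 hZ hVm hV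
    rwa [hxP] at this
  · have hgls : IsGLS α β (armaSign α β * x) est := (isMinVarUnbiasedLinear_iff hβ hZ est).1 hest
    have herr : ∀ n, 1 ≤ n → ∀ (D : (Fin n → ℝ) → Fin (numMessages n R)) (hD : Measurable D),
        (schemeCode (armaSign α β * x) est D hD).IsMaximumLikelihood μ Z →
        (schemeCode (armaSign α β * x) est D hD).errorProb μ Z ≤
          erfc (Real.sqrt ((2 * C)⁻¹ * x⁻¹ ^ (2 * n) / (2 : ℝ) ^ (2 * (n : ℝ) * R))) := by
      intro n hn D hD hML
      rw [← hpow]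
      exact errorProb_schemeCode_le_erfc hβ hZ hgls hr0 hC hCn hn
        ((isMaximumLikelihood_schemeCode_iff hβ hZ hgls hn).1 hML)
    refine ⟨?_, fun n hn => ⟨?_, fun D hD =>
      ⟨isMaximumLikelihood_schemeCode_iff hβ hZ hgls hn, herr n hn D hD⟩⟩, fun hRx => ?_⟩
    · rw [← hxP, ← (tendsto_sum_powerBound hα hβ hr0 hr1).limsup_eq]
      exact limsup_le_limsup (Eventually.of_forall fun n => avgPower_le hβ hZ hgls n _)
    · obtain ⟨D, hDm, hD⟩ := exists_measurable_nearestPoint (numMessages_pos n R)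
      exact ⟨fun y => D (est n y), hDm.comp (LinearMap.measurable_of_fin _), fun y => hD _⟩
    · exact ⟨(2 * C)⁻¹, (x⁻¹ / (2 : ℝ) ^ R) ^ 2, by positivity, one_lt_doubleExp_base hx0 hRx,
        fun n hn D hD hML => (herr n hn D hD hML).trans (erfc_le_doubleExp (by positivity) hx0 n)⟩
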